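/- Let $n\ge 4$ and $s\ge 0$ be integers, and let $\tilde B^{2,s}$ be the affine crystal of type $D_n^{(1)}$ defined as follows. *Tableaux.* Order the letters by $1<2<\dots<n-1<\{n,\bar n\}<\overline{n-1}<\dots<\bar 1$, with $n,\bar n$ incomparable, put $\bar{\bar\imath}=i$, and write $\binom ab$ for the column with $a$ above $b$. Let $\mathcal T(s)$ be the set of $2\times s$ tableaux such that (1) rows weakly increase; (2) no column $\binom ab$ has $b\le a$; (4) there is no configuration $\binom{n-1}{n}\cdots\binom{n}{\overline{n-1}}$ or $\binom{n-1}{\bar n}\cdots\binom{\bar n}{\overline{n-1}}$. Let $B(k\varpi_2)$ be the set of $2\times k$ tableaux satisfying (1), (2), (4) and also: (3) there are no adjacent columns $\binom a*\binom a{\bar a}$ or $\binom a{\bar a}\binom *{\bar a}$; (5) there is no column $\binom1{\bar1}$. For $1\le i\le n$ the Kashiwara operators $\tilde e_i,\tilde f_i$ act on $B(k\varpi_2)$ by the signature (tensor product) rule on the column word $b_1a_1\cdots b_ka_k$ of $\binom{a_1}{b_1}\cdots\binom{a_k}{b_k}$: with the convention that $\tilde f_i(b_2\otimes b_1)=\tilde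 f_i(b_2)\otimes b_1$ if $\varepsilon_i(b_2)\ge\varphi_i(b_1)$ and $b_2\otimes\tilde f_i(b_1)$ otherwise, and $\tilde e_i(b_2\otimes b_1)=\tilde e_i(b_2)\otimes b_1$ if $\varepsilon_i(b_2)>\varphi_i(b_1)$ and $b_2\otimes\tilde e_i(b_1)$ otherwise; on letters, $\tilde f_i: i\mapsto i+1,\ \overline{i+1}\mapsto\bar\imath$ for $i<n$, $\tilde f_n: n-1\mapsto\bar n,\ n\mapsto\overline{n-1}$, all other letters are sent to $\varnothing$, and $\tilde e_i$ is the partial inverse of $\tilde f_i$. *Drop and fill.* The bijection $D:\mathcal T(s)\to\bigsqcup_{k=0}^s B(k\varpi_2)$ sends $\binom1{\bar1}^s$ to the empty tableau and fixes $B(s\varpi_2)$. Any other $T$ contains, for a unique $a\in\{1,\dots,n,\bar n\}$ and a unique $m>0$, one of the following: a maximal block $\binom a{\bar a}^m$ immediately preceded by a column $\binom ab$ with $b\ne\bar a$; a maximal block $\binom a{\bar a}^m$ immediately followed by a column $\binom d{\bar a}$ with $d\neq a$; or a block $\binom a{\bar a}^{m+1}$ not immediately preceded by a column with top entry $a$ and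 not immediately followed by a column with bottom entry $\bar a$. Then $D(T)$ is $T$ with $m$ of these columns $\binom a{\bar a}$ removed. Let $F=D^{-1}$ and put $\tilde e_i=F\tilde e_iD$, $\tilde f_i=F\tilde f_iD$ on $\mathcal T(s)$ for $1\le i\le n$. We regard $B(k\varpi_2)$ as a subset of $\mathcal T(s)$ through $F$. *The involution $\sigma$.* The connected components of $\mathcal T(s)$ under the arrows $2,\dots,n$ are $U_q(D_{n-1})$-crystals, and each has a unique highest weight vector (an element annihilated by $\tilde e_2,\dots,\tilde e_n$). They are the vertices of the branching component graph, in which $v,w$ are joined if $\tilde f_1$ maps some element of $v$ into $w$. A vertex $v\subset B(k\varpi_2)$ is labelled by its shape, the partition $\lambda=(\lambda_1,\lambda_2)$ such that $\lambda_1\epsilon_2+\lambda_2\epsilon_3$ is the $D_{n-1}$-weight of its highest weight vector, and has rank $R(v)=r_k(v)+s-k$, where $r_k(v)$ is the graph distance from $v$ to the vertex containing the highest weight vector $\binom12^k$ of $B(k\varpi_2)$. A vertex is determined by its component $k$, shape and rank. For $v\subset B(k\varpi_2)$ let $\ell$ be the least index such that $B(\ell\varpi_2)$ contains a vertex of the same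 shape and rank as $v$, and let $\check\sigma(v)$ be the vertex of the same shape and of rank $2s-R(v)$ in $B((s+\ell-k)\varpi_2)$. If $b=\tilde f_{i_1}\cdots\tilde f_{i_m}u$ with $i_1,\dots,i_m\in\{2,\dots,n\}$ and $u$ the highest weight vector of the vertex $v$ containing $b$, then $\sigma(b)=\tilde f_{i_1}\cdots\tilde f_{i_m}u^\dagger$, where $u^\dagger$ is the highest weight vector of $\check\sigma(v)$. Finally $\tilde e_0=\sigma\tilde e_1\sigma$ and $\tilde f_0=\sigma\tilde f_1\sigma$. The crystal $\tilde B^{2,s}$ is $\mathcal T(s)$ with $\tilde e_i,\tilde f_i$ for $0\le i\le n$. *Levels.* Put $\varepsilon_i(t)=\max\{m\ge0:\tilde e_i^m(t)\ne\varnothing\}$, $\varphi_i(t)=\max\{m\ge0:\tilde f_i^m(t)\neq\varnothing\}$, $\varepsilon(t)=\sum_{i=0}^n\varepsilon_i(t)\Lambda_i$, $\varphi(t)=\sum_{i=0}^n\varphi_i(t)\Lambda_i$, where the $\Lambda_i$ are the fundamental weights, and let $c=h_0+h_1+2h_2+\dots+2h_{n-2}+h_{n-1}+h_n$ be the canonical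 central element, where $\langle h_i,\Lambda_j\rangle=\delta_{ij}$. **Lemma.** For every $t\in\tilde B^{2,s}$, $$\langle c,\varepsilon(t)\rangle\ge s\qquad\text{and}\qquad\langle c,\varphi(t)\rangle\ge s.$$ -/

import Mathlib

/-!
The affine crystal `B̃^{2,s}` of type `D_n^{(1)}`, built on tableaux of shape `(s,s)`.

Encoding.  The letters `1, …, n, n̄, …, 1̄` are the integers `x` with `1 ≤ |x| ≤ n`: the unbarred
letter `i` is `i`, the barred letter `ī` is `-i`; thus `x ↦ -x` is the bar involution.
A tableau with two rows of equal length is the list of its columns, read from left to right; the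
column with `a` above `b` is the pair `(a, b)`.  The symbol `∅` of a crystal is `none`.
-/

namespace KRCrystal

/-! ### The alphabet -/

/-- `x` is one of the letters `1, …, n, n̄, …, 1̄`. -/
def IsLetter (n : ℕ) (x : ℤ) : Prop := 1 ≤ |x| ∧ |x| ≤ n

/-- The height of a letter in the poset `1 < 2 < ⋯ < n-1 < n, n̄ < (n-1)‾ < ⋯ < 1̄`;
only the incomparable letters `n` and `n̄` share a height. -/
def height (n : ℕ) (x : ℤ) : ℤ := if 0 < x then x else 2 * n + x

/-- The partial order of the alphabet. -/
def LetterLE (n : ℕ) (a b : ℤ) : Prop := a = b ∨ height n a < height n b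

/-! ### Tableaux -/

/-- A two-row rectangular array, as the list of its columns `(top, bottom)`. -/
abbrev Tableau := List (ℤ × ℤ)

/-- All entries are letters, the rows weakly increase, no column has `bottom ≤ top`, and there is
no configuration `(n-1 over n) … (n over (n-1)‾)` or `(n-1 over n̄) … (n̄ over (n-1)‾)`. -/
structure IsLegal (n : ℕ) (T : Tableau) : Prop where
  letters : ∀ c ∈ T, IsLetter n c.1 ∧ IsLetter n c.2
  rows : T.IsChain (fun c d => LetterLE n c.1 d.1 ∧ LetterLE n c.2 d.2)
  columns : ∀ c ∈ T, ¬ LetterLE n c.2 c.1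
  middle : T.Pairwise (fun c d =>
    ¬ (c = ((n : ℤ) - 1, (n : ℤ)) ∧ d = ((n : ℤ), -((n : ℤ) - 1))) ∧
    ¬ (c = ((n : ℤ) - 1, -(n : ℤ)) ∧ d = (-(n : ℤ), -((n : ℤ) - 1))))

/-- The Kashiwara--Nakashima tableaux of shape `(k,k)`, i.e. the elements of `B(kϖ₂)`: legal, and
in addition there are no adjacent columns `(a over *)(a over ā)` or `(a over ā)(* over ā)`, and no
column `(1 over 1̄)`. -/
structure IsKN (n k : ℕ) (T : Tableau) : Prop where
  length_eq : T.length = k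
  legal : IsLegal n T
  adjacent : T.IsChain (fun c d =>
    ¬ (d.1 = c.1 ∧ d.2 = -c.1) ∧ ¬ (c.2 = -c.1 ∧ d.2 = -c.1))
  no_one : ((1 : ℤ), (-1 : ℤ)) ∉ T

/-- The underlying set `𝒯(s)` of `B̃^{2,s}`. -/
abbrev Btilde (n s : ℕ) := {T : Tableau // T.length = s ∧ IsLegal n T}

/-! ### Classical Kashiwara operators on words and on `B(kϖ₂)` -/

/-- `f̃_i` (`1 ≤ i ≤ n`) on the crystal `B(ϖ₁)` of letters. -/
def letterF (n i : ℕ) (x : ℤ) : Option ℤ :=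
  if 1 ≤ i ∧ i < n then
    if x = i then some ((i : ℤ) + 1) else if x = -((i : ℤ) + 1) then some (-(i : ℤ)) else none
  else if i = n then
    if x = (n : ℤ) - 1 then some (-(n : ℤ))
    else if x = n then some (-((n : ℤ) - 1)) else none
  else none

/-- `ẽ_i` (`1 ≤ i ≤ n`) on the crystal `B(ϖ₁)` of letters. -/
def letterE (n i : ℕ) (x : ℤ) : Option ℤ :=
  if 1 ≤ i ∧ i < n then
    if x = (i : ℤ) + 1 then some (i : ℤ) else if x = -(i : ℤ) then some (-((i : ℤ) + 1)) else none
  else if i = n then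
    if x = -(n : ℤ) then some ((n : ℤ) - 1)
    else if x = -((n : ℤ) - 1) then some (n : ℤ) else none
  else none

/-- `φ_i` of a letter; every string in `B(ϖ₁)` has length at most one. -/
def letterPhi (n i : ℕ) (x : ℤ) : ℕ := if (letterF n i x).isSome then 1 else 0

/-- `ε_i` of a letter. -/
def letterEps (n i : ℕ) (x : ℤ) : ℕ := if (letterE n i x).isSome then 1 else 0

/-- `φ_i` of the word `x₁ x₂ ⋯ x_m`, viewed as `x₁ ⊗ x₂ ⊗ ⋯ ⊗ x_m`:
`φ(b₂ ⊗ b₁) = φ(b₂) + max(0, φ(b₁) - ε(b₂))` (the subtraction is the truncated one of `ℕ`). -/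
def wordPhi (n i : ℕ) : List ℤ → ℕ
  | [] => 0
  | x :: w => letterPhi n i x + (wordPhi n i w - letterEps n i x)

/-- `f̃_i` on words by the tensor product rule:
`f̃(b₂ ⊗ b₁)` is `f̃(b₂) ⊗ b₁` if `ε(b₂) ≥ φ(b₁)` and `b₂ ⊗ f̃(b₁)` otherwise. -/
def wordF (n i : ℕ) : List ℤ → Option (List ℤ)
  | [] => none
  | x :: w =>
    if wordPhi n i w ≤ letterEps n i x then (letterF n i x).map (fun y => y :: w)
    else (wordF n i w).map (fun v => x :: v)

/-- `ẽ_i` on words by the tensor product rule: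
`ẽ(b₂ ⊗ b₁)` is `ẽ(b₂) ⊗ b₁` if `ε(b₂) > φ(b₁)` and `b₂ ⊗ ẽ(b₁)` otherwise. -/
def wordE (n i : ℕ) : List ℤ → Option (List ℤ)
  | [] => none
  | x :: w =>
    if wordPhi n i w < letterEps n i x then (letterE n i x).map (fun y => y :: w)
    else (wordE n i w).map (fun v => x :: v)

/-- The column word `b₁ a₁ b₂ a₂ ⋯ b_k a_k` of a tableau. -/
def colWord : Tableau → List ℤ
  | [] => []
  | c :: T => c.2 :: c.1 :: colWord T

/-- The tableau with a given column word. -/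
def ofColWord : List ℤ → Tableau
  | b :: a :: w => (a, b) :: ofColWord w
  | _ => []

/-- `f̃_i` (`1 ≤ i ≤ n`) on `⨁_k B(kϖ₂)`. -/
def knF (n i : ℕ) (t : Tableau) : Option Tableau := (wordF n i (colWord t)).map ofColWord

/-- `ẽ_i` (`1 ≤ i ≤ n`) on `⨁_k B(kϖ₂)`. -/
def knE (n i : ℕ) (t : Tableau) : Option Tableau := (wordE n i (colWord t)).map ofColWord

/-! ### The height-two drop and fill maps -/

/-- `t` arises from `T` by removing the `m` columns `(a over ā)` of an `a`-configuration of `T`,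
with `a ∈ {1, …, n, n̄}` and `m > 0`.  The three cases are the three kinds of `a`-configuration;
neighbouring columns may be absent, except the one that shares an `a` or an `ā` with the block in
the first two kinds. -/
def DropsTo (n : ℕ) (T t : Tableau) : Prop :=
  ∃ (a : ℤ) (m : ℕ) (L R : Tableau), ((1 ≤ a ∧ a ≤ n) ∨ a = -(n : ℤ)) ∧ 0 < m ∧
    ((T = L ++ List.replicate m (a, -a) ++ R ∧ t = L ++ R ∧
        (∃ c ∈ L.getLast?, c.1 = a ∧ c.2 ≠ -a) ∧ (∀ d ∈ R.head?, d ≠ (a, -a))) ∨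
     (T = L ++ List.replicate m (a, -a) ++ R ∧ t = L ++ R ∧
        (∀ c ∈ L.getLast?, c ≠ (a, -a)) ∧ (∃ d ∈ R.head?, d.1 ≠ a ∧ d.2 = -a)) ∨
     (T = L ++ List.replicate (m + 1) (a, -a) ++ R ∧ t = L ++ [(a, -a)] ++ R ∧
        (∀ c ∈ L.getLast?, c.1 ≠ a) ∧ (∀ d ∈ R.head?, d.2 ≠ -a)))

open Classical in
/-- The height-two drop map `D_{2,s} : 𝒯(s) → ⨁_{k ≤ s} B(kϖ₂)`. -/
noncomputable def drop {n s : ℕ} (T : Btilde n s) : Tableau :=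
  if T.1 = List.replicate s (1, -1) then []
  else if IsKN n s T.1 then T.1
  else Classical.epsilon (fun t => DropsTo n T.1 t)

open Classical in
/-- The height-two fill map `F_{2,s} : ⨁_{k ≤ s} B(kϖ₂) → 𝒯(s)`, the inverse of the bijection
`D_{2,s}` (`none` is only returned off `⨁_{k ≤ s} B(kϖ₂)`). -/
noncomputable def fill (n s : ℕ) (t : Tableau) : Option (Btilde n s) :=
  if h : ∃ T : Btilde n s, drop T = t then some h.choose else none

/-- `f̃_i = F_{2,s} ∘ f̃_i ∘ D_{2,s}` on `𝒯(s)`, for `1 ≤ i ≤ n`. -/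
noncomputable def classF {n s : ℕ} (i : ℕ) (T : Btilde n s) : Option (Btilde n s) :=
  (knF n i (drop T)).bind (fill n s)

/-- `ẽ_i = F_{2,s} ∘ ẽ_i ∘ D_{2,s}` on `𝒯(s)`, for `1 ≤ i ≤ n`. -/
noncomputable def classE {n s : ℕ} (i : ℕ) (T : Btilde n s) : Option (Btilde n s) :=
  (knE n i (drop T)).bind (fill n s)

/-! ### The branching component graph -/

/-- The index `k` of the classical component `B(kϖ₂) ⊆ B̃^{2,s}` that contains `T`. -/
noncomputable def compIndex {n s : ℕ} (T : Btilde n s) : ℕ := (drop T).length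

/-- The `ε_j`-coordinate of the classical weight of `T`: the number of letters `j` minus the number
of letters `j̄` in the corresponding element of `B(kϖ₂)`. -/
noncomputable def wt {n s : ℕ} (T : Btilde n s) (j : ℕ) : ℤ :=
  ((colWord (drop T)).count (j : ℤ) : ℤ) - ((colWord (drop T)).count (-(j : ℤ)) : ℤ)

/-- `T` is a highest weight vector for `U_q(D_{n-1})`, whose Dynkin nodes are `2, …, n`. -/
def IsLeviHighest {n s : ℕ} (T : Btilde n s) : Prop :=
  ∀ i : ℕ, 2 ≤ i → i ≤ n → classE i T = none

/-- The crystal graph of `𝒯(s)` with only the arrows of colours `2, …, n`, without orientation. -/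
noncomputable def leviGraph (n s : ℕ) : SimpleGraph (Btilde n s) :=
  SimpleGraph.fromRel (fun T T' => ∃ i : ℕ, 2 ≤ i ∧ i ≤ n ∧ classF i T = some T')

/-- Branching component vertices: the connected components under the colours `2, …, n`. -/
abbrev BCVertex (n s : ℕ) := (leviGraph n s).ConnectedComponent

/-- The branching component vertex `v` with `T ∈ B(v)`. -/
noncomputable def bcVertex {n s : ℕ} (T : Btilde n s) : BCVertex n s :=
  (leviGraph n s).connectedComponentMk T

/-- The branching component graph of `B̃^{2,s}`, without orientation: `v` and `w` are joined if
`f̃_1` sends some element of `B(v)` into `B(w)`. -/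
noncomputable def bcGraph (n s : ℕ) : SimpleGraph (BCVertex n s) :=
  SimpleGraph.fromRel (fun v w =>
    ∃ T T' : Btilde n s, bcVertex T = v ∧ bcVertex T' = w ∧ classF 1 T = some T')

/-- `v` is the vertex of the branching component graph of `B(kϖ₂) ⊆ B̃^{2,s}` that is labelled by
the partition `(p, q)` and has rank `r`.

The label says that the `U_q(D_{n-1})`-highest weight vector in `B(v)` has weight
`p ε₂ + q ε₃`.  The rank is `R(v) = r_k(v) + s - k`, where `r_k(v)` is the graph distance of `v`
from the vertex that contains the highest weight vector `(1 over 2)^k` of `B(kϖ₂)`. -/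
def IsVertex {n s : ℕ} (k p q r : ℕ) (v : BCVertex n s) : Prop :=
  (∃ u : Btilde n s, bcVertex u = v ∧ compIndex u = k ∧ IsLeviHighest u ∧
    ∀ j : ℕ, 2 ≤ j → j ≤ n → wt u j = if j = 2 then (p : ℤ) else if j = 3 then (q : ℤ) else 0) ∧
  (∃ u : Btilde n s, drop u = List.replicate k (1, 2) ∧
    r = (bcGraph n s).dist (bcVertex u) v + (s - k))

/-- `w = σ̌(v)`.  For `v` in the component `k`, of shape `(p, q)` and rank `r`, let `ℓ` be minimal
such that the image of `v` under the embedding of the branching component graph of `B(kϖ₂)` into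
that of `B(sϖ₂)` lies in the image of that of `B(ℓϖ₂)`.  These embeddings preserve shapes and
ranks, which together determine a vertex of a given component; so `ℓ` is the least component with
a vertex of shape `(p, q)` and rank `r`.  Then `σ̌(v)` is the vertex of shape `(p, q)` and rank
`2s - r` in the component `s + ℓ - k`. -/
def IsSigmaCheck {n s : ℕ} (v w : BCVertex n s) : Prop :=
  ∃ k l p q r r' : ℕ, IsVertex k p q r v ∧
    IsLeast {j : ℕ | ∃ v' : BCVertex n s, IsVertex j p q r v'} l ∧
    r + r' = 2 * s ∧ IsVertex (s + l - k) p q r' w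

/-! ### The involution `σ` and the affine operators -/

/-- `f̃_{i₁} ⋯ f̃_{i_m} (T)` for the list `[i₁, …, i_m]` of indices in `{1, …, n}`. -/
noncomputable def applyF {n s : ℕ} : List ℕ → Btilde n s → Option (Btilde n s)
  | [], T => some T
  | i :: w, T => (applyF w T).bind (classF i)

/-- `b' = σ(b)`: for some `i₁, …, i_m ∈ {2, …, n}`, `b = f̃_{i₁} ⋯ f̃_{i_m} u` and
`b' = f̃_{i₁} ⋯ f̃_{i_m} u'`, where `u` and `u'` are the `U_q(D_{n-1})`-highest weight vectors of
the vertex `v` containing `b` and of `σ̌(v)`. -/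
def IsSigma {n s : ℕ} (b b' : Btilde n s) : Prop :=
  ∃ (w : List ℕ) (u u' : Btilde n s), (∀ i ∈ w, 2 ≤ i ∧ i ≤ n) ∧
    IsLeviHighest u ∧ IsLeviHighest u' ∧ IsSigmaCheck (bcVertex u) (bcVertex u') ∧
    applyF w u = some b ∧ applyF w u' = some b'

open Classical in
/-- The involution `σ` of `B̃^{2,s}`. -/
noncomputable def sigma {n s : ℕ} (b : Btilde n s) : Btilde n s :=
  if h : ∃ b', IsSigma b b' then h.choose else b

/-- `f̃_i` on `B̃^{2,s}` for `0 ≤ i ≤ n`, with `f̃_0 = σ f̃_1 σ`. -/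
noncomputable def opF {n s : ℕ} (i : ℕ) (T : Btilde n s) : Option (Btilde n s) :=
  if i = 0 then (classF 1 (sigma T)).map sigma else classF i T

/-- `ẽ_i` on `B̃^{2,s}` for `0 ≤ i ≤ n`, with `ẽ_0 = σ ẽ_1 σ`. -/
noncomputable def opE {n s : ℕ} (i : ℕ) (T : Btilde n s) : Option (Btilde n s) :=
  if i = 0 then (classE 1 (sigma T)).map sigma else classE i T

/-! ### Levels -/

/-- `max {m ≥ 0 | g^m(T) ≠ ∅}`. -/
noncomputable def stringLength {X : Type*} (g : X → Option X) (T : X) : ℕ :=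
  sSup {m : ℕ | (fun o : Option X => o.bind g)^[m] (some T) ≠ none}

/-- A weight `∑ λ_i Λ_i` of `P_cl`, as the family of its coordinates `λ_i = ⟨h_i, λ⟩`. -/
abbrev ClWeight (n : ℕ) := Fin (n + 1) → ℤ

/-- `ε(T) = ∑_i ε_i(T) Λ_i`. -/
noncomputable def epsWt {n s : ℕ} (T : Btilde n s) : ClWeight n :=
  fun i => (stringLength (opE (i : ℕ)) T : ℤ)

/-- `φ(T) = ∑_i φ_i(T) Λ_i`. -/
noncomputable def phiWt {n s : ℕ} (T : Btilde n s) : ClWeight n :=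
  fun i => (stringLength (opF (i : ℕ)) T : ℤ)

/-- `⟨c, λ⟩` for the canonical central element
`c = h_0 + h_1 + 2 h_2 + ⋯ + 2 h_{n-2} + h_{n-1} + h_n` of `D_n^{(1)}`. -/
def cPairing (n : ℕ) (lam : ClWeight n) : ℤ :=
  ∑ i : Fin (n + 1), (if 2 ≤ (i : ℕ) ∧ (i : ℕ) + 2 ≤ n then 2 else 1) * lam i

end KRCrystal

namespace KRCrystal

/-! ### Signature rule on words -/

/-! Drop and fill identify 𝒯(s) with the column words of the components B(kϖ₂), k ≤ s, so that all
string lengths become `wordPhi` and `wordEps`. Write x₁, x₂, … for the coordinates of the classical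
weight of t.

Two reductions come from σ, which negates x₁ and keeps x₂ and all φ_i with i ≥ 2. The classical part
of c takes the value x₁ + x₂ on the weight of t (`sum_mark_coroot`) and node 0 contributes -x₁ - x₂,
so ε and φ have the same level (`cPairing_epsWt_eq`) and only φ needs a bound. Moreover σ exchanges
φ_0 and φ_1 (`cPairing_phiWt_sigma`), so one may assume x₁ ≥ 0.

Two bounds then add up to s. Let σ(t) lie in the component k, in a vertex of shape (p, q); then t
lies in the component s + p - k. (a) φ_0(t) = φ_1(σ(t)) ≥ k - p: lowering with colours 2, …, n never
decreases φ_1 (`wordPhi_one_le_of_wordF`), and φ_1 = k - p at the highest weight vector of the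
vertex (`Blocks.HasLabel.wordPhi_one`). (b) The colours 1, …, n contribute at least the component
index K of t (`compIndex_le_sum_mark`). Indeed B(Kϖ₂) is also the component of the word 2^K 1^K,
whose elements are words YX made of two rows, with Y of length K. For x₁ ≥ 0 the row Y contains
neither 1 nor 1̄. Since φ_i(YX) ≥ φ_i(Y), it suffices that the level of such a row is at least its
length, which follows by distributing one unit for each letter over the colours (`sum_contribution`,
`sum_contribution_le`).

This requires σ in explicit form. The highest weight vectors for the colours 2, …, n consist of six
blocks of columns (`Blocks.exists_tableau_eq`) and are determined by the component k, the shape (p,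
q) and the coordinate d = x₁. Such a vertex has rank s - d, the index ℓ is p, and σ̌ sends (k, p, q,
d) to (s + p - k, p, q, -d) (`isSigmaCheck_iff`).

That σ is well defined, and that the two models of B(Kϖ₂) agree, both rest on `Paired.good`: highest
weight words with equal φ generate isomorphic components. This is proved locally, from pairs of
colours, by means of explicit insertion models of types A₂ and A₁ × A₁. -/

theorem letterE_eq_some_iff {n i : ℕ} (_ : 2 ≤ n) {x y : ℤ} :
    letterE n i x = some y ↔ letterF n i y = some x := by
  unfold letterE letterF
  split_ifs <;> simp <;> omega

theorem letterPhi_eq_one_iff {n i : ℕ} {x : ℤ} :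
    letterPhi n i x = 1 ↔ ∃ y, letterF n i x = some y := by
  unfold letterPhi
  rw [← Option.isSome_iff_exists]
  split_ifs with h <;> simp [h]

theorem letterEps_eq_one_iff {n i : ℕ} {x : ℤ} :
    letterEps n i x = 1 ↔ ∃ y, letterE n i x = some y := by
  unfold letterEps
  rw [← Option.isSome_iff_exists]
  split_ifs with h <;> simp [h]

theorem letterPhi_le_one (n i : ℕ) (x : ℤ) : letterPhi n i x ≤ 1 := by
  unfold letterPhi; split_ifs <;> simp

theorem letterEps_le_one (n i : ℕ) (x : ℤ) : letterEps n i x ≤ 1 := by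
  unfold letterEps; split_ifs <;> simp

theorem letterPhi_eq_zero_iff {n i : ℕ} {x : ℤ} :
    letterPhi n i x = 0 ↔ letterF n i x = none := by
  cases h : letterF n i x <;> simp [letterPhi, h]

theorem letterEps_eq_zero_iff {n i : ℕ} {x : ℤ} :
    letterEps n i x = 0 ↔ letterE n i x = none := by
  cases h : letterE n i x <;> simp [letterEps, h]

theorem letterPhi_add_letterEps_le (n i : ℕ) (hn : 2 ≤ n) (x : ℤ) :
    letterPhi n i x + letterEps n i x ≤ 1 := by
  unfold letterPhi letterEps letterF letterE
  split_ifs <;> simp_all <;> omega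

/-- `ε_i` of a word, computed by the tensor product rule. -/
def wordEps (n i : ℕ) : List ℤ → ℕ
  | [] => 0
  | x :: w => wordEps n i w + (letterEps n i x - wordPhi n i w)

theorem wordF_eq_none_iff {n i : ℕ} (w : List ℤ) : wordF n i w = none ↔ wordPhi n i w = 0 := by
  induction w with
  | nil => simp [wordF, wordPhi]
  | cons x w ih =>
    have h0 := letterPhi_eq_zero_iff (n := n) (i := i) (x := x)
    simp only [wordF, wordPhi]
    split_ifs with h
    · simp [← h0]; omega
    · simp [ih]; omega

theorem wordE_eq_none_iff {n i : ℕ} (w : List ℤ) : wordE n i w = none ↔ wordEps n i w = 0 := by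
  induction w with
  | nil => simp [wordE, wordEps]
  | cons x w ih =>
    have h0 := letterEps_eq_zero_iff (n := n) (i := i) (x := x)
    simp only [wordE, wordEps]
    split_ifs with h
    · simp [← h0]; omega
    · simp [ih]; omega

theorem letterF_some {n i : ℕ} (hn : 2 ≤ n) {x y : ℤ} (h : letterF n i x = some y) :
    letterPhi n i x = 1 ∧ letterEps n i x = 0 ∧ letterPhi n i y = 0 ∧ letterEps n i y = 1 := by
  have h1 := letterPhi_eq_one_iff.2 ⟨y, h⟩
  have h2 := letterEps_eq_one_iff.2 ⟨x, (letterE_eq_some_iff hn).2 h⟩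
  have h3 := letterPhi_add_letterEps_le n i hn x
  have h4 := letterPhi_add_letterEps_le n i hn y
  omega

theorem wordF_some {n i : ℕ} (hn : 2 ≤ n) {w v : List ℤ} (h : wordF n i w = some v) :
    wordPhi n i w = wordPhi n i v + 1 ∧ wordEps n i v = wordEps n i w + 1 ∧
      wordE n i v = some w ∧ v.length = w.length := by
  induction w generalizing v with
  | nil => simp [wordF] at h
  | cons x w ih =>
    have h0 := letterPhi_add_letterEps_le n i hn x
    simp only [wordF] at h
    split_ifs at h with hc
    · obtain ⟨y, hy, rfl⟩ := Option.map_eq_some_iff.1 h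
      have := letterF_some hn hy
      have h2 := (letterE_eq_some_iff hn).2 hy
      have h3 : wordPhi n i w = 0 := by omega
      simp [wordPhi, wordEps, wordE, h2, h3, this]
    · obtain ⟨u, hu, rfl⟩ := Option.map_eq_some_iff.1 h
      obtain ⟨h1, h2, h3, h4⟩ := ih hu
      simp only [wordPhi, wordEps, wordE, List.length_cons, h4, h3]
      refine ⟨by omega, by omega, ?_, trivial⟩
      rw [if_neg (by omega)]; rfl

theorem wordE_some {n i : ℕ} (hn : 2 ≤ n) {w v : List ℤ} (h : wordE n i w = some v) :
    wordF n i v = some w := by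
  induction w generalizing v with
  | nil => simp [wordE] at h
  | cons x w ih =>
    simp only [wordE] at h
    split_ifs at h with hc
    · obtain ⟨y, hy, rfl⟩ := Option.map_eq_some_iff.1 h
      have h2 := (letterE_eq_some_iff hn).1 hy
      have := letterF_some hn h2
      simp only [wordF]
      rw [if_pos (by omega), h2]; rfl
    · obtain ⟨u, hu, rfl⟩ := Option.map_eq_some_iff.1 h
      have h1 := ih hu
      have h2 := wordF_some hn h1
      simp only [wordF]
      rw [if_neg (by omega), h1]; rfl

theorem wordE_eq_some_iff {n i : ℕ} (hn : 2 ≤ n) {w v : List ℤ} :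
    wordE n i w = some v ↔ wordF n i v = some w :=
  ⟨wordE_some hn, fun h => (wordF_some hn h).2.2.1⟩

theorem exists_wordF_of_pos {n i : ℕ} {w : List ℤ} (h : 0 < wordPhi n i w) :
    ∃ v, wordF n i w = some v := by
  rw [← Option.ne_none_iff_exists', Ne, wordF_eq_none_iff]; omega

/-- `φ_i - ε_i` of a word is the sum over its letters. -/
theorem wordPhi_sub_wordEps (n i : ℕ) (w : List ℤ) :
    (wordPhi n i w : ℤ) - wordEps n i w =
      (w.map fun x => (letterPhi n i x : ℤ) - letterEps n i x).sum := by
  induction w with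
  | nil => simp [wordPhi, wordEps]
  | cons x w ih =>
    simp only [wordPhi, wordEps, List.map_cons, List.sum_cons, ← ih]
    omega

theorem wordPhi_append (n i : ℕ) (v w : List ℤ) :
    wordPhi n i (v ++ w) = wordPhi n i v + (wordPhi n i w - wordEps n i v) := by
  induction v with
  | nil => simp [wordPhi, wordEps]
  | cons x v ih => simp only [List.cons_append, wordPhi, wordEps, ih]; omega

theorem wordEps_append (n i : ℕ) (v w : List ℤ) :
    wordEps n i (v ++ w) = wordEps n i w + (wordEps n i v - wordPhi n i w) := by
  induction v with
  | nil => simp [wordEps]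
  | cons x v ih => simp only [List.cons_append, wordEps, ih, wordPhi_append]; omega

theorem wordF_append {n i : ℕ} (v w : List ℤ) :
    wordF n i (v ++ w) = if wordPhi n i w ≤ wordEps n i v then (wordF n i v).map (· ++ w)
      else (wordF n i w).map (v ++ ·) := by
  induction v with
  | nil =>
    have := wordF_eq_none_iff (n := n) (i := i) w
    by_cases h : wordPhi n i w = 0
    · simp [wordF, wordEps, h, this.2 h]
    · simp [wordEps, h]
  | cons x v ih =>
    have := letterEps_le_one n i x
    by_cases h1 : wordPhi n i (v ++ w) ≤ letterEps n i x <;>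
    by_cases h2 : wordPhi n i w ≤ wordEps n i v <;>
    by_cases h3 : wordPhi n i v ≤ letterEps n i x <;>
    by_cases h4 : wordPhi n i w ≤ wordEps n i (x :: v) <;>
    simp only [List.cons_append, wordF, ih, h1, h2, h3, h4, if_true, if_false] <;>
    simp only [wordEps, wordPhi_append] at h1 h4 <;>
    first | omega | simp [Function.comp_def]

theorem wordE_append {n i : ℕ} (v w : List ℤ) :
    wordE n i (v ++ w) = if wordPhi n i w < wordEps n i v then (wordE n i v).map (· ++ w)
      else (wordE n i w).map (v ++ ·) := by
  induction v with
  | nil => simp [wordEps]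
  | cons x v ih =>
    have := letterEps_le_one n i x
    by_cases h1 : wordPhi n i (v ++ w) < letterEps n i x <;>
    by_cases h2 : wordPhi n i w < wordEps n i v <;>
    by_cases h3 : wordPhi n i v < letterEps n i x <;>
    by_cases h4 : wordPhi n i w < wordEps n i (x :: v) <;>
    simp only [List.cons_append, wordE, ih, h1, h2, h3, h4, if_true, if_false] <;>
    simp only [wordEps, wordPhi_append] at h1 h4 <;>
    first | omega | simp [Function.comp_def]

/-! ### Duality: reverse the word and bar all letters -/

/-- The dual word. -/
def dualWord (w : List ℤ) : List ℤ := (w.map Neg.neg).reverse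

theorem dualWord_dualWord (w : List ℤ) : dualWord (dualWord w) = w := by
  simp [dualWord]

theorem dualWord_cons (x : ℤ) (w : List ℤ) : dualWord (x :: w) = dualWord w ++ [-x] := by
  simp [dualWord]

theorem letterE_neg (n i : ℕ) (x : ℤ) : letterE n i (-x) = (letterF n i x).map Neg.neg := by
  unfold letterE letterF
  split_ifs <;> simp <;> omega

theorem letterEps_neg (n i : ℕ) (x : ℤ) : letterEps n i (-x) = letterPhi n i x := by
  simp [letterEps, letterPhi, letterE_neg]

theorem letterPhi_neg (n i : ℕ) (x : ℤ) : letterPhi n i (-x) = letterEps n i x := by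
  rw [← letterEps_neg, neg_neg]

theorem wordPhi_wordEps_dualWord (n i : ℕ) (w : List ℤ) :
    wordPhi n i (dualWord w) = wordEps n i w ∧ wordEps n i (dualWord w) = wordPhi n i w := by
  induction w with
  | nil => simp [dualWord, wordPhi, wordEps]
  | cons x w ih =>
    simp only [dualWord_cons, wordPhi_append, wordEps_append, ih, wordPhi, wordEps,
      letterEps_neg, letterPhi_neg]
    omega

/-- Barring exchanges `φ` and `ε` of a letter, and reversal exchanges the tensor factors. The
tie-breaking conventions, `≤` for lowering and `<` for raising, correspond under this exchange. -/
theorem wordE_dualWord (n i : ℕ) (w : List ℤ) :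
    wordE n i (dualWord w) = (wordF n i w).map dualWord := by
  induction w with
  | nil => simp [dualWord, wordE, wordF]
  | cons x w ih =>
    have h := (wordPhi_wordEps_dualWord n i w).2
    have h0 := letterPhi_le_one n i x
    have h1 := letterPhi_eq_zero_iff (n := n) (i := i) (x := x)
    have h3 := wordF_eq_none_iff (n := n) (i := i) w
    simp only [dualWord_cons, wordE_append, ih, wordF, wordPhi, wordE, h, letterEps_neg,
      letterPhi_neg, letterE_neg]
    split_ifs with h4 h5 h6 h7
    all_goals first
      | omega
      | (rw [h1.1 (by omega)]; rfl)
      | simp [Function.comp_def, dualWord]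

/-! ### Models of rank-two crystals -/

/-- A model for a rank-two crystal: elements `G`, letters `K`, and an operation `ins` that realizes
tensoring with a letter on the left. -/
structure RankTwoModel where
  G : Type
  K : Type
  Valid : G → Prop
  e : Bool → G → Option G
  phi : Bool → G → ℕ
  shape : G → ℕ × ℕ
  base : G
  ins : K → G → G
  eK : Bool → K → Option K
  phiK : Bool → K → ℕ
  epsK : Bool → K → ℕ
  valid_base : Valid base
  valid_ins : ∀ c T, Valid T → Valid (ins c T)
  phi_base : ∀ k, phi k base = 0
  e_base : ∀ k, e k base = none
  phi_ins : ∀ k c T, Valid T → phi k (ins c T) = phiK k c + (phi k T - epsK k c)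
  e_ins : ∀ k c T, Valid T → e k (ins c T) =
    if phi k T < epsK k c then (eK k c).map (fun c' => ins c' T) else (e k T).map (ins c)
  shape_e : ∀ k T R, Valid T → e k T = some R → shape R = shape T
  -- Insertion can be undone once the shape before it is known; this makes the sequence of shapes a
  -- recording tableau.
  ins_inj : ∀ c c' T T', Valid T → Valid T' → shape T = shape T' → ins c T = ins c' T' →
    c = c' ∧ T = T'
  e_inj : ∀ k T T' R, Valid T → Valid T' → e k T = some R → e k T' = some R → T = T'
  highest_inj : ∀ T T', Valid T → Valid T' → (∀ k, e k T = none) → (∀ k, e k T' = none) →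
    shape T = shape T' → T = T'
  shape_highest : ∀ T, Valid T → (∀ k, e k T = none) → shape T = (phi false T, phi true T)

/-! #### Type `A₂` -/

/-- The two-row semistandard tableau with first row `1^a 2^b 3^c` and second row `2^d 3^e`. -/
@[ext] structure A2Tableau where
  a : ℕ
  b : ℕ
  c : ℕ
  d : ℕ
  e : ℕ

/-- The trivial letter, the letters of the natural crystal and those of its dual. -/
inductive A2Letter
  | triv | l1 | l2 | l3 | d1 | d2 | d3

namespace A2Tableau

/-- Columns strictly increase. -/
def Valid (T : A2Tableau) : Prop := T.d ≤ T.a ∧ T.d + T.e ≤ T.a + T.b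

/-- The raising operators. -/
def eOp : Bool → A2Tableau → Option A2Tableau
  | false, ⟨a, b, c, d, e⟩ => if 0 < b then some ⟨a + 1, b - 1, c, d, e⟩ else none
  | true, ⟨a, b, c, d, e⟩ =>
    if b < e then some ⟨a, b, c, d + 1, e - 1⟩
    else if 0 < c then some ⟨a, b + 1, c - 1, d, e⟩ else none

/-- The string lengths `φ`. -/
def phi : Bool → A2Tableau → ℕ
  | false, ⟨a, _, _, d, _⟩ => a - d
  | true, ⟨_, b, _, d, e⟩ => d + (b - e)

/-- The shape modulo columns of height three. -/
def shape (T : A2Tableau) : ℕ × ℕ := (T.a + T.b + T.c - (T.d + T.e), T.d + T.e)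

/-- Column insertion. -/
def ins : A2Letter → A2Tableau → A2Tableau
  | .triv, T => T
  | .l1, ⟨a, b, c, d, e⟩ => ⟨a + 1, b, c, d, e⟩
  | .l2, ⟨a, b, c, d, e⟩ =>
    if a ≤ d then ⟨a, b + 1, c, d, e⟩
    else if e = 0 ∨ d + e < a + b then ⟨a, b, c, d + 1, e⟩ else ⟨a, b, c + 1, d + 1, e - 1⟩
  | .l3, ⟨a, b, c, d, e⟩ =>
    if 0 < d then ⟨a - 1, b, c, d - 1, e⟩
    else if e < a + b then ⟨a, b, c, d, e + 1⟩ else ⟨a, b, c + 1, d, e⟩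
  -- A dual letter is inserted as a column of height two, with entries 12, 13 or 23; columns of
  -- height three are discarded.
  | .d1, ⟨a, b, c, d, e⟩ => ⟨a + 1, b, c, d + 1, e⟩
  | .d2, ⟨a, b, c, d, e⟩ => if 0 < d then ⟨a, b, c, d - 1, e⟩ else ⟨a + 1, b, c, d, e + 1⟩
  | .d3, ⟨a, b, c, d, e⟩ =>
    if a ≤ d then
      if 0 < d then ⟨a - 1, b + 1, c, d - 1, e⟩ else ⟨a, b + 1, c, d, e + 1⟩
    else if d + e < a + b then ⟨a - 1, b, c, d, e⟩ else ⟨a - 1, b, c + 1, d, e - 1⟩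

/-- The raising operators on letters. -/
def eLetter : Bool → A2Letter → Option A2Letter
  | false, .l2 => some .l1
  | false, .d3 => some .d2
  | true, .l3 => some .l2
  | true, .d2 => some .d1
  | _, _ => none

/-- `φ` of a letter. -/
def phiLetter : Bool → A2Letter → ℕ
  | false, .l1 => 1
  | false, .d2 => 1
  | true, .l2 => 1
  | true, .d1 => 1
  | _, _ => 0

/-- `ε` of a letter. -/
def epsLetter : Bool → A2Letter → ℕ
  | false, .l2 => 1
  | false, .d3 => 1
  | true, .l3 => 1
  | true, .d2 => 1
  | _, _ => 0

theorem valid_ins (x : A2Letter) (T : A2Tableau) (h : Valid T) : Valid (ins x T) := by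
  obtain ⟨a, b, c, d, e⟩ := T
  cases x <;> simp only [Valid, ins] at * <;> (try split_ifs) <;> (try simp only) <;> omega

theorem phi_ins (k : Bool) (x : A2Letter) (T : A2Tableau) (h : Valid T) :
    phi k (ins x T) = phiLetter k x + (phi k T - epsLetter k x) := by
  obtain ⟨a, b, c, d, e⟩ := T
  cases k <;> cases x <;> simp only [Valid, ins, phiLetter, epsLetter] at * <;> (try split_ifs) <;>
    simp only [phi] <;> omega

theorem e_ins_false (x : A2Letter) (T : A2Tableau) (h : Valid T) :
    eOp false (ins x T) =
      if phi false T < epsLetter false x then (eLetter false x).map (fun y => ins y T)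
      else (eOp false T).map (ins x) := by
  obtain ⟨a, b, c, d, e⟩ := T
  cases x <;> simp only [Valid, phi, eOp, eLetter, epsLetter, Option.map_some] at * <;>
    grind [ins, eOp]

theorem e_ins_true (x : A2Letter) (T : A2Tableau) (h : Valid T) :
    eOp true (ins x T) =
      if phi true T < epsLetter true x then (eLetter true x).map (fun y => ins y T)
      else (eOp true T).map (ins x) := by
  obtain ⟨a, b, c, d, e⟩ := T
  cases x <;> simp only [Valid, phi, eOp, eLetter, epsLetter, Option.map_some] at * <;>
    grind [ins, eOp]

theorem e_ins (k : Bool) (x : A2Letter) (T : A2Tableau) (h : Valid T) :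
    eOp k (ins x T) = if phi k T < epsLetter k x then (eLetter k x).map (fun y => ins y T)
      else (eOp k T).map (ins x) := by
  cases k
  exacts [e_ins_false x T h, e_ins_true x T h]

theorem shape_e (k : Bool) (T R : A2Tableau) (h : Valid T) (hR : eOp k T = some R) :
    shape R = shape T := by
  obtain ⟨a, b, c, d, e⟩ := T
  cases k <;> simp only [eOp, Valid] at * <;> split_ifs at hR <;> simp at hR <;>
    subst hR <;> simp [shape] <;> omega

theorem e_inj (k : Bool) (T T' R : A2Tableau) (h : Valid T) (h' : Valid T')
    (hR : eOp k T = some R) (hR' : eOp k T' = some R) : T = T' := by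
  obtain ⟨a, b, c, d, e⟩ := T
  obtain ⟨a', b', c', d', e'⟩ := T'
  obtain ⟨a2, b2, c2, d2, e2⟩ := R
  cases k <;> simp only [eOp, Valid] at * <;> split_ifs at hR hR' <;> simp at * <;> omega

theorem highest_iff (T : A2Tableau) (h : Valid T) :
    (∀ k, eOp k T = none) ↔ T.b = 0 ∧ T.c = 0 ∧ T.e = 0 := by
  obtain ⟨a, b, c, d, e⟩ := T
  simp only [eOp, Valid, Bool.forall_bool] at *
  split_ifs <;> simp <;> omega

/-- A nontrivial letter changes the shape by a weight of the natural crystal or of its dual. These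
six weights are distinct and nonzero, so the two shapes tell the kind of the letter and how to
reverse the insertion. -/
theorem ins_inj (x x' : A2Letter) (T T' : A2Tableau) (h : Valid T) (h' : Valid T')
    (hs : shape T = shape T') (he : ins x T = ins x' T') : x = x' ∧ T = T' := by
  obtain ⟨a, b, c, d, e⟩ := T
  obtain ⟨a', b', c', d', e'⟩ := T'
  simp only [shape, Valid, Prod.mk.injEq] at *
  cases x <;> cases x' <;> simp only [ins] at he <;> (try split_ifs at he) <;>
    simp only [A2Tableau.mk.injEq] at he <;>
    first | (exfalso; omega) | (refine ⟨rfl, ?_⟩; ext <;> simp only <;> omega)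

end A2Tableau

/-- The model of crystals of type `A₂`. -/
def a2Model : RankTwoModel where
  G := A2Tableau
  K := A2Letter
  Valid := A2Tableau.Valid
  e := A2Tableau.eOp
  phi := A2Tableau.phi
  shape := A2Tableau.shape
  base := ⟨0, 0, 0, 0, 0⟩
  ins := A2Tableau.ins
  eK := A2Tableau.eLetter
  phiK := A2Tableau.phiLetter
  epsK := A2Tableau.epsLetter
  valid_base := by simp [A2Tableau.Valid]
  valid_ins := A2Tableau.valid_ins
  phi_base := by simp [A2Tableau.phi]
  e_base := by simp [A2Tableau.eOp]
  phi_ins := A2Tableau.phi_ins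
  e_ins := A2Tableau.e_ins
  shape_e := A2Tableau.shape_e
  ins_inj := A2Tableau.ins_inj
  e_inj := A2Tableau.e_inj
  highest_inj := by
    rintro ⟨a, b, c, d, e⟩ ⟨a', b', c', d', e'⟩ h h' h1 h2 hs
    rw [A2Tableau.highest_iff _ h] at h1
    rw [A2Tableau.highest_iff _ h'] at h2
    simp only [A2Tableau.shape, A2Tableau.Valid, Prod.mk.injEq, A2Tableau.mk.injEq] at *
    omega
  shape_highest := by
    rintro ⟨a, b, c, d, e⟩ h h1
    rw [A2Tableau.highest_iff _ h] at h1
    simp only [A2Tableau.shape, A2Tableau.Valid, A2Tableau.phi, Prod.mk.injEq] at *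
    omega

/-! #### Type `A₁ × A₁` -/

/-- The letters of type `A₁`. -/
inductive A1Letter
  | triv | up | down

namespace A1String

/-- The raising operator on a string, an element of which is the pair `(ε, φ)`. -/
def eOp (T : ℕ × ℕ) : Option (ℕ × ℕ) := if 0 < T.1 then some (T.1 - 1, T.2 + 1) else none

/-- Tensoring with a letter on the left. -/
def ins : A1Letter → ℕ × ℕ → ℕ × ℕ
  | .triv, T => T
  | .up, T => (T.1, T.2 + 1)
  | .down, T => if 0 < T.2 then (T.1, T.2 - 1) else (T.1 + 1, T.2)

/-- The raising operator on letters. -/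
def eLetter : A1Letter → Option A1Letter
  | .down => some .up
  | _ => none

/-- `φ` of a letter. -/
def phiLetter : A1Letter → ℕ
  | .up => 1
  | _ => 0

/-- `ε` of a letter. -/
def epsLetter : A1Letter → ℕ
  | .down => 1
  | _ => 0

theorem e_ins (x : A1Letter) (T : ℕ × ℕ) :
    eOp (ins x T) = if T.2 < epsLetter x then (eLetter x).map (fun y => ins y T)
      else (eOp T).map (ins x) := by
  cases x <;> grind [ins, eLetter, epsLetter, eOp]

end A1String

open A1String in
/-- The model of crystals of type `A₁ × A₁`. -/
def a1a1Model : RankTwoModel where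
  G := (ℕ × ℕ) × (ℕ × ℕ)
  K := A1Letter × A1Letter
  Valid := fun _ => True
  e := fun k T => if k then (eOp T.2).map (fun x => (T.1, x)) else (eOp T.1).map (fun x => (x, T.2))
  phi := fun k T => if k then T.2.2 else T.1.2
  shape := fun T => (T.1.1 + T.1.2, T.2.1 + T.2.2)
  base := ((0, 0), (0, 0))
  ins := fun c T => (ins c.1 T.1, ins c.2 T.2)
  eK := fun k c =>
    if k then (eLetter c.2).map (fun x => (c.1, x)) else (eLetter c.1).map (fun x => (x, c.2))
  phiK := fun k c => if k then phiLetter c.2 else phiLetter c.1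
  epsK := fun k c => if k then epsLetter c.2 else epsLetter c.1
  valid_base := trivial
  valid_ins := fun _ _ _ => trivial
  phi_base := by simp
  e_base := by simp [eOp]
  phi_ins := by
    rintro (_ | _) ⟨x, y⟩ T -
    · cases x <;> grind [ins, phiLetter, epsLetter]
    · cases y <;> grind [ins, phiLetter, epsLetter]
  e_ins := by
    rintro (_ | _) ⟨x, y⟩ T -
    · simp only [e_ins, Bool.false_eq_true, if_false]
      split_ifs <;> simp [Function.comp_def]
    · simp only [e_ins, if_true]
      split_ifs <;> simp [Function.comp_def]
  shape_e := by
    rintro (_ | _) T R - h <;> grind [eOp]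
  ins_inj := by
    rintro ⟨x, y⟩ ⟨x', y'⟩ ⟨T1, T2⟩ ⟨T1', T2'⟩ - - hs he
    simp only [Prod.mk.injEq] at *
    have h1 : x = x' ∧ T1 = T1' := by cases x <;> cases x' <;> grind [ins]
    have h2 : y = y' ∧ T2 = T2' := by cases y <;> cases y' <;> grind [ins]
    exact ⟨⟨h1.1, h2.1⟩, h1.2, h2.2⟩
  e_inj := by
    rintro (_ | _) T T' R - - h h' <;> grind [eOp]
  highest_inj := by
    rintro ⟨⟨a, b⟩, c, d⟩ ⟨⟨a', b'⟩, c', d'⟩ - - h h' hs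
    have h1 := h false
    have h2 := h true
    have h3 := h' false
    have h4 := h' true
    simp [eOp] at *
    omega
  shape_highest := by
    rintro ⟨⟨a, b⟩, c, d⟩ - h
    have h1 := h false
    have h2 := h true
    simp [eOp] at *
    omega

/-! ### Rank-two models of the crystal of words -/

/-- A description of the crystal of words, for two colours, by a rank-two model. -/
structure RankTwoTyping (n : ℕ) (idx : Bool → ℕ) where
  M : RankTwoModel
  ty : ℤ → M.K
  -- Letters of the same type may lie in different components of the alphabet; the tag tells these
  -- apart.
  tag : ℤ → ℤ
  inj : ∀ x y, ty x = ty y → tag x = tag y → x = y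
  eK : ∀ k x, M.eK k (ty x) = (letterE n (idx k) x).map ty
  tag_e : ∀ k x y, letterE n (idx k) x = some y → tag x = tag y
  phiK : ∀ k x, M.phiK k (ty x) = letterPhi n (idx k) x
  epsK : ∀ k x, M.epsK k (ty x) = letterEps n (idx k) x

namespace RankTwoTyping

variable {n : ℕ} {idx : Bool → ℕ} (D : RankTwoTyping n idx)

/-- The element of the model that corresponds to a word. -/
def toModel : List ℤ → D.M.G
  | [] => D.M.base
  | x :: w => D.M.ins (D.ty x) (toModel w)

/-- The recording data of a word. -/
def record : List ℤ → List (ℤ × (ℕ × ℕ))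
  | [] => []
  | x :: w => (D.tag x, D.M.shape (D.toModel w)) :: record w

theorem valid_toModel (w : List ℤ) : D.M.Valid (D.toModel w) := by
  induction w with
  | nil => exact D.M.valid_base
  | cons x w ih => exact D.M.valid_ins _ _ ih

theorem phi_toModel (k : Bool) (w : List ℤ) :
    D.M.phi k (D.toModel w) = wordPhi n (idx k) w := by
  induction w with
  | nil => exact D.M.phi_base k
  | cons x w ih =>
    rw [toModel, D.M.phi_ins _ _ _ (D.valid_toModel w), ih, D.phiK, D.epsK, wordPhi]

theorem e_toModel (k : Bool) (w : List ℤ) :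
    D.M.e k (D.toModel w) = (wordE n (idx k) w).map D.toModel := by
  induction w with
  | nil => simpa [wordE, toModel] using D.M.e_base k
  | cons x w ih =>
    rw [toModel, D.M.e_ins _ _ _ (D.valid_toModel w), ih, D.epsK, D.eK, D.phi_toModel, wordE]
    split_ifs <;> simp [Function.comp_def, toModel]

theorem shape_e {k : Bool} {w v : List ℤ} (h : wordE n (idx k) w = some v) :
    D.M.shape (D.toModel w) = D.M.shape (D.toModel v) := by
  refine (D.M.shape_e k _ _ (D.valid_toModel w) ?_).symm
  rw [D.e_toModel, h]; rfl

/-- Crystal operators preserve recording tableaux: one letter changes inside its component of the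
alphabet, and no suffix changes its shape. -/
theorem record_e {k : Bool} {w v : List ℤ} (h : wordE n (idx k) w = some v) :
    D.record w = D.record v := by
  induction w generalizing v with
  | nil => simp [wordE] at h
  | cons x w ih =>
    simp only [wordE] at h
    split_ifs at h with hc
    · obtain ⟨y, hy, rfl⟩ := Option.map_eq_some_iff.1 h
      simp [record, D.tag_e k x y hy]
    · obtain ⟨u, hu, rfl⟩ := Option.map_eq_some_iff.1 h
      simp [record, ih hu, D.shape_e hu]

/-- As in the Robinson–Schensted correspondence, the word is recovered by undoing one insertion
after the other. -/
theorem eq_of_toModel_eq {w v : List ℤ} (h : D.toModel w = D.toModel v)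
    (hr : D.record w = D.record v) : w = v := by
  induction w generalizing v with
  | nil => cases v <;> simp_all [record]
  | cons x w ih =>
    cases v with
    | nil => simp [record] at hr
    | cons y v =>
      simp only [record, List.cons.injEq, Prod.mk.injEq] at hr
      obtain ⟨h1, h2⟩ :=
        D.M.ins_inj _ _ _ _ (D.valid_toModel w) (D.valid_toModel v) hr.1.2 h
      rw [D.inj x y h1 hr.1.1, ih h2 hr.2]

theorem toModel_eq_of_highest {w v : List ℤ} (hw : ∀ k, wordE n (idx k) w = none)
    (hv : ∀ k, wordE n (idx k) v = none)
    (h : D.M.shape (D.toModel w) = D.M.shape (D.toModel v)) : D.toModel w = D.toModel v :=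
  D.M.highest_inj _ _ (D.valid_toModel w) (D.valid_toModel v)
    (fun k => by rw [D.e_toModel, hw]; rfl) (fun k => by rw [D.e_toModel, hv]; rfl) h

/-- The shape of a highest weight element can be read off from its two values of `φ`. -/
theorem toModel_eq_of_phi_eq {w v : List ℤ} (hw : ∀ k, wordE n (idx k) w = none)
    (hv : ∀ k, wordE n (idx k) v = none)
    (h : ∀ k, wordPhi n (idx k) w = wordPhi n (idx k) v) : D.toModel w = D.toModel v := by
  refine D.toModel_eq_of_highest hw hv ?_
  rw [D.M.shape_highest _ (D.valid_toModel w) (fun k => by rw [D.e_toModel, hw]; rfl),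
    D.M.shape_highest _ (D.valid_toModel v) (fun k => by rw [D.e_toModel, hv]; rfl)]
  simp only [D.phi_toModel, h]

theorem wordPhi_eq {w v : List ℤ} (h : D.toModel w = D.toModel v) (k : Bool) :
    wordPhi n (idx k) w = wordPhi n (idx k) v := by
  rw [← D.phi_toModel, h, D.phi_toModel]

theorem wordE_eq_none_iff {w v : List ℤ} (h : D.toModel w = D.toModel v) (k : Bool) :
    wordE n (idx k) w = none ↔ wordE n (idx k) v = none := by
  rw [← Option.map_eq_none_iff (f := D.toModel), ← D.e_toModel, h, D.e_toModel,
    Option.map_eq_none_iff]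

theorem toModel_of_e {w v w' v' : List ℤ} (h : D.toModel w' = D.toModel v') {k : Bool}
    (hw : wordE n (idx k) w = some w') (hv : wordE n (idx k) v = some v') :
    D.toModel w = D.toModel v := by
  refine D.M.e_inj k _ _ (D.toModel w') (D.valid_toModel w) (D.valid_toModel v) ?_ ?_
  · rw [D.e_toModel, hw]; rfl
  · rw [D.e_toModel, hv, h]; rfl

end RankTwoTyping

/-! ### The typings for pairs of colours -/

/-- The typing for a pair of colours that acts on letters by `p → q → r` and `-r → -q → -p`. -/
def a2Typing (n : ℕ) (idx : Bool → ℕ) (p q r : ℤ)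
    (hd : [p, q, r, -r, -q, -p].Nodup)
    (h0 : ∀ x, letterE n (idx false) x = if x = q then some p else if x = -p then some (-q) else none)
    (h1 : ∀ x, letterE n (idx true) x = if x = r then some q else if x = -q then some (-r) else none)
    (h2 : ∀ x, letterF n (idx false) x = if x = p then some q else if x = -q then some (-p) else none)
    (h3 : ∀ x, letterF n (idx true) x = if x = q then some r else if x = -r then some (-q) else none) :
    RankTwoTyping n idx where
  M := a2Model
  ty x := if x = p then A2Letter.l1 else if x = q then A2Letter.l2 else if x = r then A2Letter.l3
    else if x = -r then A2Letter.d1 else if x = -q then A2Letter.d2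
    else if x = -p then A2Letter.d3 else A2Letter.triv
  tag x := if x = p ∨ x = q ∨ x = r then p else if x = -r ∨ x = -q ∨ x = -p then -p else x
  inj := by
    intro x y
    simp only [List.nodup_cons, List.mem_cons, List.not_mem_nil] at hd
    intro h1 h2
    grind
  eK := by
    simp only [List.nodup_cons, List.mem_cons, List.not_mem_nil] at hd
    rintro (_ | _) x
    · rw [h0]; simp only [a2Model]; grind [A2Tableau.eLetter]
    · rw [h1]; simp only [a2Model]; grind [A2Tableau.eLetter]
  tag_e := by
    simp only [List.nodup_cons, List.mem_cons, List.not_mem_nil] at hd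
    rintro (_ | _) x y
    · rw [h0]; grind
    · rw [h1]; grind
  phiK := by
    simp only [List.nodup_cons, List.mem_cons, List.not_mem_nil] at hd
    rintro (_ | _) x
    · rw [letterPhi, h2]; simp only [a2Model]; grind [A2Tableau.phiLetter]
    · rw [letterPhi, h3]; simp only [a2Model]; grind [A2Tableau.phiLetter]
  epsK := by
    simp only [List.nodup_cons, List.mem_cons, List.not_mem_nil] at hd
    rintro (_ | _) x
    · rw [letterEps, h0]; simp only [a2Model]; grind [A2Tableau.epsLetter]
    · rw [letterEps, h1]; simp only [a2Model]; grind [A2Tableau.epsLetter]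

/-- The typing for a pair of orthogonal colours that act on letters by `p → q`, `-q → -p` and
`p' → q'`, `-q' → -p'`. -/
def a1a1Typing (n : ℕ) (idx : Bool → ℕ) (p q p' q' : ℤ)
    (hd : [p, q, -p, -q].Nodup)
    (hd' : p' = p ∧ q' = -q ∨ [p, q, -p, -q, p', q', -p', -q'].Nodup)
    (h0 : ∀ x, letterE n (idx false) x = if x = q then some p else if x = -p then some (-q) else none)
    (h1 : ∀ x, letterE n (idx true) x =
      if x = q' then some p' else if x = -p' then some (-q') else none)
    (h2 : ∀ x, letterF n (idx false) x = if x = p then some q else if x = -q then some (-p) else none)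
    (h3 : ∀ x, letterF n (idx true) x =
      if x = p' then some q' else if x = -q' then some (-p') else none) :
    RankTwoTyping n idx where
  M := a1a1Model
  ty x := (if x = p ∨ x = -q then A1Letter.up else if x = q ∨ x = -p then A1Letter.down
    else A1Letter.triv, if x = p' ∨ x = -q' then A1Letter.up
    else if x = q' ∨ x = -p' then A1Letter.down else A1Letter.triv)
  -- If `p' = p` and `q' = -q`, as for the colours `n - 1` and `n`, the letters `p, q, -q, -p` form
  -- a single component, a product of two strings. Otherwise each colour has two strings of its own.
  tag x := if p' = p then (if x = p ∨ x = q ∨ x = -p ∨ x = -q then p else x)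
    else if x = p ∨ x = q then p else if x = -p ∨ x = -q then -p
    else if x = p' ∨ x = q' then p' else if x = -p' ∨ x = -q' then -p' else x
  inj := by
    intro x y
    simp only [List.nodup_cons, List.mem_cons, List.not_mem_nil] at *
    intro hxy h3
    have h1 := congrArg Prod.fst hxy
    have h2 := congrArg Prod.snd hxy
    clear hxy
    simp only at h1 h2
    grind
  eK := by
    simp only [List.nodup_cons, List.mem_cons, List.not_mem_nil] at hd hd'
    rintro (_ | _) x
    · rw [h0]; simp only [a1a1Model]; grind [A1String.eLetter]
    · rw [h1]; simp only [a1a1Model]; grind [A1String.eLetter]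
  tag_e := by
    simp only [List.nodup_cons, List.mem_cons, List.not_mem_nil] at hd hd'
    rintro (_ | _) x y
    · rw [h0]; grind
    · rw [h1]; grind
  phiK := by
    simp only [List.nodup_cons, List.mem_cons, List.not_mem_nil] at hd hd'
    rintro (_ | _) x
    · rw [letterPhi, h2]; simp only [a1a1Model]; grind [A1String.phiLetter]
    · rw [letterPhi, h3]; simp only [a1a1Model]; grind [A1String.phiLetter]
  epsK := by
    simp only [List.nodup_cons, List.mem_cons, List.not_mem_nil] at hd hd'
    rintro (_ | _) x
    · rw [letterEps, h0]; simp only [a1a1Model]; grind [A1String.epsLetter]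
    · rw [letterEps, h1]; simp only [a1a1Model]; grind [A1String.epsLetter]

/-- The target `q` of the arrows `p → q`, `-q → -p` of colour `i`. -/
def arrowTarget (n i : ℕ) : ℤ := if i = n then -n else i + 1

/-- The source `p` of the arrows `p → q`, `-q → -p` of colour `i`. -/
def arrowSource (n i : ℕ) : ℤ := if i = n then n - 1 else i

theorem letterE_eq {n i : ℕ} (hi : 1 ≤ i) (hin : i ≤ n) (x : ℤ) :
    letterE n i x = if x = arrowTarget n i then some (arrowSource n i)
      else if x = -arrowSource n i then some (-arrowTarget n i) else none := by
  unfold letterE arrowTarget arrowSource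
  split_ifs <;> first | rfl | omega | simp

theorem letterF_eq {n i : ℕ} (hi : 1 ≤ i) (hin : i ≤ n) (x : ℤ) :
    letterF n i x = if x = arrowSource n i then some (arrowTarget n i)
      else if x = -arrowTarget n i then some (-arrowSource n i) else none := by
  unfold letterF arrowTarget arrowSource
  split_ifs <;> first | rfl | omega

/-- For `i < j` the colours are adjacent in the Dynkin diagram exactly when the arrows of `j` start
where those of `i` end; this includes the pair `n - 2`, `n`. The arrows of `n - 1` and `n` share a
source, and these colours are orthogonal. -/
theorem exists_rankTwoTyping_of_lt {n i j : ℕ} (hn : 4 ≤ n) (hi : 1 ≤ i) (hij : i < j)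
    (hj : j ≤ n) : Nonempty (RankTwoTyping n (fun k => if k then j else i)) := by
  have e0 := letterE_eq (n := n) hi (by omega)
  have e1 := letterE_eq (n := n) (i := j) (by omega) hj
  have f0 := letterF_eq (n := n) hi (by omega)
  have f1 := letterF_eq (n := n) (i := j) (by omega) hj
  by_cases h : arrowSource n j = arrowTarget n i
  · refine ⟨a2Typing n _ (arrowSource n i) (arrowTarget n i) (arrowTarget n j) ?_
      (by simpa using e0) (by simpa [h] using e1) (by simpa using f0) (by simpa [h] using f1)⟩
    clear e0 e1 f0 f1
    unfold arrowSource arrowTarget at *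
    by_cases hj' : j = n <;> simp [hj', show i ≠ n by omega] at * <;> omega
  · refine ⟨a1a1Typing n _ (arrowSource n i) (arrowTarget n i) (arrowSource n j)
      (arrowTarget n j) ?_ ?_
      (by simpa using e0) (by simpa using e1) (by simpa using f0) (by simpa using f1)⟩
    all_goals
      clear e0 e1 f0 f1
      unfold arrowSource arrowTarget at *
      by_cases hj' : j = n <;> simp [hj', show i ≠ n by omega] at * <;> omega

open Relation

/-! ### Highest weight words -/

/-- The word `v` arises from `w` by a raising operator with colour in `J`. -/
def Raises (n : ℕ) (J : Set ℕ) (w v : List ℤ) : Prop := ∃ i ∈ J, wordE n i w = some v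

/-- No raising operator with colour in `J` applies to `w`. -/
def IsHighest (n : ℕ) (J : Set ℕ) (w : List ℤ) : Prop := ∀ i ∈ J, wordE n i w = none

/-- The total height of a word. -/
def totalHeight (n : ℕ) (w : List ℤ) : ℕ := (w.map fun x => (height n x).toNat).sum

theorem height_of_letterE {n i : ℕ} (hn : 4 ≤ n) {x y : ℤ} (h : letterE n i x = some y) :
    (height n x).toNat = (height n y).toNat + 1 := by
  unfold letterE at h
  unfold height
  split_ifs at h <;> simp at h <;> split_ifs <;> omega

theorem totalHeight_of_wordE {n i : ℕ} (hn : 4 ≤ n) {w v : List ℤ} (h : wordE n i w = some v) :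
    totalHeight n w = totalHeight n v + 1 := by
  induction w generalizing v with
  | nil => simp [wordE] at h
  | cons x w ih =>
    simp only [wordE] at h
    split_ifs at h with hc
    · obtain ⟨y, hy, rfl⟩ := Option.map_eq_some_iff.1 h
      simp [totalHeight, height_of_letterE hn hy]; omega
    · obtain ⟨u, hu, rfl⟩ := Option.map_eq_some_iff.1 h
      have := ih hu
      simp only [totalHeight, List.map_cons, List.sum_cons] at *
      omega

theorem exists_highest {n : ℕ} (hn : 4 ≤ n) (J : Set ℕ) (w : List ℤ) :
    ∃ u, ReflTransGen (Raises n J) w u ∧ IsHighest n J u := by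
  induction h : totalHeight n w using Nat.strong_induction_on generalizing w with
  | _ m ih =>
    by_cases hw : IsHighest n J w
    · exact ⟨w, .refl, hw⟩
    · simp only [IsHighest, not_forall] at hw
      obtain ⟨i, hi, hne⟩ := hw
      obtain ⟨v, hv⟩ := Option.ne_none_iff_exists'.1 hne
      have := totalHeight_of_wordE hn hv
      obtain ⟨u, hu, hu'⟩ := ih _ (by omega) v rfl
      exact ⟨u, .head ⟨i, hi, hv⟩ hu, hu'⟩

theorem IsHighest.eq_of_raises {n : ℕ} {J : Set ℕ} {u v : List ℤ} (hu : IsHighest n J u)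
    (h : ReflTransGen (Raises n J) u v) : u = v := by
  rcases h.cases_head with h | ⟨w, ⟨i, hi, hw⟩, -⟩
  · exact h
  · rw [hu i hi] at hw; cases hw

theorem RankTwoTyping.record_shape_of_raises {n : ℕ} {idx : Bool → ℕ} (D : RankTwoTyping n idx)
    {w v : List ℤ} (h : ReflTransGen (Raises n (Set.range idx)) w v) :
    D.record w = D.record v ∧ D.M.shape (D.toModel w) = D.M.shape (D.toModel v) := by
  induction h with
  | refl => exact ⟨rfl, rfl⟩
  | tail _ hs ih =>
    obtain ⟨_, ⟨k, rfl⟩, hk⟩ := hs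
    exact ⟨ih.1.trans (D.record_e hk), ih.2.trans (D.shape_e hk)⟩

/-- Both ends inherit the record and the shape of `w`. The shape determines the highest weight
element of the model, and this element together with the record determines the word. -/
theorem RankTwoTyping.highest_unique {n : ℕ} {idx : Bool → ℕ} (D : RankTwoTyping n idx)
    {w v v' : List ℤ} (h : ReflTransGen (Raises n (Set.range idx)) w v)
    (h' : ReflTransGen (Raises n (Set.range idx)) w v')
    (hv : IsHighest n (Set.range idx) v) (hv' : IsHighest n (Set.range idx) v') : v = v' := by
  have h1 := D.record_shape_of_raises h
  have h2 := D.record_shape_of_raises h'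
  exact D.eq_of_toModel_eq
    (D.toModel_eq_of_highest (fun k => hv _ ⟨k, rfl⟩) (fun k => hv' _ ⟨k, rfl⟩)
      (h1.2.symm.trans h2.2)) (h1.1.symm.trans h2.1)

theorem Raises.mono {n : ℕ} {I J : Set ℕ} (h : I ⊆ J) {w v : List ℤ}
    (hw : ReflTransGen (Raises n I) w v) : ReflTransGen (Raises n J) w v :=
  hw.lift id (fun _ _ ⟨i, hi, h'⟩ => ⟨i, h hi, h'⟩)

/-- A set of colours of the crystal of words, any two of which are described by a rank-two
model. -/
theorem exists_rankTwoTyping {n : ℕ} (hn : 4 ≤ n) {J : Set ℕ} (hJ : J ⊆ Set.Icc 1 n) {i j : ℕ}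
    (hi : i ∈ J) (hj : j ∈ J) (hij : i ≠ j) :
    ∃ idx : Bool → ℕ, Nonempty (RankTwoTyping n idx) ∧ Set.range idx ⊆ J ∧
      i ∈ Set.range idx ∧ j ∈ Set.range idx := by
  have h1 := hJ hi
  have h2 := hJ hj
  rcases lt_or_gt_of_ne hij with h | h
  · refine ⟨_, exists_rankTwoTyping_of_lt hn h1.1 h h2.2, ?_, ⟨false, rfl⟩, ⟨true, rfl⟩⟩
    rintro _ ⟨k, rfl⟩; cases k <;> simpa
  · refine ⟨_, exists_rankTwoTyping_of_lt hn h2.1 h h1.2, ?_, ⟨true, rfl⟩, ⟨false, rfl⟩⟩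
    rintro _ ⟨k, rfl⟩; cases k <;> simpa

/-- A word can be raised to only one highest weight word. -/
theorem highest_unique {n : ℕ} (hn : 4 ≤ n) {J : Set ℕ} (hJ : J ⊆ Set.Icc 1 n) {w u u' : List ℤ}
    (h : ReflTransGen (Raises n J) w u) (h' : ReflTransGen (Raises n J) w u')
    (hu : IsHighest n J u) (hu' : IsHighest n J u') : u = u' := by
  induction hm : totalHeight n w using Nat.strong_induction_on generalizing w u u' with
  | _ m ih =>
    rcases h.cases_head with rfl | ⟨y, ⟨i, hi, hy⟩, hyu⟩
    · exact hu.eq_of_raises h'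
    rcases h'.cases_head with rfl | ⟨z, ⟨j, hj, hz⟩, hzu⟩
    · exact (hu'.eq_of_raises h).symm
    have hy1 := totalHeight_of_wordE hn hy
    have hz1 := totalHeight_of_wordE hn hz
    by_cases hij : i = j
    · subst hij
      obtain rfl : y = z := by simpa [hy] using hz
      exact ih _ (by omega) hyu hzu hu hu' rfl
    -- Local confluence, as in Newman's lemma: both raisings continue to the same highest weight
    -- word for the two colours `i` and `j`.
    · obtain ⟨idx, ⟨D⟩, hJ', hi', hj'⟩ := exists_rankTwoTyping hn hJ hi hj hij
      obtain ⟨v, hv, hvh⟩ := exists_highest hn (Set.range idx) y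
      obtain ⟨v', hv', hvh'⟩ := exists_highest hn (Set.range idx) z
      obtain rfl : v = v' :=
        D.highest_unique (.head ⟨i, hi', hy⟩ hv) (.head ⟨j, hj', hz⟩ hv') hvh hvh'
      obtain ⟨x, hx, hxh⟩ := exists_highest hn J v
      rw [ih _ (by omega) hyu ((Raises.mono hJ' hv).trans hx) hu hxh rfl,
        ih _ (by omega) hzu ((Raises.mono hJ' hv').trans hx) hu' hxh rfl]

/-! ### Isomorphic components -/

/-- `x` and `x'` arise from `u` and `u'` by the same sequence of lowering operators, with colours
in `J`; the number records the length of the sequence. -/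
inductive Paired (n : ℕ) (J : Set ℕ) (u u' : List ℤ) : ℕ → List ℤ → List ℤ → Prop
  | base : Paired n J u u' 0 u u'
  | step {d : ℕ} {x x' y y' : List ℤ} {i : ℕ} : Paired n J u u' d x x' → i ∈ J →
      wordF n i x = some y → wordF n i x' = some y' → Paired n J u u' (d + 1) y y'

namespace Paired

variable {n : ℕ} {J : Set ℕ} {u u' : List ℤ}

theorem symm {d : ℕ} {x x' : List ℤ} (h : Paired n J u u' d x x') : Paired n J u' u d x' x := by
  induction h with
  | base => exact .base
  | step _ hi h1 h2 ih => exact .step ih hi h2 h1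

theorem raises (hn : 4 ≤ n) {d : ℕ} {x x' : List ℤ} (h : Paired n J u u' d x x') :
    ReflTransGen (Raises n J) x u := by
  induction h with
  | base => exact .refl
  | step _ hi h1 _ ih => exact .head ⟨_, hi, (wordE_eq_some_iff (by omega)).2 h1⟩ ih

theorem totalHeight (hn : 4 ≤ n) {d : ℕ} {x x' : List ℤ} (h : Paired n J u u' d x x') :
    totalHeight n x = totalHeight n u + d := by
  induction h with
  | base => rfl
  | step _ hi h1 _ ih =>
    have := totalHeight_of_wordE hn ((wordE_eq_some_iff (by omega)).2 h1)
    omega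

/-- The two words agree as far as colours in `J` are concerned. -/
def Alike (n : ℕ) (J : Set ℕ) (x x' : List ℤ) : Prop :=
  ∀ i ∈ J, wordPhi n i x = wordPhi n i x' ∧ (wordE n i x = none ↔ wordE n i x' = none)

/-- The statement proved by induction on the depth in `alike_and_unique`. -/
def Good (n : ℕ) (J : Set ℕ) (u u' : List ℤ) (d : ℕ) : Prop :=
  ∀ x x', Paired n J u u' d x x' →
    Alike n J x x' ∧ ∀ d' x'', Paired n J u u' d' x x'' → x' = x''

/-- Descend from `u` to `x`. At each stage the partner has the same `φ_i`, so the next lowering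
operator applies to it too. -/
theorem exists_of_raises (hn : 4 ≤ n) {d : ℕ} (hg : ∀ d' < d, Good n J u u' d') {x : List ℤ}
    (h : ReflTransGen (Raises n J) x u) (hd : KRCrystal.totalHeight n x ≤ KRCrystal.totalHeight n u + d) :
    ∃ d' ≤ d, ∃ x', Paired n J u u' d' x x' := by
  induction h using ReflTransGen.head_induction_on generalizing d with
  | refl => exact ⟨0, by omega, u', .base⟩
  | @head x y hxy _ ih =>
    obtain ⟨i, hi, hxy⟩ := hxy
    have h1 := totalHeight_of_wordE hn hxy
    have hf := (wordE_eq_some_iff (by omega)).1 hxy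
    obtain _ | d := d
    · obtain ⟨d', hd', y', hy'⟩ := ih (d := 0) (by simp) (by omega)
      have := hy'.totalHeight hn
      omega
    obtain ⟨d', hd', y', hy'⟩ := ih (d := d) (fun e he => hg e (by omega)) (by omega)
    have h2 := (((hg d' (by omega)) y y' hy').1 i hi).1
    have h3 := wordF_some (by omega) hf
    obtain ⟨x', hx'⟩ := exists_wordF_of_pos (n := n) (i := i) (w := y') (by omega)
    exact ⟨d' + 1, by omega, x', .step hy' hi hf hx'⟩

/-- By uniqueness of highest weight words `y2` raises to `u`, so it has a partner `y2'`. Lowering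
`y2'` gives a partner of `y`, and this must be `y'`. -/
theorem exists_of_wordE (hn : 4 ≤ n) (hJ : J ⊆ Set.Icc 1 n) (hu : IsHighest n J u) {d : ℕ}
    (hg : ∀ d' ≤ d, Good n J u u' d') {y y' y2 : List ℤ} (h : Paired n J u u' d y y') {k : ℕ}
    (hk : k ∈ J) (he : wordE n k y = some y2) :
    ∃ d2, d = d2 + 1 ∧ ∃ y2', Paired n J u u' d2 y2 y2' ∧ wordE n k y' = some y2' := by
  have hf := (wordE_eq_some_iff (by omega)).1 he
  have h1 := totalHeight_of_wordE hn he
  have h2 := h.totalHeight hn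
  obtain ⟨z, hz, hzh⟩ := exists_highest hn J y2
  obtain rfl : u = z := highest_unique hn hJ (h.raises hn) (.head ⟨k, hk, he⟩ hz) hu hzh
  obtain _ | d := d
  · obtain ⟨d', hd', y2', hy2⟩ := exists_of_raises hn (d := 0) (u' := u') (by simp) hz (by omega)
    have := hy2.totalHeight hn
    omega
  obtain ⟨d', hd', y2', hy2⟩ :=
    exists_of_raises hn (d := d) (u' := u') (fun e he => hg e (by omega)) hz (by omega)
  obtain rfl : d' = d := by have := hy2.totalHeight hn; omega
  refine ⟨d', rfl, y2', hy2, ?_⟩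
  have h3 := (((hg d' (by omega)) y2 y2' hy2).1 k hk).1
  have h4 := wordF_some (by omega) hf
  obtain ⟨y'', hy''⟩ := exists_wordF_of_pos (n := n) (i := k) (w := y2') (by omega)
  obtain rfl := ((hg _ le_rfl) y y' h).2 _ _ (hy2.step hk hf hy'')
  exact (wordE_eq_some_iff (by omega)).2 hy''

/-- Raise `y` and `y'` in parallel within the two colours. At the top, equal values of `φ` force
equal elements of the model; as raising operators are injective in the model, this equality descends
to `y` and `y'`. -/
theorem exists_highest_pair (hn : 4 ≤ n) (hJ : J ⊆ Set.Icc 1 n) (hu : IsHighest n J u)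
    {idx : Bool → ℕ} (D : RankTwoTyping n idx) (hidx : Set.range idx ⊆ J) {d : ℕ}
    (hg : ∀ d' ≤ d, Good n J u u' d') {y y' : List ℤ} (h : Paired n J u u' d y y') :
    D.toModel y = D.toModel y' ∧ ∃ d' ≤ d, ∃ v v', Paired n J u u' d' v v' ∧
      IsHighest n (Set.range idx) v ∧ ReflTransGen (Raises n (Set.range idx)) y v ∧
      ReflTransGen (Raises n (Set.range idx)) y' v' := by
  induction d generalizing y y' with
  | zero =>
    cases h
    have hu' : ∀ k, wordE n (idx k) u' = none := fun k =>
      (((hg 0 le_rfl) u u' .base).1 _ (hidx ⟨k, rfl⟩)).2.1 (hu _ (hidx ⟨k, rfl⟩))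
    exact ⟨D.toModel_eq_of_phi_eq (fun k => hu _ (hidx ⟨k, rfl⟩)) hu' fun k =>
      (((hg 0 le_rfl) u u' .base).1 _ (hidx ⟨k, rfl⟩)).1,
      0, le_rfl, u, u', .base, fun i hi => hu i (hidx hi), .refl, .refl⟩
  | succ d ih =>
    have ha := ((hg _ le_rfl) y y' h).1
    by_cases hy : IsHighest n (Set.range idx) y
    · exact ⟨D.toModel_eq_of_phi_eq (fun k => hy _ ⟨k, rfl⟩)
        (fun k => (ha _ (hidx ⟨k, rfl⟩)).2.1 (hy _ ⟨k, rfl⟩)) fun k => (ha _ (hidx ⟨k, rfl⟩)).1,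
        d + 1, le_rfl, y, y', h, hy, .refl, .refl⟩
    · simp only [IsHighest, not_forall] at hy
      obtain ⟨_, ⟨k, rfl⟩, hne⟩ := hy
      obtain ⟨y2, hy2⟩ := Option.ne_none_iff_exists'.1 hne
      obtain ⟨d2, hd2, y2', hp, he'⟩ := exists_of_wordE hn hJ hu hg h (hidx ⟨k, rfl⟩) hy2
      obtain rfl : d = d2 := by omega
      obtain ⟨h1, d', hd', v, v', h2, h3, h4, h5⟩ := ih (fun e he => hg e (by omega)) hp
      exact ⟨D.toModel_of_e h1 hy2 he', d', by omega, v, v', h2, h3,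
        .head ⟨_, ⟨k, rfl⟩, hy2⟩ h4, .head ⟨_, ⟨k, rfl⟩, he'⟩ h5⟩

/-- Let `x` be `f̃_i` of `y`. Colour `i` itself is immediate; any other colour `j` is controlled by
the rank-two model for `i` and `j`, where `x` and `x'` have the same image. If `x` is also `f̃_j` of
`z`, then `y` and `z` share their highest weight word for these two colours, so the two partners of
`x` have the same record besides the same image in the model. -/
theorem good (hn : 4 ≤ n) (hJ : J ⊆ Set.Icc 1 n) (hu : IsHighest n J u) (hu' : IsHighest n J u')
    (hphi : ∀ i ∈ J, wordPhi n i u = wordPhi n i u') (d : ℕ) : Good n J u u' d := by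
  induction d using Nat.strong_induction_on with
  | _ d ih =>
    intro x x' hx
    cases hx with
    | base =>
      refine ⟨fun i hi => ⟨hphi i hi, by simp [hu i hi, hu' i hi]⟩, fun d' x'' h => ?_⟩
      have := h.totalHeight hn
      obtain rfl : d' = 0 := by omega
      cases h; rfl
    | @step d y y' _ _ i hp hi h1 h2 =>
      have hg : ∀ d' ≤ d, Good n J u u' d' := fun e he => ih e (by omega)
      have e1 := (wordE_eq_some_iff (by omega)).2 h1
      have e2 := (wordE_eq_some_iff (by omega)).2 h2
      constructor
      · intro j hj
        by_cases hij : i = j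
        · subst hij
          have h3 := wordF_some (by omega) h1
          have h4 := wordF_some (by omega) h2
          have h5 := ((hg d le_rfl y y' hp).1 i hi).1
          exact ⟨by omega, by simp [e1, e2]⟩
        · obtain ⟨idx, ⟨D⟩, hJ', ⟨k, rfl⟩, ⟨l, rfl⟩⟩ := exists_rankTwoTyping hn hJ hi hj hij
          obtain ⟨h3, -⟩ := exists_highest_pair hn hJ hu D hJ' hg hp
          have h4 := D.toModel_of_e h3 e1 e2
          exact ⟨D.wordPhi_eq h4 l, D.wordE_eq_none_iff h4 l⟩
      · intro d' x'' h'
        have hd := hp.step hi h1 h2 |>.totalHeight hn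
        have hd2 := h'.totalHeight hn
        obtain rfl : d' = d + 1 := by omega
        cases h' with
        | @step _ z z' _ _ j hq hj h3 h4 =>
          have e3 := (wordE_eq_some_iff (by omega)).2 h3
          have e4 := (wordE_eq_some_iff (by omega)).2 h4
          by_cases hij : i = j
          · subst hij
            obtain rfl : y = z := by simpa [e1] using e3
            obtain rfl := (hg d le_rfl y y' hp).2 _ _ hq
            simpa [h2] using h4
          · obtain ⟨idx, ⟨D⟩, hJ', hi', hj'⟩ := exists_rankTwoTyping hn hJ hi hj hij
            obtain ⟨a1, d1, hd1, v, v', a2, a3, a4, a5⟩ := exists_highest_pair hn hJ hu D hJ' hg hp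
            obtain ⟨b1, d2, hd2, t, t', b2, b3, b4, b5⟩ := exists_highest_pair hn hJ hu D hJ' hg hq
            obtain rfl : v = t :=
              D.highest_unique (.head ⟨i, hi', e1⟩ a4) (.head ⟨j, hj', e3⟩ b4) a3 b3
            obtain rfl := (hg d1 hd1 v v' a2).2 _ _ b2
            have r1 : D.record x' = D.record x'' := by
              rw [(D.record_shape_of_raises (.head ⟨i, hi', e2⟩ a5)).1,
                (D.record_shape_of_raises (.head ⟨j, hj', e4⟩ b5)).1]
            obtain ⟨k, rfl⟩ := hi'
            obtain ⟨l, rfl⟩ := hj'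
            exact D.eq_of_toModel_eq
              ((D.toModel_of_e a1 e1 e2).symm.trans (D.toModel_of_e b1 e3 e4)) r1

end Paired

/-! ### Legal tableaux -/

theorem height_neg {n : ℕ} {x : ℤ} (h : IsLetter n x) : height n (-x) = 2 * n - height n x := by
  unfold IsLetter at h
  unfold height
  split_ifs <;> grind

theorem IsLetter.neg {n : ℕ} {x : ℤ} (h : IsLetter n x) : IsLetter n (-x) := by
  simpa [IsLetter] using h

theorem eq_of_height_eq {n : ℕ} {x y : ℤ} (hx : IsLetter n x) (hy : IsLetter n y)
    (h : height n x = height n y) (hn : height n x ≠ n) : x = y := by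
  unfold IsLetter at hx hy
  unfold height at h hn
  split_ifs at h hn <;> grind

theorem eq_or_eq_neg_of_height_eq {n : ℕ} {x y : ℤ} (hx : IsLetter n x) (hy : IsLetter n y)
    (h : height n x = height n y) : x = y ∨ x = -y := by
  unfold IsLetter at hx hy
  unfold height at h
  split_ifs at h <;> grind

theorem LetterLE.refl (n : ℕ) (x : ℤ) : LetterLE n x x := .inl rfl

theorem LetterLE.trans {n : ℕ} {x y z : ℤ} (h : LetterLE n x y) (h' : LetterLE n y z) :
    LetterLE n x z := by
  unfold LetterLE at *
  grind

theorem LetterLE.height_le {n : ℕ} {x y : ℤ} (h : LetterLE n x y) : height n x ≤ height n y := by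
  unfold LetterLE at *
  grind

theorem LetterLE.eq_of_height_le {n : ℕ} {x y : ℤ} (h : LetterLE n x y)
    (h' : height n y ≤ height n x) : x = y := by
  unfold LetterLE at *
  grind

/-- The weak order on columns that consecutive columns of a tableau obey. -/
def ColLE (n : ℕ) (c d : ℤ × ℤ) : Prop := LetterLE n c.1 d.1 ∧ LetterLE n c.2 d.2

theorem ColLE.refl (n : ℕ) (c : ℤ × ℤ) : ColLE n c c := ⟨.refl n _, .refl n _⟩

theorem ColLE.trans {n : ℕ} {c d e : ℤ × ℤ} (h : ColLE n c d) (h' : ColLE n d e) : ColLE n c e :=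
  ⟨h.1.trans h'.1, h.2.trans h'.2⟩

instance (n : ℕ) : IsTrans (ℤ × ℤ) (ColLE n) := ⟨fun _ _ _ => ColLE.trans⟩

/-- An admissible column. -/
def IsCol (n : ℕ) (c : ℤ × ℤ) : Prop := (IsLetter n c.1 ∧ IsLetter n c.2) ∧ ¬ LetterLE n c.2 c.1

/-- Two columns that do not form a configuration with `n-1` and its bar around `n` or `n̄`. -/
def MiddleFree (n : ℕ) (c d : ℤ × ℤ) : Prop :=
  ¬ (c = ((n : ℤ) - 1, (n : ℤ)) ∧ d = ((n : ℤ), -((n : ℤ) - 1))) ∧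
    ¬ (c = ((n : ℤ) - 1, -(n : ℤ)) ∧ d = (-(n : ℤ), -((n : ℤ) - 1)))

theorem isLegal_iff {n : ℕ} {T : Tableau} :
    IsLegal n T ↔ (∀ c ∈ T, IsCol n c) ∧ T.Pairwise (ColLE n) ∧ T.Pairwise (MiddleFree n) := by
  rw [← List.isChain_iff_pairwise]
  constructor
  · rintro ⟨h1, h2, h3, h4⟩
    exact ⟨fun c hc => ⟨h1 c hc, h3 c hc⟩, h2, h4⟩
  · rintro ⟨h1, h2, h3⟩
    exact ⟨fun c hc => (h1 c hc).1, h2, fun c hc => (h1 c hc).2, h3⟩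

theorem IsLegal.sublist {n : ℕ} {T t : Tableau} (h : IsLegal n T) (ht : t.Sublist T) :
    IsLegal n t := by
  rw [isLegal_iff] at *
  exact ⟨fun c hc => h.1 c (ht.subset hc), h.2.1.sublist ht, h.2.2.sublist ht⟩

/-- The sum of the heights of the entries of a column. -/
def colHeight (n : ℕ) (c : ℤ × ℤ) : ℤ := height n c.1 + height n c.2

theorem IsCol.height_le {n : ℕ} {c : ℤ × ℤ} (h : IsCol n c) : height n c.1 ≤ height n c.2 := by
  have := h.2
  unfold LetterLE at this
  omega

/-- The height only confuses `n` with `n̄`, so the alternative to `b = ā` is `b = a`, which no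
column satisfies. -/
theorem IsCol.colHeight_eq_iff {n : ℕ} {c : ℤ × ℤ} (h : IsCol n c) :
    colHeight n c = 2 * n ↔ c.2 = -c.1 := by
  have h1 := height_neg h.1.1
  constructor
  · intro h2
    unfold colHeight at h2
    rcases eq_or_eq_neg_of_height_eq h.1.2 h.1.1.neg (by omega) with h3 | h3
    · exact h3
    · exact absurd (.inl (by simpa using h3)) h.2
  · intro h2
    rw [colHeight, h2, h1]; omega

theorem ColLE.colHeight_le {n : ℕ} {c d : ℤ × ℤ} (h : ColLE n c d) :
    colHeight n c ≤ colHeight n d := by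
  have h1 := h.1.height_le
  have h2 := h.2.height_le
  unfold colHeight; omega

/-- Hence `colHeight` increases strictly between distinct columns of a tableau, and all columns of
the form `(a, ā)` in it are equal and consecutive. -/
theorem ColLE.eq_of_colHeight_le {n : ℕ} {c d : ℤ × ℤ} (h : ColLE n c d)
    (h' : colHeight n d ≤ colHeight n c) : c = d := by
  have h1 := h.1.height_le
  have h2 := h.2.height_le
  unfold colHeight at h'
  exact Prod.ext (h.1.eq_of_height_le (by omega)) (h.2.eq_of_height_le (by omega))

/-- The columns `(a, b)` with `b < ā`. -/
def leftPart (n : ℕ) (T : Tableau) : Tableau := T.filter (fun c => colHeight n c < 2 * n)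

/-- The columns `(a, b)` with `ā < b`. -/
def rightPart (n : ℕ) (T : Tableau) : Tableau := T.filter (fun c => 2 * n < colHeight n c)

/-- A tableau is `L ++ z^r ++ R`, where `L` and `R` consist of columns of smaller and larger height
than the column `z = (a, ā)`. -/
theorem parts_of_eq_append {n r : ℕ} {T L R : Tableau} {z : ℤ × ℤ}
    (hT : T = L ++ List.replicate r z ++ R) (hL : ∀ c ∈ L, colHeight n c < 2 * n)
    (hz : r ≠ 0 → colHeight n z = 2 * n) (hR : ∀ c ∈ R, 2 * n < colHeight n c) :
    leftPart n T = L ∧ rightPart n T = R := by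
  subst hT
  simp only [leftPart, rightPart, List.filter_append]
  have h1 : L.filter (fun c => colHeight n c < 2 * n) = L :=
    List.filter_eq_self.2 (by simpa using hL)
  have h2 : R.filter (fun c => 2 * n < colHeight n c) = R :=
    List.filter_eq_self.2 (by simpa using hR)
  have h3 : L.filter (fun c => 2 * n < colHeight n c) = [] :=
    List.filter_eq_nil_iff.2 (by simpa using fun a b h => (hL (a, b) h).le)
  have h4 : R.filter (fun c => colHeight n c < 2 * n) = [] :=
    List.filter_eq_nil_iff.2 (by simpa using fun a b h => (hR (a, b) h).le)
  rw [h1, h2, h3, h4]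
  by_cases hr : r = 0
  · simp [hr]
  · have h := hz hr
    simp [h]

theorem exists_parts {n : ℕ} {T : Tableau} (h : T.Pairwise (ColLE n)) :
    ∃ r z, T = leftPart n T ++ List.replicate r z ++ rightPart n T ∧
      (r ≠ 0 → colHeight n z = 2 * n) := by
  induction T with
  | nil => exact ⟨0, (0, 0), by simp [leftPart, rightPart]⟩
  | cons c T ih =>
    rw [List.pairwise_cons] at h
    obtain ⟨r, z, hT, hz⟩ := ih h.2
    have hle : ∀ d ∈ T, colHeight n c ≤ colHeight n d := fun d hd => (h.1 d hd).colHeight_le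
    rcases lt_trichotomy (colHeight n c) (2 * n) with hc | hc | hc
    · refine ⟨r, z, ?_, hz⟩
      have h1 : leftPart n (c :: T) = c :: leftPart n T := by simp [leftPart, hc]
      have h2 : rightPart n (c :: T) = rightPart n T := by simp [rightPart, hc.le]
      rw [h1, h2, List.cons_append, List.cons_append, ← hT]
    · have h0 : leftPart n T = [] := List.filter_eq_nil_iff.2 fun d hd => by
        have := hle d hd; simp; omega
      have h1 : leftPart n (c :: T) = [] := by
        rw [← h0]; simp [leftPart, hc]
      have h2 : rightPart n (c :: T) = rightPart n T := by simp [rightPart, hc.le]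
      refine ⟨r + 1, c, ?_, fun _ => hc⟩
      have h3 : List.replicate r z = List.replicate r c := by
        by_cases hr : r = 0
        · simp [hr]
        · have hm : z ∈ T := by rw [hT]; simp [hr]
          rw [(h.1 z hm).eq_of_colHeight_le (by rw [hz hr, hc])]
      rw [h1, h2, List.replicate_succ, List.nil_append, List.cons_append, ← h3]
      rw [h0, List.nil_append] at hT
      rw [← hT]
    · have h0 : T = rightPart n T := (List.filter_eq_self.2 fun d hd => by
        have := hle d hd; simp; omega).symm
      refine ⟨0, c, ?_, by simp⟩
      have h1 : leftPart n (c :: T) = [] := List.filter_eq_nil_iff.2 fun d hd => by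
        rcases List.mem_cons.1 hd with rfl | hd
        · simp; omega
        · have := hle d hd; simp; omega
      have h2 : rightPart n (c :: T) = c :: rightPart n T := by simp [rightPart, hc]
      rw [h1, h2, ← h0]; rfl

theorem mem_leftPart {n : ℕ} {T : Tableau} {c : ℤ × ℤ} :
    c ∈ leftPart n T ↔ c ∈ T ∧ colHeight n c < 2 * n := by
  simp [leftPart]

theorem mem_rightPart {n : ℕ} {T : Tableau} {c : ℤ × ℤ} :
    c ∈ rightPart n T ↔ c ∈ T ∧ 2 * n < colHeight n c := by
  simp [rightPart]

/-! ### The drop and fill maps -/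

/-- The adjacency condition of Kashiwara--Nakashima tableaux. -/
def Separated (c d : ℤ × ℤ) : Prop := ¬ (d.1 = c.1 ∧ d.2 = -c.1) ∧ ¬ (c.2 = -c.1 ∧ d.2 = -c.1)

/-- A block of columns `(a, ā)` between `L` and `R` is adjacent to a column with top entry `a` on
its left or to a column with bottom entry `ā` on its right. -/
def Touches (L R : Tableau) (a : ℤ) : Prop :=
  (∃ c ∈ L.getLast?, c.1 = a) ∨ ∃ d ∈ R.head?, d.2 = -a

/-- `T` is `L (a, ā)^r R` with columns of height smaller, equal, and larger than that of `(a, ā)`. -/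
structure HasParts (n : ℕ) (T L : Tableau) (r : ℕ) (a : ℤ) (R : Tableau) : Prop where
  eq : T = L ++ List.replicate r (a, -a) ++ R
  left : ∀ c ∈ L, colHeight n c < 2 * n
  mid : r ≠ 0 → colHeight n (a, -a) = 2 * n
  right : ∀ c ∈ R, 2 * n < colHeight n c

theorem HasParts.unique {n : ℕ} {T L R L' R' : Tableau} {r r' : ℕ} {a a' : ℤ}
    (h : HasParts n T L r a R) (h' : HasParts n T L' r' a' R') :
    L = L' ∧ R = R' ∧ r = r' ∧ (r ≠ 0 → a = a') := by
  obtain ⟨h1, h2⟩ := parts_of_eq_append h.eq h.left h.mid h.right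
  obtain ⟨h3, h4⟩ := parts_of_eq_append h'.eq h'.left h'.mid h'.right
  have hL := h1.symm.trans h3
  have hR := h2.symm.trans h4
  subst hL hR
  have he := h.eq.symm.trans h'.eq
  rw [List.append_assoc, List.append_assoc, List.append_cancel_left_eq,
    List.append_cancel_right_eq] at he
  have hl : r = r' := by simpa using congrArg List.length he
  subst hl
  refine ⟨rfl, rfl, rfl, fun hr => ?_⟩
  have hm : (a, -a) ∈ List.replicate r (a', -a') := by rw [← he]; simp [hr]
  exact congrArg Prod.fst (List.eq_of_mem_replicate hm)

theorem IsLegal.isCol {n : ℕ} {T : Tableau} (h : IsLegal n T) {c : ℤ × ℤ} (hc : c ∈ T) :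
    IsCol n c := (isLegal_iff.1 h).1 c hc

theorem IsLegal.exists_hasParts {n : ℕ} {T : Tableau} (h : IsLegal n T) :
    ∃ L r a R, HasParts n T L r a R := by
  obtain ⟨r, z, hT, hz⟩ := exists_parts (isLegal_iff.1 h).2.1
  have hz' : List.replicate r z = List.replicate r (z.1, -z.1) := by
    by_cases hr : r = 0
    · simp [hr]
    · have hm : z ∈ T := by rw [hT]; simp [hr]
      rw [← ((h.isCol hm).colHeight_eq_iff.1 (hz hr))]
  refine ⟨leftPart n T, r, z.1, rightPart n T, by rw [← hz', ← hT],
    fun c hc => (mem_leftPart.1 hc).2, fun hr => ?_, fun c hc => (mem_rightPart.1 hc).2⟩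
  have hm : z ∈ T := by rw [hT]; simp [hr]
  rw [← ((h.isCol hm).colHeight_eq_iff.1 (hz hr))]
  exact hz hr

theorem isCol_diag_iff {n : ℕ} {a : ℤ} :
    IsCol n (a, -a) ↔ (1 ≤ a ∧ a ≤ n) ∨ (a = -(n : ℤ) ∧ n ≠ 0) := by
  unfold IsCol IsLetter LetterLE height
  grind

theorem HasParts.isCol {n : ℕ} {T L R : Tableau} {r : ℕ} {a : ℤ} (h : HasParts n T L r a R)
    (hT : IsLegal n T) (hr : r ≠ 0) : IsCol n (a, -a) :=
  hT.isCol (by rw [h.eq]; simp [hr])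

theorem IsCol.colHeight_diag {n : ℕ} {a : ℤ} (h : IsCol n (a, -a)) :
    colHeight n (a, -a) = 2 * n := h.colHeight_eq_iff.2 rfl

/-- Both adjacency conditions involve a column `(a, ā)`. They amount to this: the middle block has
at most one column, and it does not touch its neighbours. -/
theorem IsKN.hasParts {n k : ℕ} {T L R : Tableau} {r : ℕ} {a : ℤ} (hT : IsKN n k T)
    (h : HasParts n T L r a R) : r = 0 ∨ (r = 1 ∧ ¬ Touches L R a ∧ a ≠ 1) := by
  by_cases hr : r = 0
  · exact .inl hr
  right
  have hc : T.IsChain Separated := hT.adjacent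
  rw [h.eq, List.isChain_append, List.isChain_append] at hc
  obtain ⟨⟨-, hc1, hc2⟩, -, hc3⟩ := hc
  have hr1 : r = 1 := by
    by_contra hr1
    obtain ⟨r', rfl⟩ : ∃ r', r = r' + 2 := ⟨r - 2, by omega⟩
    simp [List.replicate_succ, Separated] at hc1
  subst hr1
  refine ⟨rfl, ?_, ?_⟩
  · rintro (⟨c, hc, rfl⟩ | ⟨d, hd, hd'⟩)
    · exact (hc2 c hc (c.1, -c.1) (by simp)).1 (by simp)
    · exact (hc3 (a, -a) (by simp) d hd).2 (by simpa using hd')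
  · rintro rfl
    exact hT.no_one (by rw [h.eq]; simp)

theorem HasParts.isKN {n : ℕ} {T L R : Tableau} {r : ℕ} {a : ℤ} (h : HasParts n T L r a R)
    (hT : IsLegal n T) (hr : r = 0 ∨ (r = 1 ∧ ¬ Touches L R a ∧ a ≠ 1)) :
    IsKN n T.length T := by
  have hm : ∀ c ∈ T, c.2 = -c.1 → r ≠ 0 ∧ c = (a, -a) := by
    intro c hc hc'
    have h2 := (hT.isCol hc).colHeight_eq_iff.2 hc'
    rw [h.eq] at hc
    simp only [List.mem_append, List.mem_replicate] at hc
    rcases hc with (hc | hc) | hc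
    · have := h.left c hc; omega
    · exact hc
    · have := h.right c hc; omega
  refine ⟨rfl, hT, ?_, ?_⟩
  · change T.IsChain Separated
    have hs : ∀ c d : ℤ × ℤ, c.2 ≠ -c.1 → d.2 ≠ -d.1 → Separated c d := by
      unfold Separated; grind
    have hne : ∀ c ∈ T, colHeight n c ≠ 2 * n → c.2 ≠ -c.1 := fun c hc h1 h2 =>
      h1 ((hT.isCol hc).colHeight_eq_iff.2 h2)
    have hL' : ∀ c ∈ L, c.2 ≠ -c.1 := fun c hc => hne c (by rw [h.eq]; simp [hc]) (h.left c hc).ne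
    have hR' : ∀ c ∈ R, c.2 ≠ -c.1 := fun c hc =>
      hne c (by rw [h.eq]; simp [hc]) (h.right c hc).ne'
    have hL : L.IsChain Separated :=
      (List.pairwise_of_forall_mem_list fun c hc d hd => hs c d (hL' c hc) (hL' d hd)).isChain
    have hR : R.IsChain Separated :=
      (List.pairwise_of_forall_mem_list fun c hc d hd => hs c d (hR' c hc) (hR' d hd)).isChain
    rcases hr with rfl | ⟨rfl, hr, -⟩
    · rw [h.eq]
      simp only [List.replicate_zero, List.append_nil, List.isChain_append]
      exact ⟨hL, hR, fun c hc d hd =>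
        hs c d (hL' c (List.mem_of_getLast? hc)) (hR' d (List.mem_of_head? hd))⟩
    · rw [h.eq, List.isChain_append, List.isChain_append]
      refine ⟨⟨hL, by simp, fun c hc d hd => ?_⟩, hR, fun c hc d hd => ?_⟩
      · simp only [List.replicate_one, List.head?_cons, Option.mem_def, Option.some.injEq] at hd
        subst hd
        have h1 := hL' c (List.mem_of_getLast? hc)
        have h2 : c.1 ≠ a := fun h2 => hr (.inl ⟨c, hc, h2⟩)
        unfold Separated; grind
      · rw [List.replicate_one, List.getLast?_append] at hc
        simp only [List.getLast?_singleton, Option.some_or, Option.mem_def,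
          Option.some.injEq] at hc
        subst hc
        have h1 := hR' d (List.mem_of_head? hd)
        have h2 : d.2 ≠ -a := fun h2 => hr (.inr ⟨d, hd, h2⟩)
        unfold Separated; grind
  · intro h1
    obtain ⟨h2, h3⟩ := hm _ h1 (by norm_num)
    have : a = 1 := (congrArg Prod.fst h3).symm
    grind

theorem IsLegal.colLE {n : ℕ} {T : Tableau} (h : IsLegal n T) : T.Pairwise (ColLE n) :=
  (isLegal_iff.1 h).2.1

/-- The defining property of the drop map determines its value. -/
theorem HasParts.dropsTo {n : ℕ} {T L R t : Tableau} {r : ℕ} {a : ℤ} (h : HasParts n T L r a R)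
    (hT : IsLegal n T) (ht : DropsTo n T t) :
    r ≠ 0 ∧ (Touches L R a ∧ t = L ++ R ∨ ¬ Touches L R a ∧ t = L ++ [(a, -a)] ++ R) := by
  -- A block that cannot be extended is the whole middle part: since columns increase, everything
  -- before it has smaller height and everything after it larger height.
  have key : ∀ (L' R' : Tableau) (b : ℤ) (m : ℕ), m ≠ 0 →
      T = L' ++ List.replicate m (b, -b) ++ R' → (∀ c ∈ L'.getLast?, c ≠ (b, -b)) →
      (∀ c ∈ R'.head?, c ≠ (b, -b)) → L' = L ∧ R' = R ∧ m = r ∧ b = a := by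
    intro L' R' b m hm hT' hL' hR'
    have hb : colHeight n (b, -b) = 2 * n := (hT.isCol (c := (b, -b))
      (by rw [hT']; simp [hm])).colHeight_diag
    have hp := hT.colLE
    rw [hT', List.pairwise_append, List.pairwise_append] at hp
    obtain ⟨⟨hp1, -, hp2⟩, hp3, hp4⟩ := hp
    have hparts : HasParts n T L' m b R' := by
      refine ⟨hT', fun c hc => ?_, fun _ => hb, fun c hc => ?_⟩
      · have hle : ∀ c ∈ L', colHeight n c ≤ 2 * n := fun c hc => by
          rw [← hb]; exact (hp2 c hc (b, -b) (by simp [hm])).colHeight_le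
        refine lt_of_le_of_ne (hle c hc) fun he => ?_
        obtain ⟨L₀, x, rfl⟩ := (List.eq_nil_or_concat' L').resolve_left (List.ne_nil_of_mem hc)
        have hx : x ≠ (b, -b) := hL' x (by simp)
        have hcx : colHeight n c ≤ colHeight n x := by
          rw [List.pairwise_append] at hp1
          rcases List.mem_append.1 hc with hc | hc
          · exact (hp1.2.2 c hc x (by simp)).colHeight_le
          · rw [List.mem_singleton.1 hc]
        exact hx ((hp2 x (by simp) (b, -b) (by simp [hm])).eq_of_colHeight_le (by omega))
      · have hle : ∀ c ∈ R', 2 * n ≤ colHeight n c := fun c hc => by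
          rw [← hb]; exact (hp4 (b, -b) (by simp [hm]) c hc).colHeight_le
        refine lt_of_le_of_ne (hle c hc) fun he => ?_
        cases R' with
        | nil => simp at hc
        | cons x R₀ =>
          have hx : x ≠ (b, -b) := hR' x (by simp)
          have hcx : colHeight n x ≤ colHeight n c := by
            rw [List.pairwise_cons] at hp3
            rcases List.mem_cons.1 hc with hc | hc
            · rw [hc]
            · exact (hp3.1 c hc).colHeight_le
          exact hx (((hp4 (b, -b) (by simp [hm]) x (by simp)).eq_of_colHeight_le
            (by omega)).symm)
    obtain ⟨h1, h2, h3, h4⟩ := hparts.unique h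
    exact ⟨h1, h2, h3, h4 hm⟩
  obtain ⟨b, m, L', R', -, hm, (⟨h1, h2, ⟨c, hc, h3⟩, h4⟩ | ⟨h1, h2, h3, ⟨d, hd, h4⟩⟩ |
    ⟨h1, h2, h3, h4⟩)⟩ := ht
  · obtain ⟨rfl, rfl, rfl, rfl⟩ := key L' R' b m hm.ne' h1
      (fun c' hc' => by rw [Option.mem_unique hc' hc]; grind) h4
    exact ⟨hm.ne', .inl ⟨.inl ⟨c, hc, h3.1⟩, h2⟩⟩
  · obtain ⟨rfl, rfl, rfl, rfl⟩ := key L' R' b m hm.ne' h1 h3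
      (fun c' hc' => by rw [Option.mem_unique hc' hd]; grind)
    exact ⟨hm.ne', .inl ⟨.inr ⟨d, hd, h4.2⟩, h2⟩⟩
  · obtain ⟨rfl, rfl, rfl, rfl⟩ := key L' R' b (m + 1) (by omega) h1
      (fun c' hc' => by have := h3 c' hc'; grind) (fun c' hc' => by have := h4 c' hc'; grind)
    refine ⟨by omega, .inr ⟨?_, h2⟩⟩
    rintro (⟨c, hc, hc'⟩ | ⟨d, hd, hd'⟩)
    · exact h3 c hc hc'
    · exact h4 d hd hd'

theorem HasParts.exists_dropsTo {n : ℕ} {T L R : Tableau} {r : ℕ} {a : ℤ}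
    (h : HasParts n T L r a R) (hT : IsLegal n T) (hr : r ≠ 0) (h' : r = 1 → Touches L R a) :
    ∃ t, DropsTo n T t := by
  have ha : (1 ≤ a ∧ a ≤ n) ∨ a = -(n : ℤ) := (isCol_diag_iff.1 (h.isCol hT hr)).imp_right (·.1)
  have hz := h.mid hr
  by_cases ht : Touches L R a
  · refine ⟨L ++ R, a, r, L, R, ha, by omega, ?_⟩
    have hL : ∀ c ∈ L.getLast?, c ≠ (a, -a) := fun c hc he => by
      have := h.left c (List.mem_of_getLast? hc); rw [he] at this; omega
    have hR : ∀ c ∈ R.head?, c ≠ (a, -a) := fun c hc he => by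
      have := h.right c (List.mem_of_head? hc); rw [he] at this; omega
    rcases ht with ⟨c, hc, hc'⟩ | ⟨d, hd, hd'⟩
    · refine .inl ⟨h.eq, rfl, ⟨c, hc, hc', fun h2 => hL c hc (Prod.ext hc' h2)⟩, hR⟩
    · refine .inr (.inl ⟨h.eq, rfl, hL, ⟨d, hd, fun h2 => hR d hd (Prod.ext h2 hd'), hd'⟩⟩)
  · obtain ⟨m, rfl⟩ : ∃ m, r = m + 2 := by
      refine ⟨r - 2, ?_⟩
      have : r ≠ 1 := fun h1 => ht (h' h1)
      omega
    exact ⟨L ++ [(a, -a)] ++ R, a, m + 1, L, R, ha, by omega, .inr (.inr ⟨h.eq, rfl,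
      fun c hc h1 => ht (.inl ⟨c, hc, h1⟩), fun c hc h1 => ht (.inr ⟨c, hc, h1⟩)⟩)⟩

/-- As `1` is the least letter and `1̄` the greatest, a column before `(1, 1̄)` has top entry `1`
and a column after it has bottom entry `1̄`. Any other column is therefore touched. -/
theorem HasParts.touches_one {n : ℕ} {T L R : Tableau} {r : ℕ} {a : ℤ}
    (h : HasParts n T L r a R) (hT : IsLegal n T) (hne : T ≠ List.replicate T.length (1, -1))
    (ha : a = 1) (hr : r ≠ 0) : Touches L R a := by
  subst ha
  by_contra ht
  have hp := hT.colLE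
  rw [h.eq, List.pairwise_append, List.pairwise_append] at hp
  obtain ⟨⟨-, -, hp1⟩, -, hp2⟩ := hp
  have hL : L = [] := by
    refine (List.eq_nil_or_concat' L).resolve_right ?_
    rintro ⟨L₀, x, rfl⟩
    refine ht (.inl ⟨x, by simp, ?_⟩)
    have hx := (hT.isCol (c := x) (by rw [h.eq]; simp)).1.1
    have := (hp1 x (by simp) (1, -1) (by simp [hr])).1
    unfold IsLetter at hx
    unfold LetterLE height at this
    grind
  have hR : R = [] := by
    cases R with
    | nil => rfl
    | cons x R₀ =>
      exfalso
      refine ht (.inr ⟨x, by simp, ?_⟩)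
      have hx := (hT.isCol (c := x) (by rw [h.eq]; simp)).1.2
      have := (hp2 (1, -1) (by simp [hr]) x (by simp)).2
      unfold IsLetter at hx
      unfold LetterLE height at this
      grind
  subst hL hR
  apply hne
  have := h.eq
  simp only [List.nil_append, List.append_nil] at this
  rw [this, List.length_replicate]

open Classical in
-- A closed form in place of the choice made in `drop`: a touching block disappears and a free block
-- shrinks to one column. The block `(1, 1̄)^s` has to be excluded, since it is free but drops to
-- the empty tableau.
theorem drop_eq {n s : ℕ} {T : Btilde n s} {L R : Tableau} {r : ℕ} {a : ℤ}
    (h : HasParts n T.1 L r a R) (hne : T.1 ≠ List.replicate s (1, -1)) :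
    drop T = L ++ List.replicate (if Touches L R a then 0 else min r 1) (a, -a) ++ R := by
  have hT := T.2.2
  rw [drop, if_neg hne]
  have hone := h.touches_one hT (by rwa [T.2.1])
  by_cases hk : IsKN n s T.1
  · rw [if_pos hk]
    rcases hk.hasParts h with rfl | ⟨rfl, ht, -⟩
    · have := h.eq
      split_ifs <;> simpa using this
    · rw [if_neg ht]; simpa using h.eq
  · rw [if_neg hk]
    have hnk : ¬ (r = 0 ∨ (r = 1 ∧ ¬ Touches L R a ∧ a ≠ 1)) := fun hr => hk <| by
      have := h.isKN hT hr
      rwa [T.2.1] at this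
    have hr : r ≠ 0 := fun h0 => hnk (.inl h0)
    have hex := h.exists_dropsTo hT hr fun h1 => by
      by_contra ht
      exact hnk (.inr ⟨h1, ht, fun ha => ht (hone ha hr)⟩)
    have hd := h.dropsTo hT (Classical.epsilon_spec hex)
    rcases hd.2 with ⟨ht, he⟩ | ⟨ht, he⟩
    · rw [he, if_pos ht]; simp
    · rw [he, if_neg ht, min_eq_right (by omega)]; simp

theorem drop_replicate {n s : ℕ} {T : Btilde n s} (h : T.1 = List.replicate s (1, -1)) :
    drop T = [] := by rw [drop, if_pos h]

theorem exists_isKN_drop {n s : ℕ} (T : Btilde n s) : IsKN n (drop T).length (drop T) ∧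
    (drop T).length ≤ s := by
  classical
  have hT := T.2.2
  by_cases hne : T.1 = List.replicate s (1, -1)
  · rw [drop_replicate hne]
    exact ⟨⟨rfl, hT.sublist (List.nil_sublist _), by simp, by simp⟩, by simp⟩
  obtain ⟨L, r, a, R, h⟩ := hT.exists_hasParts
  have hd := drop_eq h hne
  set r' := if Touches L R a then 0 else min r 1 with hr'
  have hle : r' ≤ r := by rw [hr']; split_ifs <;> omega
  have hsub : (drop T).Sublist T.1 := by
    rw [hd, h.eq]
    exact (List.Sublist.append_left ((List.replicate_sublist_replicate _).2 hle) _).append_right _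
  have hp : HasParts n (drop T) L r' a R := ⟨hd, h.left, fun h0 => h.mid (by omega), h.right⟩
  refine ⟨hp.isKN (hT.sublist hsub) ?_, by have := hsub.length_le; rwa [T.2.1] at this⟩
  rw [hr']
  split_ifs with ht
  · exact .inl rfl
  · by_cases hr : r = 0
    · exact .inl (by omega)
    · exact .inr ⟨by omega, ht, fun ha => ht (h.touches_one hT (by rwa [T.2.1]) ha hr)⟩

/-- `L` and `R` survive the drop, and the length `s` gives the size of the block. If the block
vanished, its letter is an entry of a neighbouring column or the bar of one; when the two tableaux
refer to different neighbours, the row conditions of both force the two letters to agree. -/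
theorem drop_injective {n s : ℕ} {T T' : Btilde n s} (h : drop T = drop T') : T = T' := by
  classical
  have aux : ∀ T T' : Btilde n s, drop T = drop T' → T.1 = List.replicate s (1, -1) →
      T.1 = T'.1 := by
    intro T T' h h1
    by_contra hne
    rw [h1] at hne
    obtain ⟨L, r, a, R, hp⟩ := T'.2.2.exists_hasParts
    rw [drop_replicate h1, drop_eq hp (Ne.symm hne)] at h
    have h := h.symm
    simp only [List.append_eq_nil_iff] at h
    obtain ⟨⟨rfl, h⟩, rfl⟩ := h
    have ht : ¬ Touches [] [] a := by simp [Touches]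
    rw [if_neg ht] at h
    have hr : r = 0 := by
      by_contra hr
      simp at h
      omega
    have hs := T'.2.1
    rw [hp.eq, hr] at hs
    simp at hs
    apply hne
    rw [hp.eq, hr, ← hs]; simp
  by_cases h1 : T.1 = List.replicate s (1, -1)
  · exact Subtype.ext (aux T T' h h1)
  by_cases h2 : T'.1 = List.replicate s (1, -1)
  · exact Subtype.ext (aux T' T h.symm h2).symm
  obtain ⟨L, r, a, R, hp⟩ := T.2.2.exists_hasParts
  obtain ⟨L', r', a', R', hp'⟩ := T'.2.2.exists_hasParts
  have e := drop_eq hp h1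
  have e' := drop_eq hp' h2
  have q : HasParts n (drop T) L (if Touches L R a then 0 else min r 1) a R :=
    ⟨e, hp.left, fun h0 => hp.mid (by intro h; simp [h] at h0), hp.right⟩
  have q' : HasParts n (drop T) L' (if Touches L' R' a' then 0 else min r' 1) a' R' :=
    ⟨h.trans e', hp'.left, fun h0 => hp'.mid (by intro h; simp [h] at h0), hp'.right⟩
  obtain ⟨rfl, rfl, hx, ha⟩ := q.unique q'
  have hr : r = r' := by
    have h3 := T.2.1
    have h4 := T'.2.1
    rw [hp.eq] at h3
    rw [hp'.eq] at h4
    simp at h3 h4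
    omega
  subst hr
  refine Subtype.ext ?_
  rw [hp.eq, hp'.eq]
  by_cases hr : r = 0
  · rw [hr]; rfl
  suffices a = a' by rw [this]
  by_cases ht : Touches L R a
  swap
  · exact ha (by rw [if_neg ht]; omega)
  rw [if_pos ht] at hx
  have ht' : Touches L R a' := by
    by_contra ht'
    rw [if_neg ht'] at hx
    omega
  have hx : IsLetter n a := (hp.isCol T.2.2 hr).1.1
  have hx' : IsLetter n a' := (hp'.isCol T'.2.2 hr).1.1
  have key : LetterLE n a a' → LetterLE n (-a) (-a') → a = a' := fun h3 h4 => by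
    have h5 := h4.height_le
    rw [height_neg hx, height_neg hx'] at h5
    exact h3.eq_of_height_le (by omega)
  have key' : LetterLE n a' a → LetterLE n (-a') (-a) → a = a' := fun h3 h4 => by
    have h5 := h4.height_le
    rw [height_neg hx, height_neg hx'] at h5
    exact (h3.eq_of_height_le (by omega)).symm
  have hl : ∀ T : Btilde n s, ∀ b, HasParts n T.1 L r b R → ∀ c ∈ L.getLast?, LetterLE n c.1 b := by
    intro T b hp c hc
    have := T.2.2.colLE
    rw [hp.eq, List.pairwise_append, List.pairwise_append] at this
    exact (this.1.2.2 c (List.mem_of_getLast? hc) (b, -b) (by simp [hr])).1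
  have hl' : ∀ T : Btilde n s, ∀ b, HasParts n T.1 L r b R → ∀ c ∈ R.head?,
      LetterLE n (-b) c.2 := by
    intro T b hp c hc
    have := T.2.2.colLE
    rw [hp.eq, List.pairwise_append, List.pairwise_append] at this
    exact (this.2.2 (b, -b) (by simp [hr]) c (List.mem_of_head? hc)).2
  rcases ht with ⟨c, hc, rfl⟩ | ⟨d, hd, hd'⟩
  · rcases ht' with ⟨c', hc', rfl⟩ | ⟨d', hd', hd''⟩
    · rw [Option.mem_unique hc hc']
    · exact key (hl T' a' hp' c hc) (by rw [← hd'']; exact hl' T c.1 hp d' hd')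
  · rcases ht' with ⟨c', hc', rfl⟩ | ⟨d', hd'', hd'''⟩
    · exact key' (hl T a hp c' hc') (by rw [← hd']; exact hl' T' c'.1 hp' d hd)
    · have := Option.mem_unique hd hd''
      subst this
      omega

/-- Copies of an admissible column `(a, ā)` fit between `L` and `R` as soon as they fit next to
the neighbouring columns. -/
theorem IsLegal.insert {n m : ℕ} {L R : Tableau} {a : ℤ} (h : IsLegal n (L ++ R))
    (ha : IsCol n (a, -a)) (hL : ∀ c ∈ L, ColLE n c (a, -a))
    (hR : ∀ c ∈ R, ColLE n (a, -a) c) : IsLegal n (L ++ List.replicate m (a, -a) ++ R) := by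
  have hm1 : ∀ c, MiddleFree n c (a, -a) := by unfold MiddleFree; grind
  have hm2 : ∀ c, MiddleFree n (a, -a) c := by unfold MiddleFree; grind
  obtain ⟨h1, h2, h3⟩ := isLegal_iff.1 h
  rw [List.pairwise_append] at h2 h3
  refine isLegal_iff.2 ⟨fun c hc => ?_, ?_, ?_⟩
  · simp only [List.mem_append, List.mem_replicate] at hc
    rcases hc with (hc | hc) | hc
    · exact h1 c (by simp [hc])
    · rw [hc.2]; exact ha
    · exact h1 c (by simp [hc])
  · rw [List.pairwise_append, List.pairwise_append, List.pairwise_replicate]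
    refine ⟨⟨h2.1, .inr (.refl _ _), fun c hc d hd => ?_⟩, h2.2.1, fun c hc d hd => ?_⟩
    · rw [List.eq_of_mem_replicate hd]; exact hL c hc
    · rcases List.mem_append.1 hc with hc | hc
      · exact h2.2.2 c hc d hd
      · rw [List.eq_of_mem_replicate hc]; exact hR d hd
  · rw [List.pairwise_append, List.pairwise_append, List.pairwise_replicate]
    refine ⟨⟨h3.1, .inr (hm1 _), fun c hc d hd => ?_⟩, h3.2.1, fun c hc d hd => ?_⟩
    · rw [List.eq_of_mem_replicate hd]; exact hm1 c
    · rcases List.mem_append.1 hc with hc | hc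
      · exact h3.2.2 c hc d hd
      · rw [List.eq_of_mem_replicate hc]; exact hm2 d

/-- The candidates are the top entry of the last column of `L` and the bar of the bottom entry of
the first column of `R`. The one of larger height fits next to both neighbours. -/
theorem exists_insertable {n : ℕ} {L R : Tableau} (h : IsLegal n (L ++ R))
    (hL : ∀ c ∈ L, colHeight n c < 2 * n) (hR : ∀ c ∈ R, 2 * n < colHeight n c)
    (hne : L ++ R ≠ []) :
    ∃ a, IsCol n (a, -a) ∧ Touches L R a ∧ (∀ c ∈ L, ColLE n c (a, -a)) ∧
      ∀ c ∈ R, ColLE n (a, -a) c := by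
  have hp := h.colLE
  rw [List.pairwise_append] at hp
  obtain ⟨hp1, hp2, hp3⟩ := hp
  have hlast : ∀ L₀ x, L = L₀ ++ [x] → ∀ c ∈ L, ColLE n c x := by
    rintro L₀ x rfl c hc
    rw [List.pairwise_append] at hp1
    rcases List.mem_append.1 hc with hc | hc
    · exact hp1.2.2 c hc x (by simp)
    · rw [List.mem_singleton.1 hc]; exact .refl _ _
  have hhead : ∀ x R₀, R = x :: R₀ → ∀ c ∈ R, ColLE n x c := by
    rintro x R₀ rfl c hc
    rw [List.pairwise_cons] at hp2
    rcases List.mem_cons.1 hc with hc | hc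
    · rw [hc]; exact .refl _ _
    · exact hp2.1 c hc
  have hcol : ∀ a, IsLetter n a → height n a < n → IsCol n (a, -a) := fun a h1 h2 =>
    ⟨⟨h1, h1.neg⟩, fun h3 => by have := h3.height_le; simp only [height_neg h1] at this; omega⟩
  rcases List.eq_nil_or_concat' L with hL' | ⟨L₀, x, hL'⟩
  · rcases R with _ | ⟨y, R₀⟩
    · simp [hL'] at hne
    · have hy := (h.isCol (c := y) (by simp))
      have hy' := hR y (by simp)
      have h1 := hy.height_le
      have h2 := height_neg hy.1.2
      unfold colHeight at hy'
      refine ⟨-y.2, hcol _ hy.1.2.neg (by omega), .inr ⟨y, by simp, by simp⟩, by simp [hL'],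
        fun c hc => ColLE.trans ?_ (hhead y R₀ rfl c hc)⟩
      exact ⟨.inr (by simp only; omega), by simpa using .refl n y.2⟩
  · have hxL : x ∈ L := by simp [hL']
    have hx := (h.isCol (c := x) (by simp [hL']))
    have hx' := hL x hxL
    have h1 := hx.height_le
    have h2 := height_neg hx.1.1
    unfold colHeight at hx'
    have hleft : ∀ c ∈ L, ColLE n c (x.1, -x.1) := fun c hc =>
      ColLE.trans (hlast L₀ x hL' c hc) ⟨.refl _ _, .inr (by simp only; omega)⟩
    have htl : Touches L R x.1 := .inl ⟨x, by simp [hL'], rfl⟩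
    rcases R with _ | ⟨y, R₀⟩
    · exact ⟨x.1, hcol _ hx.1.1 (by omega), htl, hleft, by simp⟩
    · have hy := (h.isCol (c := y) (by simp))
      have hy' := hR y (by simp)
      have h3 := hy.height_le
      have h4 := height_neg hy.1.2
      have hxy := hp3 x hxL y (by simp)
      unfold colHeight at hy'
      by_cases hc : height n (-y.2) ≤ height n x.1
      · refine ⟨x.1, hcol _ hx.1.1 (by omega), htl, hleft, fun c hc' =>
          ColLE.trans ⟨hxy.1, ?_⟩ (hhead y R₀ rfl c hc')⟩
        rcases hc.eq_or_lt with he | hlt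
        · rw [← eq_of_height_eq hy.1.2.neg hx.1.1 he (by omega)]
          simpa using .refl n y.2
        · exact .inr (by simp only; omega)
      · refine ⟨-y.2, hcol _ hy.1.2.neg (by omega), .inr ⟨y, by simp, by simp⟩,
          fun c hc' => ColLE.trans (hlast L₀ x hL' c hc') ⟨.inr (by simp only; omega), ?_⟩,
          fun c hc' => ColLE.trans ⟨.inr (by simp only; omega), ?_⟩ (hhead y R₀ rfl c hc')⟩
        · simpa using hxy.2
        · simpa using .refl n y.2

theorem exists_drop_eq {n s : ℕ} (hn : 2 ≤ n) {t : Tableau} (ht : IsKN n t.length t)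
    (hs : t.length ≤ s) : ∃ T : Btilde n s, drop T = t := by
  classical
  have hone : IsCol n (1, -1) := isCol_diag_iff.2 (.inl (by omega))
  rcases hs.eq_or_lt with rfl | hs
  · refine ⟨⟨t, rfl, ht.legal⟩, ?_⟩
    by_cases h : t = List.replicate t.length (1, -1)
    · rw [drop_replicate h]
      cases t with
      | nil => rfl
      | cons c t =>
        refine absurd ?_ ht.no_one
        rw [h]; simp
    · rw [drop, if_neg h, if_pos ht]
  by_cases hnil : t = []
  · subst hnil
    have hl := IsLegal.insert (m := s) (L := []) (R := []) ht.legal hone (by simp) (by simp)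
    simp only [List.nil_append, List.append_nil] at hl
    exact ⟨⟨_, by simp, hl⟩, drop_replicate rfl⟩
  obtain ⟨L, r, a, R, h⟩ := ht.legal.exists_hasParts
  rcases ht.hasParts h with rfl | ⟨rfl, htouch, ha⟩
  · have hLR : t = L ++ R := by simpa using h.eq
    obtain ⟨b, hb, hbt, hbL, hbR⟩ := exists_insertable (hLR ▸ ht.legal) h.left h.right
      (hLR ▸ hnil)
    have hl := IsLegal.insert (m := s - t.length) (hLR ▸ ht.legal) hb hbL hbR
    have hp : HasParts n (L ++ List.replicate (s - t.length) (b, -b) ++ R) L (s - t.length) b R :=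
      ⟨rfl, h.left, fun _ => hb.colHeight_diag, h.right⟩
    have hlen : (L ++ List.replicate (s - t.length) (b, -b) ++ R).length = s := by
      have := congrArg List.length hLR
      simp at this ⊢
      omega
    refine ⟨⟨_, hlen, hl⟩, ?_⟩
    rw [drop_eq (T := ⟨_, hlen, hl⟩) hp, if_pos hbt, hLR]
    · simp
    · intro he
      have hall : ∀ c ∈ t, colHeight n c = 2 * n := fun c hc => by
        have hm : c ∈ List.replicate s ((1 : ℤ), (-1 : ℤ)) := by
          rw [← he]; rw [hLR] at hc; simp at hc ⊢; tauto
        rw [List.eq_of_mem_replicate hm]; exact hone.colHeight_diag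
      obtain ⟨c, hc⟩ := List.exists_mem_of_ne_nil t hnil
      have h1 := hall c hc
      rw [hLR] at hc
      rcases List.mem_append.1 hc with hc | hc
      · have := h.left c hc; omega
      · have := h.right c hc; omega
  · have hcol := h.isCol ht.legal one_ne_zero
    have hp := ht.legal.colLE
    rw [h.eq, List.pairwise_append, List.pairwise_append] at hp
    have hLR : IsLegal n (L ++ R) := ht.legal.sublist (by rw [h.eq]; simp)
    -- The additional one accounts for the column `(a, ā)` already present in `t` but not in `L ++
    -- R`.
    have hl := IsLegal.insert (m := s - t.length + 1) hLR hcol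
      (fun c hc => hp.1.2.2 c hc _ (by simp)) (fun c hc => hp.2.2 _ (by simp) c hc)
    have hp : HasParts n (L ++ List.replicate (s - t.length + 1) (a, -a) ++ R) L
        (s - t.length + 1) a R := ⟨rfl, h.left, fun _ => hcol.colHeight_diag, h.right⟩
    have hlen : (L ++ List.replicate (s - t.length + 1) (a, -a) ++ R).length = s := by
      have := congrArg List.length h.eq
      simp at this ⊢
      omega
    refine ⟨⟨_, hlen, hl⟩, ?_⟩
    rw [drop_eq (T := ⟨_, hlen, hl⟩) hp, if_neg htouch, min_eq_right (by omega), ← h.eq]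
    intro he
    have hm : (a, -a) ∈ List.replicate s ((1 : ℤ), (-1 : ℤ)) := by rw [← he]; simp
    exact ha (congrArg Prod.fst (List.eq_of_mem_replicate hm))

theorem fill_eq_some_iff {n s : ℕ} {t : Tableau} {T : Btilde n s} :
    fill n s t = some T ↔ drop T = t := by
  unfold fill
  split_ifs with h
  · have := h.choose_spec
    constructor
    · intro h1
      rw [Option.some.injEq] at h1
      rwa [h1] at this
    · intro h1
      rw [Option.some.injEq]
      exact drop_injective (this.trans h1.symm)
  · simp only [false_iff]
    exact fun h1 => h ⟨T, h1⟩

/-! ### Stability of Kashiwara--Nakashima tableaux under the Kashiwara operators -/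

/-- The columns that occur in Kashiwara--Nakashima tableaux. -/
def IsKNCol (n : ℕ) (c : ℤ × ℤ) : Prop := IsCol n c ∧ c ≠ (1, -1)

/-- The condition on two consecutive columns of a Kashiwara--Nakashima tableau. -/
def Adj (n : ℕ) (c d : ℤ × ℤ) : Prop := ColLE n c d ∧ Separated c d ∧ MiddleFree n c d

section Iff

variable {n i : ℕ} {a b x : ℤ}

theorem isLetter_iff : IsLetter n a ↔ (1 ≤ a ∧ a ≤ n) ∨ (-(n : ℤ) ≤ a ∧ a ≤ -1) := by
  unfold IsLetter; grind

theorem letterLE_iff : LetterLE n a b ↔ a = b ∨ (0 < a ∧ 0 < b ∧ a < b) ∨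
    (0 < a ∧ b ≤ 0 ∧ a < 2 * n + b) ∨ (a ≤ 0 ∧ b ≤ 0 ∧ a < b) ∨ (a ≤ 0 ∧ 0 < b ∧ 2 * n + a < b) := by
  unfold LetterLE height; grind

theorem isKNCol_iff : IsKNCol n (a, b) ↔ ((1 ≤ a ∧ a ≤ n) ∨ (-(n : ℤ) ≤ a ∧ a ≤ -1)) ∧
    ((1 ≤ b ∧ b ≤ n) ∨ (-(n : ℤ) ≤ b ∧ b ≤ -1)) ∧ ¬ LetterLE n b a ∧ ¬ (a = 1 ∧ b = -1) := by
  unfold IsKNCol IsCol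
  simp only [isLetter_iff, ne_eq, Prod.mk.injEq]
  tauto

theorem adj_iff {c d : ℤ} : Adj n (a, b) (c, d) ↔ (LetterLE n a c ∧ LetterLE n b d) ∧
    (¬ (c = a ∧ d = -a) ∧ ¬ (b = -a ∧ d = -a)) ∧
    ¬ (a = n - 1 ∧ b = n ∧ c = n ∧ d = -(n - 1)) ∧
    ¬ (a = n - 1 ∧ b = -n ∧ c = -n ∧ d = -(n - 1)) := by
  unfold Adj ColLE Separated MiddleFree
  simp only [Prod.mk.injEq]
  tauto

theorem arrow_cases (hi : 1 ≤ i ∧ i ≤ n) :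
    (1 ≤ arrowSource n i ∧ arrowSource n i ≤ n - 1 ∧ arrowTarget n i = arrowSource n i + 1) ∨
      (arrowSource n i = n - 1 ∧ arrowTarget n i = -n) := by
  unfold arrowSource arrowTarget; split_ifs <;> omega

theorem letterE_cases (hi : 1 ≤ i ∧ i ≤ n) (h : letterE n i b = some x) :
    (b = arrowTarget n i ∧ x = arrowSource n i) ∨
      (b = -arrowSource n i ∧ x = -arrowTarget n i) := by
  rw [letterE_eq hi.1 hi.2] at h; grind

theorem letterF_eq_none_iff (hi : 1 ≤ i ∧ i ≤ n) :
    letterF n i a = none ↔ a ≠ arrowSource n i ∧ a ≠ -arrowTarget n i := by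
  rw [letterF_eq hi.1 hi.2]; grind

theorem letterE_eq_none_iff (hi : 1 ≤ i ∧ i ≤ n) :
    letterE n i a = none ↔ a ≠ arrowTarget n i ∧ a ≠ -arrowSource n i := by
  rw [letterE_eq hi.1 hi.2]; grind

/-- Between `(n-1, n)` and `(n, (n-1)‾)` the only other column allowed by the rows is `(n-1,
(n-1)‾)`, which may not follow `(n-1, n)`; the same holds with `n̄`. So the condition on all pairs
follows from that on neighbours. -/
theorem middleFree_of_adj {c d e : ℤ × ℤ} (hd : IsKNCol n d) (he : IsKNCol n e)
    (h : Adj n c d) (h' : ColLE n d e) (h'' : MiddleFree n d e) : MiddleFree n c e := by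
  obtain ⟨d1, d2⟩ := d
  unfold ColLE at h'
  unfold MiddleFree at h'' ⊢
  constructor
  · rintro ⟨rfl, rfl⟩
    simp only [isKNCol_iff, adj_iff, letterLE_iff, Prod.mk.injEq] at *
    grind
  · rintro ⟨rfl, rfl⟩
    simp only [isKNCol_iff, adj_iff, letterLE_iff, Prod.mk.injEq] at *
    grind

end Iff

theorem colLE_of_isChain_adj {n : ℕ} {T : Tableau} (h : T.IsChain (Adj n)) :
    T.Pairwise (ColLE n) :=
  List.isChain_iff_pairwise.1 (h.imp fun _ _ h => h.1)

theorem middleFree_of_isChain_adj {n : ℕ} : ∀ {T : Tableau}, (∀ c ∈ T, IsKNCol n c) →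
    T.IsChain (Adj n) → T.Pairwise (MiddleFree n)
  | [], _, _ => .nil
  | [c], _, _ => by simp
  | c :: d :: T, hc, h => by
    have ih := middleFree_of_isChain_adj (T := d :: T) (fun e he => hc e (by simp [he])) h.tail
    refine List.pairwise_cons.2 ⟨fun e he => ?_, ih⟩
    rw [List.isChain_cons_cons] at h
    rcases List.mem_cons.1 he with rfl | he
    · exact h.1.2.2
    · exact middleFree_of_adj (hc d (by simp)) (hc e (by simp [he])) h.1
        ((List.pairwise_cons.1 (colLE_of_isChain_adj h.2)).1 e he)
        ((List.pairwise_cons.1 ih).1 e he)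

theorem isKN_iff {n k : ℕ} {T : Tableau} :
    IsKN n k T ↔ T.length = k ∧ (∀ c ∈ T, IsKNCol n c) ∧ T.IsChain (Adj n) := by
  constructor
  · rintro ⟨h1, h2, h3, h4⟩
    refine ⟨h1, fun c hc => ⟨h2.isCol hc, fun h => h4 (h ▸ hc)⟩, ?_⟩
    have h5 := isLegal_iff.1 h2
    have h6 : T.IsChain Separated := h3
    clear h1 h2 h3 h4
    induction T with
    | nil => simp
    | cons c T ih =>
      cases T with
      | nil => simp
      | cons d T =>
        rw [List.isChain_cons_cons] at h6 ⊢
        simp only [List.pairwise_cons] at h5 ih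
        refine ⟨⟨h5.2.1.1 d (by simp), h6.1, h5.2.2.1 d (by simp)⟩, ih ⟨fun e he =>
          h5.1 e (by simp [he]), h5.2.1.2, h5.2.2.2⟩ h6.2⟩
  · rintro ⟨h1, h2, h3⟩
    exact ⟨h1, isLegal_iff.2 ⟨fun c hc => (h2 c hc).1, colLE_of_isChain_adj h3,
      middleFree_of_isChain_adj h2 h3⟩, h3.imp fun _ _ h => h.2.1, fun h => (h2 _ h).2 rfl⟩

section Local

variable {n i : ℕ} {l d : ℤ × ℤ} {a b x : ℤ}

theorem IsKNCol.raise_bottom (hn : 3 ≤ n) (hi : 1 ≤ i ∧ i ≤ n) (h : IsKNCol n (a, b))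
    (hx : letterE n i b = some x) (ha : letterF n i a = none) : IsKNCol n (a, x) := by
  have h0 := arrow_cases hi
  rw [letterF_eq_none_iff hi] at ha
  have h1 := letterE_cases hi hx
  simp only [isKNCol_iff, letterLE_iff] at *
  generalize arrowSource n i = p at *
  generalize arrowTarget n i = q at *
  rcases h0 with ⟨h0, h0', rfl⟩ | ⟨rfl, rfl⟩ <;> rcases h1 with ⟨rfl, rfl⟩ | ⟨rfl, rfl⟩ <;> grind

theorem IsKNCol.raise_top (hn : 3 ≤ n) (hi : 1 ≤ i ∧ i ≤ n) (h : IsKNCol n (a, b))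
    (hx : letterE n i a = some x) (hb : letterE n i b = none) : IsKNCol n (x, b) := by
  have h0 := arrow_cases hi
  rw [letterE_eq_none_iff hi] at hb
  have h1 := letterE_cases hi hx
  simp only [isKNCol_iff, letterLE_iff] at *
  generalize arrowSource n i = p at *
  generalize arrowTarget n i = q at *
  rcases h0 with ⟨h0, h0', rfl⟩ | ⟨rfl, rfl⟩ <;> rcases h1 with ⟨rfl, rfl⟩ | ⟨rfl, rfl⟩ <;> grind

theorem Adj.raise_bottom_left (hn : 3 ≤ n) (hi : 1 ≤ i ∧ i ≤ n) (hc : IsKNCol n (a, b))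
    (hd : IsKNCol n d) (h : Adj n (a, b) d)
    (hx : letterE n i b = some x) (ha : letterF n i a = none) : Adj n (a, x) d := by
  obtain ⟨c, d⟩ := d
  have h0 := arrow_cases hi
  rw [letterF_eq_none_iff hi] at ha
  have h1 := letterE_cases hi hx
  simp only [isKNCol_iff, adj_iff, letterLE_iff] at *
  generalize arrowSource n i = p at *
  generalize arrowTarget n i = q at *
  rcases h0 with ⟨h0, h0', rfl⟩ | ⟨rfl, rfl⟩ <;> rcases h1 with ⟨rfl, rfl⟩ | ⟨rfl, rfl⟩ <;> grind

theorem Adj.raise_top_left (hn : 3 ≤ n) (hi : 1 ≤ i ∧ i ≤ n) (hc : IsKNCol n (a, b))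
    (hd : IsKNCol n d) (h : Adj n (a, b) d)
    (hx : letterE n i a = some x) (hb : letterE n i b = none) : Adj n (x, b) d := by
  obtain ⟨c, d⟩ := d
  have h0 := arrow_cases hi
  rw [letterE_eq_none_iff hi] at hb
  have h1 := letterE_cases hi hx
  simp only [isKNCol_iff, adj_iff, letterLE_iff] at *
  generalize arrowSource n i = p at *
  generalize arrowTarget n i = q at *
  rcases h0 with ⟨h0, h0', rfl⟩ | ⟨rfl, rfl⟩ <;> rcases h1 with ⟨rfl, rfl⟩ | ⟨rfl, rfl⟩ <;> grind

/-- The conditions on `l` come from the signature rule, which here acts to the right of `l`. Without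
them the new bottom entry could be smaller than that of `l`. -/
theorem Adj.raise_bottom_right (hn : 3 ≤ n) (hi : 1 ≤ i ∧ i ≤ n) (hc : IsKNCol n (a, b))
    (hl : IsKNCol n l) (h : Adj n l (a, b)) (hx : letterE n i b = some x)
    (ha : letterF n i a = none) (hl1 : letterE n i l.1 = none)
    (hl2 : letterE n i l.2 = none ∨ letterF n i l.1 ≠ none) : Adj n l (a, x) := by
  obtain ⟨c, d⟩ := l
  have h0 := arrow_cases hi
  rw [letterF_eq_none_iff hi] at ha
  rw [ne_eq, letterE_eq_none_iff hi, letterF_eq_none_iff hi] at hl2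
  rw [letterE_eq_none_iff hi] at hl1
  have h1 := letterE_cases hi hx
  simp only [isKNCol_iff, adj_iff, letterLE_iff] at *
  generalize arrowSource n i = p at *
  generalize arrowTarget n i = q at *
  rcases h0 with ⟨h0, h0', rfl⟩ | ⟨rfl, rfl⟩ <;> rcases h1 with ⟨rfl, rfl⟩ | ⟨rfl, rfl⟩ <;> grind (splits := 40)

theorem Adj.raise_top_right (hn : 3 ≤ n) (hi : 1 ≤ i ∧ i ≤ n) (hc : IsKNCol n (a, b))
    (hl : IsKNCol n l) (h : Adj n l (a, b)) (hx : letterE n i a = some x)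
    (hb : letterE n i b = none) (hl1 : letterE n i l.1 = none ∨ letterF n i b ≠ none) :
    Adj n l (x, b) := by
  obtain ⟨c, d⟩ := l
  have h0 := arrow_cases hi
  rw [ne_eq, letterE_eq_none_iff hi, letterF_eq_none_iff hi] at hl1
  rw [letterE_eq_none_iff hi] at hb
  have h1 := letterE_cases hi hx
  simp only [isKNCol_iff, adj_iff, letterLE_iff] at *
  generalize arrowSource n i = p at *
  generalize arrowTarget n i = q at *
  rcases h0 with ⟨h0, h0', rfl⟩ | ⟨rfl, rfl⟩ <;> rcases h1 with ⟨rfl, rfl⟩ | ⟨rfl, rfl⟩ <;> grind (splits := 40)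

end Local

/-! ### Column words of tableaux and the signature rule column by column. -/

theorem colWord_injective : Function.Injective colWord := by
  intro T
  induction T with
  | nil => intro T' h; cases T' <;> simp [colWord] at h ⊢
  | cons c T ih =>
    intro T' h
    cases T' with
    | nil => simp [colWord] at h
    | cons c' T' =>
      simp only [colWord, List.cons.injEq] at h
      rw [ih h.2.2, Prod.ext h.2.1 h.1]

theorem ofColWord_colWord (T : Tableau) : ofColWord (colWord T) = T := by
  induction T with
  | nil => rfl
  | cons c T ih => simp [colWord, ofColWord, ih]

theorem colWord_append (T T' : Tableau) : colWord (T ++ T') = colWord T ++ colWord T' := by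
  induction T with
  | nil => rfl
  | cons c T ih => simp [colWord, ih]

theorem length_colWord (T : Tableau) : (colWord T).length = 2 * T.length := by
  induction T with
  | nil => rfl
  | cons c T ih => simp [colWord, ih]; ring

/-- Induction on the columns. The final clause carries the information across the boundary between
columns: a column `l` in front remains compatible with the new first column, provided the rule makes
`ẽ_i` act to the right of `l`. -/
theorem wordE_colWord {n i : ℕ} (hn : 3 ≤ n) (hi : 1 ≤ i ∧ i ≤ n) : ∀ {T : Tableau} {w : List ℤ},
    (∀ c ∈ T, IsKNCol n c) → T.IsChain (Adj n) → wordE n i (colWord T) = some w →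
    ∃ T' : Tableau, w = colWord T' ∧ T'.length = T.length ∧ (∀ c ∈ T', IsKNCol n c) ∧
      T'.IsChain (Adj n) ∧ ∀ l, IsKNCol n l → (∀ c ∈ T.head?, Adj n l c) →
        letterEps n i l.1 ≤ wordPhi n i (colWord T) →
        letterEps n i l.2 ≤ wordPhi n i (l.1 :: colWord T) → ∀ c ∈ T'.head?, Adj n l c
  | [], w, _, _, h => by simp [colWord, wordE] at h
  | (a, b) :: T, w, hT, hc, h => by
    have hab := hT (a, b) (by simp)
    have hT' : ∀ c ∈ T, IsKNCol n c := fun c hc => hT c (by simp [hc])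
    rw [List.isChain_cons] at hc
    simp only [colWord, wordE] at h
    split_ifs at h with h1 h2
    · obtain ⟨x, hx, rfl⟩ := Option.map_eq_some_iff.1 h
      have hE : letterEps n i b = 1 := letterEps_eq_one_iff.2 ⟨x, hx⟩
      have hF := letterPhi_add_letterEps_le n i (by omega) b
      rw [wordPhi] at h1
      have ha : letterF n i a = none := letterPhi_eq_zero_iff.1 (by omega)
      refine ⟨(a, x) :: T, rfl, rfl, ?_, ?_, ?_⟩
      · rintro c (_ | ⟨_, hc⟩)
        · exact hab.raise_bottom hn hi hx ha
        · exact hT' c hc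
      · rw [List.isChain_cons]
        exact ⟨fun d hd => (hc.1 d hd).raise_bottom_left hn hi hab
          (hT' d (List.mem_of_head? hd)) hx ha, hc.2⟩
      · intro l hl hadj h3 h4 c hc'
        simp only [List.head?_cons, Option.mem_def, Option.some.injEq] at hc' hadj
        subst hc'
        simp only [colWord, wordPhi] at h3 h4
        refine (hadj _ rfl).raise_bottom_right hn hi hab hl hx ha
          (letterEps_eq_zero_iff.1 (by omega)) ?_
        by_cases h5 : letterE n i l.2 = none
        · exact .inl h5
        · refine .inr fun h6 => h5 (letterEps_eq_zero_iff.1 ?_)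
          rw [letterPhi_eq_zero_iff.2 h6] at h4
          omega
    · simp only [Option.map_map, Option.map_eq_some_iff] at h
      obtain ⟨x, hx, rfl⟩ := h
      have hE : letterEps n i a = 1 := letterEps_eq_one_iff.2 ⟨x, hx⟩
      have hF := letterPhi_add_letterEps_le n i (by omega) a
      rw [wordPhi] at h1
      have hb : letterE n i b = none := letterEps_eq_zero_iff.1 (by omega)
      refine ⟨(x, b) :: T, rfl, rfl, ?_, ?_, ?_⟩
      · rintro c (_ | ⟨_, hc⟩)
        · exact hab.raise_top hn hi hx hb
        · exact hT' c hc
      · rw [List.isChain_cons]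
        exact ⟨fun d hd => (hc.1 d hd).raise_top_left hn hi hab
          (hT' d (List.mem_of_head? hd)) hx hb, hc.2⟩
      · intro l hl hadj h3 h4 c hc'
        simp only [List.head?_cons, Option.mem_def, Option.some.injEq] at hc' hadj
        subst hc'
        simp only [colWord, wordPhi] at h3 h4
        refine (hadj _ rfl).raise_top_right hn hi hab hl hx hb ?_
        by_cases h5 : letterF n i b = none
        · refine .inl (letterEps_eq_zero_iff.1 ?_)
          rw [letterPhi_eq_zero_iff.2 h5] at h3
          omega
        · exact .inr h5
    · simp only [Option.map_map, Option.map_eq_some_iff] at h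
      obtain ⟨v, hv, rfl⟩ := h
      obtain ⟨T', rfl, hlen, h3, h4, h5⟩ := wordE_colWord hn hi hT' hc.2 hv
      refine ⟨(a, b) :: T', rfl, by simp [hlen], ?_, ?_, ?_⟩
      · rintro c (_ | ⟨_, hc⟩)
        · exact hab
        · exact h3 c hc
      · rw [List.isChain_cons]
        exact ⟨h5 (a, b) hab hc.1 (not_lt.1 h2) (not_lt.1 h1), h4⟩
      · intro l hl hadj _ _ c hc'
        simp only [List.head?_cons, Option.mem_def, Option.some.injEq] at hc' hadj
        subst hc'
        exact hadj _ rfl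

/-- The Lusztig dual of a tableau. -/
def dualTableau (T : Tableau) : Tableau := (T.map fun c => (-c.2, -c.1)).reverse

theorem colWord_dualTableau (T : Tableau) : colWord (dualTableau T) = dualWord (colWord T) := by
  induction T with
  | nil => rfl
  | cons c T ih =>
    have : dualTableau (c :: T) = dualTableau T ++ [(-c.2, -c.1)] := by simp [dualTableau]
    simp [this, colWord_append, ih, colWord, dualWord_cons]

theorem LetterLE.neg {n : ℕ} {a b : ℤ} (ha : IsLetter n a) (hb : IsLetter n b) :
    LetterLE n (-b) (-a) ↔ LetterLE n a b := by
  rw [isLetter_iff] at ha hb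
  rw [letterLE_iff, letterLE_iff]
  omega

theorem IsKNCol.dual {n : ℕ} {c : ℤ × ℤ} (h : IsKNCol n c) : IsKNCol n (-c.2, -c.1) := by
  obtain ⟨a, b⟩ := c
  rw [isKNCol_iff, ← isLetter_iff, ← isLetter_iff] at h
  rw [isKNCol_iff, ← isLetter_iff, ← isLetter_iff, LetterLE.neg h.2.1 h.1]
  exact ⟨h.2.1.neg, h.1.neg, h.2.2.1, by omega⟩

theorem Adj.dual {n : ℕ} {c d : ℤ × ℤ} (hc : IsKNCol n c) (hd : IsKNCol n d) (h : Adj n c d) :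
    Adj n (-d.2, -d.1) (-c.2, -c.1) := by
  obtain ⟨a, b⟩ := c
  obtain ⟨a', b'⟩ := d
  rw [isKNCol_iff, ← isLetter_iff, ← isLetter_iff] at hc hd
  rw [adj_iff] at h ⊢
  rw [LetterLE.neg hc.1 hd.1, LetterLE.neg hc.2.1 hd.2.1]
  refine ⟨h.1.symm, ?_, ?_, ?_⟩
  · have := h.2.1; simp only; omega
  · have := h.2.2.2; simp only; omega
  · have := h.2.2.1; simp only; omega

theorem IsKN.dual {n k : ℕ} {T : Tableau} (h : IsKN n k T) : IsKN n k (dualTableau T) := by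
  rw [isKN_iff] at *
  obtain ⟨h1, h2, h3⟩ := h
  refine ⟨by simpa [dualTableau] using h1, ?_, ?_⟩
  · intro c hc
    simp only [dualTableau, List.mem_reverse, List.mem_map] at hc
    obtain ⟨d, hd, rfl⟩ := hc
    exact (h2 d hd).dual
  · rw [dualTableau, List.isChain_reverse, List.isChain_map]
    clear h1
    induction T with
    | nil => simp
    | cons c T ih =>
      rw [List.isChain_cons] at h3 ⊢
      exact ⟨fun d hd => (h3.1 d hd).dual (h2 c (by simp))
        (h2 d (by simp [List.mem_of_head? hd])), ih (fun d hd => h2 d (by simp [hd])) h3.2⟩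

theorem IsKN.wordE {n k i : ℕ} (hn : 3 ≤ n) (hi : 1 ≤ i ∧ i ≤ n) {T : Tableau} (h : IsKN n k T)
    {w : List ℤ} (hw : wordE n i (colWord T) = some w) : ∃ T', IsKN n k T' ∧ w = colWord T' := by
  rw [isKN_iff] at h
  obtain ⟨T', h1, h2, h3, h4, -⟩ := wordE_colWord hn hi h.2.1 h.2.2 hw
  exact ⟨T', isKN_iff.2 ⟨h2.trans h.1, h3, h4⟩, h1⟩

/-- Duality turns lowering into raising, so the case analysis for `ẽ_i` suffices. -/
theorem IsKN.wordF {n k i : ℕ} (hn : 3 ≤ n) (hi : 1 ≤ i ∧ i ≤ n) {T : Tableau} (h : IsKN n k T)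
    {w : List ℤ} (hw : wordF n i (colWord T) = some w) : ∃ T', IsKN n k T' ∧ w = colWord T' := by
  have h1 := wordE_dualWord n i (colWord T)
  rw [hw, ← colWord_dualTableau] at h1
  obtain ⟨T', h2, h3⟩ := h.dual.wordE hn hi h1
  refine ⟨dualTableau T', h2.dual, ?_⟩
  rw [colWord_dualTableau, ← h3, dualWord_dualWord]

/-! ### The classical operators on `𝒯(s)` in terms of words -/

/-- The word of `T`, i.e. the column word of the element of `⨁_k B(kϖ₂)` that belongs to `T`. -/
noncomputable def word {n s : ℕ} (T : Btilde n s) : List ℤ := colWord (drop T)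

theorem word_injective {n s : ℕ} : Function.Injective (word : Btilde n s → List ℤ) :=
  fun _ _ h => drop_injective (colWord_injective h)

theorem length_word {n s : ℕ} (T : Btilde n s) : (word T).length = 2 * compIndex T :=
  length_colWord _

theorem compIndex_le {n s : ℕ} (T : Btilde n s) : compIndex T ≤ s := (exists_isKN_drop T).2

theorem isKN_drop {n s : ℕ} (T : Btilde n s) : IsKN n (compIndex T) (drop T) :=
  (exists_isKN_drop T).1

theorem exists_word_eq {n s k : ℕ} (hn : 2 ≤ n) {t : Tableau} (ht : IsKN n k t) (hk : k ≤ s) :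
    ∃ T : Btilde n s, word T = colWord t ∧ drop T = t ∧ compIndex T = k := by
  obtain rfl := ht.length_eq
  obtain ⟨T, hT⟩ := exists_drop_eq hn ht hk
  exact ⟨T, by rw [word, hT], hT, by rw [compIndex, hT]⟩

/-- Since Kashiwara–Nakashima tableaux are stable, the raised word is again a column word, so
`ofColWord` loses nothing. -/
theorem classE_eq_some_iff {n s i : ℕ} (hn : 3 ≤ n) (hi : 1 ≤ i ∧ i ≤ n) {T T' : Btilde n s} :
    classE i T = some T' ↔ wordE n i (word T) = some (word T') := by
  unfold classE knE
  rw [Option.bind_eq_some_iff]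
  constructor
  · rintro ⟨t, h1, h2⟩
    obtain ⟨w, hw, rfl⟩ := Option.map_eq_some_iff.1 h1
    obtain ⟨t', -, rfl⟩ := (isKN_drop T).wordE hn hi hw
    rw [fill_eq_some_iff, ofColWord_colWord] at h2
    rw [word, hw, word, h2]
  · intro h
    exact ⟨drop T', Option.map_eq_some_iff.2 ⟨_, h, ofColWord_colWord _⟩, fill_eq_some_iff.2 rfl⟩

theorem classF_eq_some_iff {n s i : ℕ} (hn : 3 ≤ n) (hi : 1 ≤ i ∧ i ≤ n) {T T' : Btilde n s} :
    classF i T = some T' ↔ wordF n i (word T) = some (word T') := by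
  unfold classF knF
  rw [Option.bind_eq_some_iff]
  constructor
  · rintro ⟨t, h1, h2⟩
    obtain ⟨w, hw, rfl⟩ := Option.map_eq_some_iff.1 h1
    obtain ⟨t', -, rfl⟩ := (isKN_drop T).wordF hn hi hw
    rw [fill_eq_some_iff, ofColWord_colWord] at h2
    rw [word, hw, word, h2]
  · intro h
    exact ⟨drop T', Option.map_eq_some_iff.2 ⟨_, h, ofColWord_colWord _⟩, fill_eq_some_iff.2 rfl⟩

theorem exists_word_of_wordE {n s i : ℕ} (hn : 3 ≤ n) (hi : 1 ≤ i ∧ i ≤ n) {T : Btilde n s}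
    {w : List ℤ} (h : wordE n i (word T) = some w) : ∃ T' : Btilde n s, word T' = w := by
  obtain ⟨t, ht, rfl⟩ := (isKN_drop T).wordE hn hi h
  obtain ⟨T', h1, -⟩ := exists_word_eq (s := s) (by omega) ht (compIndex_le T)
  exact ⟨T', h1⟩

theorem exists_word_of_wordF {n s i : ℕ} (hn : 3 ≤ n) (hi : 1 ≤ i ∧ i ≤ n) {T : Btilde n s}
    {w : List ℤ} (h : wordF n i (word T) = some w) : ∃ T' : Btilde n s, word T' = w := by
  obtain ⟨t, ht, rfl⟩ := (isKN_drop T).wordF hn hi h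
  obtain ⟨T', h1, -⟩ := exists_word_eq (s := s) (by omega) ht (compIndex_le T)
  exact ⟨T', h1⟩

theorem classE_eq_none_iff {n s i : ℕ} (hn : 3 ≤ n) (hi : 1 ≤ i ∧ i ≤ n) {T : Btilde n s} :
    classE i T = none ↔ wordE n i (word T) = none := by
  rw [Option.eq_none_iff_forall_ne_some, Option.eq_none_iff_forall_ne_some]
  constructor
  · intro h w hw
    obtain ⟨T', rfl⟩ := exists_word_of_wordE hn hi hw
    exact h T' ((classE_eq_some_iff hn hi).2 hw)
  · exact fun h T' hT' => h _ ((classE_eq_some_iff hn hi).1 hT')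

theorem classF_eq_none_iff {n s i : ℕ} (hn : 3 ≤ n) (hi : 1 ≤ i ∧ i ≤ n) {T : Btilde n s} :
    classF i T = none ↔ wordF n i (word T) = none := by
  rw [Option.eq_none_iff_forall_ne_some, Option.eq_none_iff_forall_ne_some]
  constructor
  · intro h w hw
    obtain ⟨T', rfl⟩ := exists_word_of_wordF hn hi hw
    exact h T' ((classF_eq_some_iff hn hi).2 hw)
  · exact fun h T' hT' => h _ ((classF_eq_some_iff hn hi).1 hT')

/-! ### Highest weight vectors for the colours `2, …, n` -/

/-- The sizes of the blocks of equal columns in a tableau that is of highest weight for the colours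
`2, …, n`. -/
structure Blocks where
  x₁ : ℕ
  x₂ : ℕ
  x₃ : ℕ
  x₄ : ℕ
  x₅ : ℕ
  x₆ : ℕ

/-- The tableau with given blocks. -/
def Blocks.tableau (x : Blocks) : Tableau :=
  List.replicate x.x₁ (1, 2) ++ (List.replicate x.x₂ (1, 3) ++ (List.replicate x.x₃ (1, -2) ++
    (List.replicate x.x₄ (2, 3) ++ (List.replicate x.x₅ (2, -2) ++ List.replicate x.x₆ (2, -1)))))

/-- The condition for the tableau to be a highest weight Kashiwara--Nakashima tableau. -/
structure Blocks.Valid (x : Blocks) : Prop where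
  le_one : x.x₅ ≤ 1
  eq_zero : x.x₄ = 0 ∨ (x.x₃ = 0 ∧ x.x₅ = 0)
  le : x.x₂ + x.x₃ ≤ x.x₆

theorem colWord_replicate_append (m : ℕ) (c : ℤ × ℤ) (T : Tableau) :
    colWord (List.replicate (m + 1) c ++ T) = c.2 :: c.1 :: colWord (List.replicate m c ++ T) := rfl

section Values

variable {n i : ℕ} {x : ℤ}

theorem letterPhi_eq (hi : 1 ≤ i ∧ i ≤ n) :
    letterPhi n i x = if x = arrowSource n i ∨ x = -arrowTarget n i then 1 else 0 := by
  unfold letterPhi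
  have := letterF_eq_none_iff (a := x) hi
  split_ifs with h1 h2 h2
  · rfl
  · rw [Option.isSome_iff_ne_none, ne_eq, this] at h1; tauto
  · rw [Option.not_isSome_iff_eq_none, this] at h1; tauto
  · rfl

theorem letterEps_eq (hi : 1 ≤ i ∧ i ≤ n) :
    letterEps n i x = if x = arrowTarget n i ∨ x = -arrowSource n i then 1 else 0 := by
  unfold letterEps
  have := letterE_eq_none_iff (a := x) hi
  split_ifs with h1 h2 h2
  · rfl
  · rw [Option.isSome_iff_ne_none, ne_eq, this] at h1; tauto
  · rw [Option.not_isSome_iff_eq_none, this] at h1; tauto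
  · rfl

end Values

/-- The `ε` of the bottom entry is cancelled by the `φ` of the top entry to its right, so these
columns leave `ε` alone and can only add to `φ`. -/
theorem word_replicate_of_eps_le {n i : ℕ} (m : ℕ) (a b : ℤ) (T : Tableau)
    (ha : letterEps n i a = 0) (hb : letterEps n i b ≤ letterPhi n i a) :
    wordPhi n i (colWord (List.replicate m (a, b) ++ T)) =
        wordPhi n i (colWord T) + m * (letterPhi n i a + letterPhi n i b - letterEps n i b) ∧
      wordEps n i (colWord (List.replicate m (a, b) ++ T)) = wordEps n i (colWord T) := by
  induction m with
  | zero => simp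
  | succ m ih =>
    simp only [colWord_replicate_append, wordPhi, wordEps, ih, ha, Nat.add_mul, one_mul]
    omega

/-- These columns only consume `φ` from their right; `ε` does not grow as long as enough of it is
available. -/
theorem word_replicate_of_phi_eq_zero {n i : ℕ} (m : ℕ) (a b : ℤ) (T : Tableau)
    (ha : letterPhi n i a = 0) (hb : letterPhi n i b = 0) :
    wordPhi n i (colWord (List.replicate m (a, b) ++ T)) =
        wordPhi n i (colWord T) - m * (letterEps n i a + letterEps n i b) ∧
      (m * (letterEps n i a + letterEps n i b) ≤ wordPhi n i (colWord T) →
        wordEps n i (colWord (List.replicate m (a, b) ++ T)) = wordEps n i (colWord T)) := by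
  induction m with
  | zero => simp
  | succ m ih =>
    simp only [colWord_replicate_append, wordPhi, wordEps, ih.1, ha, hb, Nat.add_mul, one_mul]
    refine ⟨by omega, fun h => ?_⟩
    rw [ih.2 (by omega)]
    omega

theorem mem_colWord {T : Tableau} {y : ℤ} (h : y ∈ colWord T) : ∃ c ∈ T, y = c.1 ∨ y = c.2 := by
  induction T with
  | nil => simp [colWord] at h
  | cons c T ih =>
    simp only [colWord, List.mem_cons] at h
    rcases h with h | h | h
    · exact ⟨c, by simp, .inr h⟩
    · exact ⟨c, by simp, .inl h⟩
    · obtain ⟨d, hd, h⟩ := ih h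
      exact ⟨d, by simp [hd], h⟩

theorem wordEps_eq_zero_of_forall {n i : ℕ} {w : List ℤ}
    (h : ∀ y ∈ w, letterEps n i y = 0) : wordEps n i w = 0 := by
  induction w with
  | nil => rfl
  | cons y w ih =>
    rw [wordEps, ih fun z hz => h z (by simp [hz]), h y (by simp)]
    simp

namespace Blocks

variable {n : ℕ} (x : Blocks)

theorem word_two (hn : 4 ≤ n) (hx : x.Valid) :
    wordEps n 2 (colWord x.tableau) = 0 ∧
      wordPhi n 2 (colWord x.tableau) = x.x₁ + (x.x₆ - x.x₂ - x.x₃) := by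
  obtain ⟨x₁, x₂, x₃, x₄, x₅, x₆⟩ := x
  obtain ⟨h5, h4, h6⟩ := hx
  simp only [tableau] at *
  have hs : arrowSource n 2 = 2 := by unfold arrowSource; grind
  have ht : arrowTarget n 2 = 3 := by unfold arrowTarget; grind
  have hp := fun x => letterPhi_eq (n := n) (i := 2) (x := x) (by omega)
  have he := fun x => letterEps_eq (n := n) (i := 2) (x := x) (by omega)
  rw [hs, ht] at hp he
  have A6 := word_replicate_of_eps_le (n := n) (i := 2) x₆ 2 (-1) [] (by simp [he]) (by simp [he])
  rw [List.append_nil] at A6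
  have A5 := word_replicate_of_eps_le (n := n) (i := 2) x₅ 2 (-2) (List.replicate x₆ (2, -1))
    (by simp [he]) (by simp [he, hp])
  have A4 := word_replicate_of_eps_le (n := n) (i := 2) x₄ 2 3 (List.replicate x₅ (2, -2) ++
    List.replicate x₆ (2, -1)) (by simp [he]) (by simp [he, hp])
  have A3 := word_replicate_of_phi_eq_zero (n := n) (i := 2) x₃ 1 (-2) (List.replicate x₄ (2, 3) ++
    (List.replicate x₅ (2, -2) ++ List.replicate x₆ (2, -1))) (by simp [hp]) (by simp [hp])
  have A2 := word_replicate_of_phi_eq_zero (n := n) (i := 2) x₂ 1 3 (List.replicate x₃ (1, -2) ++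
    (List.replicate x₄ (2, 3) ++ (List.replicate x₅ (2, -2) ++ List.replicate x₆ (2, -1))))
    (by simp [hp]) (by simp [hp])
  have A1' : ∀ T : Tableau, wordPhi n 2 (colWord (List.replicate x₁ (1, 2) ++ T)) =
        wordPhi n 2 (colWord T) + x₁ ∧
      wordEps n 2 (colWord (List.replicate x₁ (1, 2) ++ T)) = wordEps n 2 (colWord T) := by
    have := word_replicate_of_eps_le (n := n) (i := 2) x₁ 1 2
    simpa [hp, he] using this
  simp only [hp, he, colWord, wordPhi, wordEps] at A6 A5 A4 A3 A2
  norm_num at A6 A5 A4 A3 A2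
  obtain ⟨B1, B1'⟩ := A1' (List.replicate x₂ (1, 3) ++ (List.replicate x₃ (1, -2) ++
    (List.replicate x₄ (2, 3) ++ (List.replicate x₅ (2, -2) ++ List.replicate x₆ (2, -1)))))
  omega

theorem word_one (hn : 4 ≤ n) (hx : x.Valid) :
    wordPhi n 1 (colWord x.tableau) = x.x₂ + 2 * x.x₃ + x.x₅ := by
  obtain ⟨x₁, x₂, x₃, x₄, x₅, x₆⟩ := x
  obtain ⟨h5, h4, h6⟩ := hx
  simp only [tableau] at *
  have hs : arrowSource n 1 = 1 := by unfold arrowSource; grind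
  have ht : arrowTarget n 1 = 2 := by unfold arrowTarget; grind
  have hp := fun x => letterPhi_eq (n := n) (i := 1) (x := x) (by omega)
  have he := fun x => letterEps_eq (n := n) (i := 1) (x := x) (by omega)
  rw [hs, ht] at hp he
  have A6 := (word_replicate_of_phi_eq_zero (n := n) (i := 1) x₆ 2 (-1) [] (by simp [hp])
    (by simp [hp])).1
  rw [List.append_nil] at A6
  -- In a product of several columns `(2, 2̄)` the entry `2` of one cancels the `2̄` of the next, so
  -- this value depends on `x₅ ≤ 1`.
  have A5 : wordPhi n 1 (colWord (List.replicate x₅ (2, -2) ++ List.replicate x₆ (2, -1))) = x₅ := by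
    obtain rfl | rfl : x₅ = 0 ∨ x₅ = 1 := by omega
    · simp [A6, colWord, wordPhi]
    · simp [A6, colWord, wordPhi, hp, he]
  have A4 := (word_replicate_of_phi_eq_zero (n := n) (i := 1) x₄ 2 3 (List.replicate x₅ (2, -2) ++
    List.replicate x₆ (2, -1)) (by simp [hp]) (by simp [hp])).1
  have A3 := (word_replicate_of_eps_le (n := n) (i := 1) x₃ 1 (-2) (List.replicate x₄ (2, 3) ++
    (List.replicate x₅ (2, -2) ++ List.replicate x₆ (2, -1))) (by simp [he]) (by simp [hp, he])).1
  have A2 := (word_replicate_of_eps_le (n := n) (i := 1) x₂ 1 3 (List.replicate x₃ (1, -2) ++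
    (List.replicate x₄ (2, 3) ++ (List.replicate x₅ (2, -2) ++ List.replicate x₆ (2, -1))))
    (by simp [he]) (by simp [hp, he])).1
  have A1 := (word_replicate_of_eps_le (n := n) (i := 1) x₁ 1 2 (List.replicate x₂ (1, 3) ++
    (List.replicate x₃ (1, -2) ++ (List.replicate x₄ (2, 3) ++ (List.replicate x₅ (2, -2) ++
    List.replicate x₆ (2, -1))))) (by simp [he]) (by simp [hp, he])).1
  rw [A5] at A4
  simp only [hp, he] at A4 A3 A2 A1
  norm_num at A4 A3 A2 A1
  omega

theorem mem_tableau {c : ℤ × ℤ} (h : c ∈ x.tableau) : (x.x₁ ≠ 0 ∧ c = (1, 2)) ∨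
    (x.x₂ ≠ 0 ∧ c = (1, 3)) ∨ (x.x₃ ≠ 0 ∧ c = (1, -2)) ∨ (x.x₄ ≠ 0 ∧ c = (2, 3)) ∨
    (x.x₅ ≠ 0 ∧ c = (2, -2)) ∨ (x.x₆ ≠ 0 ∧ c = (2, -1)) := by
  simpa [tableau, List.mem_replicate] using h

theorem mem_tableau_of {c : ℤ × ℤ} (h : (x.x₁ ≠ 0 ∧ c = (1, 2)) ∨
    (x.x₂ ≠ 0 ∧ c = (1, 3)) ∨ (x.x₃ ≠ 0 ∧ c = (1, -2)) ∨ (x.x₄ ≠ 0 ∧ c = (2, 3)) ∨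
    (x.x₅ ≠ 0 ∧ c = (2, -2)) ∨ (x.x₆ ≠ 0 ∧ c = (2, -1))) : c ∈ x.tableau := by
  simpa [tableau, List.mem_replicate] using h

theorem isHighest (hn : 4 ≤ n) (hx : x.Valid) :
    IsHighest n (Set.Icc 2 n) (colWord x.tableau) := by
  rintro i ⟨hi, hin⟩
  rw [wordE_eq_none_iff]
  rcases hi.eq_or_lt with rfl | hi
  · exact (x.word_two hn hx).1
  · refine wordEps_eq_zero_of_forall fun y hy => ?_
    obtain ⟨c, hc, hy⟩ := mem_colWord hy
    have hm := x.mem_tableau hc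
    rw [letterEps_eq ⟨by omega, hin⟩]
    have := arrow_cases (n := n) (i := i) ⟨by omega, hin⟩
    have h2 : 3 ≤ arrowSource n i := by unfold arrowSource; split_ifs <;> omega
    clear hc
    have hy' : y = 1 ∨ y = 2 ∨ y = 3 ∨ y = -1 ∨ y = -2 := by
      rcases hm with ⟨-, rfl⟩ | ⟨-, rfl⟩ | ⟨-, rfl⟩ | ⟨-, rfl⟩ | ⟨-, rfl⟩ | ⟨-, rfl⟩ <;> simp only at hy <;> omega
    rw [if_neg]
    omega

theorem isKN (hn : 4 ≤ n) (hx : x.Valid) :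
    IsKN n (x.x₁ + x.x₂ + x.x₃ + x.x₄ + x.x₅ + x.x₆) x.tableau := by
  rw [isKN_iff]
  refine ⟨by simp [tableau]; ring, fun c hc => ?_, List.Pairwise.isChain ?_⟩
  · rcases x.mem_tableau hc with h | h | h | h | h | h <;> rw [h.2, isKNCol_iff, letterLE_iff] <;>
      omega
  · obtain ⟨x₁, x₂, x₃, x₄, x₅, x₆⟩ := x
    obtain ⟨h5, h4, h6⟩ := hx
    simp only [tableau] at *
    simp only [List.pairwise_append, List.pairwise_replicate, List.mem_append, List.mem_replicate]
    have hself : ∀ a b : ℤ, b ≠ -a → Adj n (a, b) (a, b) := fun a b h => by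
      rw [adj_iff]
      exact ⟨⟨.refl n a, .refl n b⟩, by omega, by omega, by omega⟩
    refine ⟨.inr (hself _ _ (by omega)), ⟨.inr (hself _ _ (by omega)),
      ⟨.inr (hself _ _ (by omega)), ⟨.inr (hself _ _ (by omega)),
      ⟨.inl h5, .inr (hself _ _ (by omega)), ?_⟩, ?_⟩, ?_⟩, ?_⟩, ?_⟩
    all_goals
      rintro ⟨a, b⟩ h ⟨a', b'⟩ h'
      rw [adj_iff, letterLE_iff, letterLE_iff]
      simp only [Prod.mk.injEq] at h h'
      omega

theorem count_colWord_replicate (m : ℕ) (a b y : ℤ) :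
    (colWord (List.replicate m (a, b))).count y =
      m * ((if b = y then 1 else 0) + if a = y then 1 else 0) := by
  induction m with
  | zero => simp [colWord]
  | succ m ih =>
    simp only [List.replicate_succ, colWord, List.count_cons, ih, beq_iff_eq]
    ring

end Blocks

/-- The `ε_j`-coordinate of the weight of a word. -/
def coord (w : List ℤ) (j : ℕ) : ℤ := (w.count (j : ℤ) : ℤ) - (w.count (-(j : ℤ)) : ℤ)

namespace Blocks

theorem coord_tableau (x : Blocks) (j : ℕ) (hj : 1 ≤ j) : coord (colWord x.tableau) j =
    if j = 1 then (x.x₁ + x.x₂ + x.x₃ - x.x₆ : ℤ) else if j = 2 then (x.x₁ + x.x₄ + x.x₆ - x.x₃ : ℤ)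
      else if j = 3 then (x.x₂ + x.x₄ : ℤ) else 0 := by
  simp only [coord, tableau, colWord_append, List.count_append, count_colWord_replicate]
  by_cases h1 : j = 1
  · subst h1; norm_num; ring
  by_cases h2 : j = 2
  · subst h2; norm_num; ring
  by_cases h3 : j = 3
  · subst h3; norm_num
  · rw [if_neg h1, if_neg h2, if_neg h3]
    have e1 : ∀ y : ℤ, -3 < y → y < 4 → (if y = (j : ℤ) then 1 else 0 : ℕ) = 0 :=
      fun y _ _ => if_neg (by omega)
    have e2 : ∀ y : ℤ, -3 < y → y < 4 → (if y = -(j : ℤ) then 1 else 0 : ℕ) = 0 :=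
      fun y _ _ => if_neg (by omega)
    simp [e1, e2]

end Blocks

theorem wordPhi_eq_zero_of_forall {n i : ℕ} {w : List ℤ}
    (h : ∀ y ∈ w, letterPhi n i y = 0) : wordPhi n i w = 0 := by
  induction w with
  | nil => rfl
  | cons y w ih =>
    rw [wordPhi, ih fun z hz => h z (by simp [hz]), h y (by simp)]
    simp

theorem letterPhi_eq_zero_of_three_le {n i : ℕ} (hn : 4 ≤ n) (hi : 3 ≤ i) (hin : i ≤ n) {y : ℤ}
    (hy : y = 1 ∨ y = 2 ∨ y = -1 ∨ y = -2) : letterPhi n i y = 0 := by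
  have h1 := arrow_cases (n := n) (i := i) ⟨by omega, hin⟩
  have h2 : 3 ≤ arrowSource n i ∨ n < 4 := by unfold arrowSource; split_ifs <;> omega
  rw [letterPhi_eq ⟨by omega, hin⟩, if_neg]
  omega

theorem eq_of_letterEps_eq_zero {n : ℕ} (hn : 4 ≤ n) {y : ℤ} (hy : IsLetter n y)
    (h : ∀ i, 3 ≤ i → i ≤ n → letterEps n i y = 0) :
    y = 1 ∨ y = 2 ∨ y = 3 ∨ y = -1 ∨ y = -2 := by
  rw [isLetter_iff] at hy
  by_contra hne
  have key : ∀ i : ℕ, 3 ≤ i → i ≤ n → y ≠ arrowTarget n i ∧ y ≠ -arrowSource n i := by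
    intro i h3 hin
    have := h i h3 hin
    rw [letterEps_eq ⟨by omega, hin⟩] at this
    split_ifs at this with h1
    tauto
  unfold arrowTarget arrowSource at key
  rcases lt_or_ge 3 y with h1 | h1
  · have := (key (y.toNat - 1) (by omega) (by omega)).1
    rw [if_neg (by omega)] at this
    omega
  · by_cases h2 : y = -n
    · have := (key n (by omega) le_rfl).1
      rw [if_pos rfl] at this
      omega
    · have := (key (-y).toNat (by omega) (by omega)).2
      rw [if_neg (by omega)] at this
      omega

theorem wordEps_cons_eq_zero_iff {n i : ℕ} {y : ℤ} {w : List ℤ} :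
    wordEps n i (y :: w) = 0 ↔ wordEps n i w = 0 ∧ letterEps n i y ≤ wordPhi n i w := by
  rw [wordEps]; omega

namespace Blocks

theorem word_of_three_le {n : ℕ} (hn : 4 ≤ n) (x : Blocks) (h2 : x.x₂ = 0) (h4 : x.x₄ = 0) {i : ℕ} (hi : 3 ≤ i)
    (hin : i ≤ n) : wordPhi n i (colWord x.tableau) = 0 := by
  refine wordPhi_eq_zero_of_forall fun y hy => letterPhi_eq_zero_of_three_le hn hi hin ?_
  obtain ⟨c, hc, hy⟩ := mem_colWord hy
  have hm := x.mem_tableau hc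
  rcases hm with ⟨-, rfl⟩ | ⟨h, rfl⟩ | ⟨-, rfl⟩ | ⟨h, rfl⟩ | ⟨-, rfl⟩ | ⟨-, rfl⟩ <;>
    simp only at hy <;> omega

/-- Induction on the columns, adding one on the left. The vanishing of `ε_i` restricts the new
entries to `1, 2` on top and `2, 3, 2̄, 1̄` below; the order, the adjacency conditions and the value
of `φ_2` on the remaining columns then leave only columns that enlarge a block. -/
theorem exists_tableau_eq {n : ℕ} (hn : 4 ≤ n) {T : Tableau} (hT : ∀ c ∈ T, IsKNCol n c)
    (hc : T.IsChain (Adj n)) (hh : IsHighest n (Set.Icc 2 n) (colWord T)) :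
    ∃ x : Blocks, x.Valid ∧ T = x.tableau := by
  induction T with
  | nil => exact ⟨⟨0, 0, 0, 0, 0, 0⟩, ⟨by simp, by simp, by simp⟩, rfl⟩
  | cons c T ih =>
    obtain ⟨a, b⟩ := c
    have hab := hT (a, b) (by simp)
    rw [List.isChain_cons] at hc
    have hh' : ∀ i, 2 ≤ i → i ≤ n → (wordEps n i (colWord T) = 0 ∧
        letterEps n i a ≤ wordPhi n i (colWord T)) ∧
        letterEps n i b ≤ wordPhi n i (a :: colWord T) := by
      intro i h2 hi
      have := hh i ⟨h2, hi⟩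
      rwa [wordE_eq_none_iff, colWord, wordEps_cons_eq_zero_iff, wordEps_cons_eq_zero_iff] at this
    obtain ⟨x, hx, rfl⟩ := ih (fun c hc => hT c (by simp [hc])) hc.2 fun i hi =>
      (wordE_eq_none_iff _).2 (hh' i hi.1 hi.2).1.1
    have hle : ∀ c ∈ x.tableau, LetterLE n a c.1 ∧ LetterLE n b c.2 := by
      have h1 : ((a, b) :: x.tableau).IsChain (Adj n) := List.isChain_cons.2 hc
      exact (List.pairwise_cons.1 (colLE_of_isChain_adj h1)).1
    have hsep := hc.1
    have htwo := x.word_two hn hx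
    have hs : arrowSource n 2 = 2 := by unfold arrowSource; grind
    have ht : arrowTarget n 2 = 3 := by unfold arrowTarget; grind
    have hla : IsLetter n a := hab.1.1.1
    have hlb : IsLetter n b := hab.1.1.2
    have hcol := isKNCol_iff.1 hab
    have ha : a = 1 ∨ a = 2 := by
      by_cases hz : x.tableau = []
      · have := eq_of_letterEps_eq_zero hn hla fun i h3 hi => by
          have := (hh' i (by omega) hi).1.2
          simpa [hz, colWord, wordPhi] using this
        have h2 := (hh' 2 le_rfl (by omega)).1.2
        rw [hz] at h2
        have h3 : a ≠ 3 := by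
          rintro rfl
          rw [letterEps_eq ⟨by omega, by omega⟩, if_pos (.inl ht.symm)] at h2
          simp [colWord, wordPhi] at h2
        have h4 : a ≠ -2 := by
          rintro rfl
          rw [letterEps_eq ⟨by omega, by omega⟩, if_pos (.inr (by rw [hs]))] at h2
          simp [colWord, wordPhi] at h2
        have h5 : a ≠ -1 := by
          rintro rfl
          rw [letterLE_iff] at hcol
          omega
        omega
      · obtain ⟨c, hc⟩ := List.exists_mem_of_ne_nil _ hz
        have h1 := (hle c hc).1
        have h2 : c.1 = 1 ∨ c.1 = 2 := by
          rcases x.mem_tableau hc with ⟨-, rfl⟩ | ⟨-, rfl⟩ | ⟨-, rfl⟩ | ⟨-, rfl⟩ | ⟨-, rfl⟩ |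
            ⟨-, rfl⟩ <;> simp
        rw [letterLE_iff] at h1
        omega
    have hb : b = 2 ∨ b = 3 ∨ b = -1 ∨ b = -2 := by
      have hb1 : b ≠ 1 := by
        rintro rfl
        rw [letterLE_iff] at hcol
        omega
      by_cases hz : x.x₂ = 0 ∧ x.x₄ = 0
      · have := eq_of_letterEps_eq_zero hn hlb fun i h3 hi => by
          have := (hh' i (by omega) hi).2
          rw [wordPhi, x.word_of_three_le hn hz.1 hz.2 h3 hi,
            letterPhi_eq_zero_of_three_le hn h3 hi (by omega)] at this
          omega
        omega
      · have h3 : LetterLE n b 3 := by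
          by_cases h2 : x.x₂ = 0
          · exact (hle (2, 3) (x.mem_tableau_of (by simp; omega))).2
          · exact (hle (1, 3) (x.mem_tableau_of (by simp; omega))).2
        rw [letterLE_iff] at h3 hcol
        omega
    -- A bottom entry `3` or `2̄` below `1` needs a surplus of `φ_2` to its right; this is the
    -- source of the inequality `x₂ + x₃ ≤ x₆`.
    have key : x.x₁ + (x.x₆ - x.x₂ - x.x₃) = 0 → a = 1 → b ≠ 3 ∧ b ≠ -2 := by
      rintro h0 rfl
      have h2 := (hh' 2 le_rfl (by omega)).2
      rw [wordPhi, htwo.2, h0, letterPhi_eq ⟨by omega, by omega⟩, if_neg (by omega),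
        letterEps_eq ⟨by omega, by omega⟩] at h2
      split_ifs at h2 <;> omega
    have hmem := fun c h => hle c (x.mem_tableau_of h)
    clear hh hh' hle hT hc ih hab htwo
    obtain ⟨x₁, x₂, x₃, x₄, x₅, x₆⟩ := x
    obtain ⟨v5, v4, v6⟩ := hx
    simp only at *
    have m1 : x₁ ≠ 0 → _ := fun h => hmem (1, 2) (by simp [h])
    have m2 : x₂ ≠ 0 → _ := fun h => hmem (1, 3) (by simp [h])
    have m3 : x₃ ≠ 0 → _ := fun h => hmem (1, -2) (by simp [h])
    have m4 : x₄ ≠ 0 → _ := fun h => hmem (2, 3) (by simp [h])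
    have m5 : x₅ ≠ 0 → _ := fun h => hmem (2, -2) (by simp [h])
    simp only [letterLE_iff] at m1 m2 m3 m4 m5 hcol
    clear hmem
    rcases ha with rfl | rfl
    · rcases hb with rfl | rfl | rfl | rfl
      · exact ⟨⟨x₁ + 1, x₂, x₃, x₄, x₅, x₆⟩, ⟨v5, v4, v6⟩, rfl⟩
      · obtain rfl : x₁ = 0 := by omega
        exact ⟨⟨0, x₂ + 1, x₃, x₄, x₅, x₆⟩, ⟨v5, v4, by simp only; omega⟩, rfl⟩
      · omega
      · obtain rfl : x₁ = 0 := by omega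
        obtain rfl : x₂ = 0 := by omega
        exact ⟨⟨0, 0, x₃ + 1, x₄, x₅, x₆⟩, ⟨v5, by simp only; omega, by simp only; omega⟩, rfl⟩
    · obtain rfl : x₁ = 0 := by omega
      obtain rfl : x₂ = 0 := by omega
      obtain rfl : x₃ = 0 := by omega
      have h5 : b = 3 ∨ b = -2 → x₄ = 0 → x₅ = 0 := by
        rintro h rfl
        by_contra h5
        obtain rfl : x₅ = 1 := by omega
        have := hsep (2, -2) rfl
        rw [adj_iff] at this
        omega
      rcases hb with rfl | rfl | rfl | rfl
      · omega
      · have h0 : x₅ = 0 := v4.elim (h5 (.inl rfl)) fun h => h.2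
        exact ⟨⟨0, 0, 0, x₄ + 1, x₅, x₆⟩, ⟨v5, .inr ⟨rfl, h0⟩, by simp only; omega⟩, rfl⟩
      · obtain rfl : x₄ = 0 := by omega
        obtain rfl : x₅ = 0 := by omega
        exact ⟨⟨0, 0, 0, 0, 0, x₆ + 1⟩, ⟨v5, v4, by simp only; omega⟩, rfl⟩
      · obtain rfl : x₄ = 0 := by omega
        obtain rfl : x₅ = 0 := by omega
        exact ⟨⟨0, 0, 0, 0, 1, x₆⟩, ⟨le_rfl, by simp, v6⟩, rfl⟩

/-- The component, the weight, and hence the shape of the tableau. -/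
structure HasLabel (x : Blocks) (k p q : ℕ) (d : ℤ) : Prop where
  size : x.x₁ + x.x₂ + x.x₃ + x.x₄ + x.x₅ + x.x₆ = k
  first : (x.x₁ + x.x₂ + x.x₃ - x.x₆ : ℤ) = d
  second : (x.x₁ + x.x₄ + x.x₆ - x.x₃ : ℤ) = p
  third : x.x₂ + x.x₄ = q

theorem HasLabel.unique {x y : Blocks} {k p q : ℕ} {d : ℤ} (hx : x.Valid) (hy : y.Valid)
    (h : x.HasLabel k p q d) (h' : y.HasLabel k p q d) : x = y := by
  obtain ⟨x₁, x₂, x₃, x₄, x₅, x₆⟩ := x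
  obtain ⟨y₁, y₂, y₃, y₄, y₅, y₆⟩ := y
  obtain ⟨a1, a2, a3⟩ := hx
  obtain ⟨b1, b2, b3⟩ := hy
  obtain ⟨c1, c2, c3, c4⟩ := h
  obtain ⟨d1, d2, d3, d4⟩ := h'
  simp only [mk.injEq] at *
  omega

/-- The labels that occur. -/
def IsLabel (k p q : ℕ) (d : ℤ) : Prop :=
  q ≤ p ∧ p ≤ k ∧ ∃ α : ℕ, q + α ≤ p ∧ d = 2 * α - (p - q)

theorem Valid.exists_label {x : Blocks} (hx : x.Valid) :
    ∃ k p q d, x.HasLabel k p q d ∧ IsLabel k p q d := by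
  obtain ⟨a1, a2, a3⟩ := hx
  refine ⟨_, (x.x₁ + x.x₄ + x.x₆ - x.x₃ : ℕ), _, _, ⟨rfl, rfl, by omega, rfl⟩, by omega, by omega,
    x.x₁, by omega, by omega⟩

theorem HasLabel.isLabel {x : Blocks} (hx : x.Valid) {k p q : ℕ} {d : ℤ}
    (h : x.HasLabel k p q d) : IsLabel k p q d := by
  obtain ⟨a1, a2, a3⟩ := hx
  obtain ⟨c1, c2, c3, c4⟩ := h
  exact ⟨by omega, by omega, x.x₁, by omega, by omega⟩

/-- `α` is the number of columns `(1, 2)`. The equation `k - p = x₂ + 2 x₃ + x₅` is solved by using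
`x₂` up to its maximum `q`, then `x₃` for pairs and `x₅` for the parity. -/
theorem IsLabel.exists_blocks {k p q : ℕ} {d : ℤ} (h : IsLabel k p q d) :
    ∃ x : Blocks, x.Valid ∧ x.HasLabel k p q d := by
  obtain ⟨h1, h2, α, h3, rfl⟩ := h
  by_cases hk : k ≤ p + q
  · refine ⟨⟨α, k - p, 0, q - (k - p), 0, k - α - q⟩, ⟨?_, .inr ⟨rfl, rfl⟩, ?_⟩, ⟨?_, ?_, ?_, ?_⟩⟩ <;>
      simp only <;> omega
  · refine ⟨⟨α, q, (k - p - q) / 2, 0, (k - p - q) % 2,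
      k - α - q - (k - p - q) / 2 - (k - p - q) % 2⟩, ⟨?_, .inl rfl, ?_⟩, ⟨?_, ?_, ?_, ?_⟩⟩ <;>
      simp only <;> omega

theorem HasLabel.wordPhi_one {n : ℕ} (hn : 4 ≤ n) {x : Blocks} (hx : x.Valid) {k p q : ℕ} {d : ℤ}
    (h : x.HasLabel k p q d) : wordPhi n 1 (colWord x.tableau) = k - p := by
  rw [x.word_one hn hx]
  obtain ⟨a1, a2, a3⟩ := hx
  obtain ⟨c1, c2, c3, c4⟩ := h
  omega

end Blocks

open Relation

/-! ### Weights of words -/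

/-- The `ε_j`-coordinate of the weight of a letter. -/
def letterCoord (y : ℤ) (j : ℕ) : ℤ := (if y = j then 1 else 0) - (if y = -j then 1 else 0)

theorem letterCoord_neg (y : ℤ) (j : ℕ) : letterCoord (-y) j = -letterCoord y j := by
  unfold letterCoord
  grind

theorem coord_cons (y : ℤ) (w : List ℤ) (j : ℕ) :
    coord (y :: w) j = letterCoord y j + coord w j := by
  unfold coord letterCoord
  simp only [List.count_cons, beq_iff_eq]
  push_cast
  ring

theorem coord_of_wordF {n i : ℕ} (hi : 1 ≤ i ∧ i ≤ n) {w v : List ℤ} (h : wordF n i w = some v)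
    (j : ℕ) : coord v j =
      coord w j + (letterCoord (arrowTarget n i) j - letterCoord (arrowSource n i) j) := by
  induction w generalizing v with
  | nil => simp [wordF] at h
  | cons x w ih =>
    simp only [wordF] at h
    split_ifs at h with hc
    · obtain ⟨y, hy, rfl⟩ := Option.map_eq_some_iff.1 h
      rw [letterF_eq hi.1 hi.2] at hy
      rw [coord_cons, coord_cons]
      split_ifs at hy with h1 h2
      · rw [Option.some.injEq] at hy
        rw [h1, ← hy]; ring
      · rw [Option.some.injEq] at hy
        rw [h2, ← hy, letterCoord_neg, letterCoord_neg]; ring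
    · obtain ⟨u, hu, rfl⟩ := Option.map_eq_some_iff.1 h
      rw [coord_cons, coord_cons, ih hu]; ring

/-- `φ_i - ε_i` is the value of the coroot `h_i` on the weight. -/
theorem wordPhi_sub_wordEps_eq_coord {n i : ℕ} (hi : 1 ≤ i ∧ i ≤ n) (h2 : 2 ≤ n) (w : List ℤ) :
    (wordPhi n i w : ℤ) - wordEps n i w =
      if i = n then coord w (n - 1) + coord w n else coord w i - coord w (i + 1) := by
  rw [wordPhi_sub_wordEps]
  induction w with
  | nil => simp [coord]
  | cons y w ih =>
    rw [List.map_cons, List.sum_cons, ih, letterPhi_eq hi, letterEps_eq hi]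
    simp only [coord_cons, letterCoord, arrowSource, arrowTarget]
    have e : ((n - 1 : ℕ) : ℤ) = n - 1 := by omega
    rw [e]
    push_cast
    split_ifs <;> omega

theorem coord_one_of_raises {n : ℕ} (hn : 4 ≤ n) {w v : List ℤ}
    (h : ReflTransGen (Raises n (Set.Icc 2 n)) w v) : coord v 1 = coord w 1 := by
  induction h with
  | refl => rfl
  | tail _ hs ih =>
    obtain ⟨i, ⟨h2, hi⟩, he⟩ := hs
    have := coord_of_wordF ⟨by omega, hi⟩ ((wordE_eq_some_iff (by omega)).1 he) 1
    have h1 := arrow_cases (n := n) (i := i) ⟨by omega, hi⟩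
    have h3 : 2 ≤ arrowSource n i := by unfold arrowSource; split_ifs <;> omega
    rw [← ih, this]
    unfold letterCoord
    push_cast
    split_ifs <;> omega

theorem length_of_raises {n : ℕ} (hn : 4 ≤ n) {J : Set ℕ} {w v : List ℤ}
    (h : ReflTransGen (Raises n J) w v) : v.length = w.length := by
  induction h with
  | refl => rfl
  | tail _ hs ih =>
    obtain ⟨i, -, he⟩ := hs
    rw [← ih, (wordF_some (by omega) ((wordE_eq_some_iff (by omega)).1 he)).2.2.2]

theorem wt_eq_coord {n s : ℕ} (T : Btilde n s) (j : ℕ) : wt T j = coord (word T) j := rfl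

/-! ### Highest weight vectors of branching component vertices -/

theorem exists_word_of_raises {n s : ℕ} (hn : 4 ≤ n) {J : Set ℕ} (hJ : J ⊆ Set.Icc 1 n)
    {T : Btilde n s} {v : List ℤ} (h : ReflTransGen (Raises n J) (word T) v) :
    ∃ U : Btilde n s, word U = v := by
  induction h with
  | refl => exact ⟨T, rfl⟩
  | tail _ hs ih =>
    obtain ⟨U, rfl⟩ := ih
    obtain ⟨i, hi, he⟩ := hs
    exact exists_word_of_wordE (by omega) (hJ hi) he

/-- `U` is the highest weight vector of the vertex that contains `T`. -/
def IsTop {n s : ℕ} (T U : Btilde n s) : Prop :=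
  ReflTransGen (Raises n (Set.Icc 2 n)) (word T) (word U) ∧ IsHighest n (Set.Icc 2 n) (word U)

theorem Icc_two_subset (n : ℕ) : Set.Icc 2 n ⊆ Set.Icc 1 n := Set.Icc_subset_Icc_left (by omega)

section

variable {n s : ℕ}

theorem exists_isTop (hn : 4 ≤ n) (T : Btilde n s) : ∃ U, IsTop T U := by
  obtain ⟨u, h1, h2⟩ := exists_highest hn (Set.Icc 2 n) (word T)
  obtain ⟨U, rfl⟩ := exists_word_of_raises hn (Icc_two_subset n) h1
  exact ⟨U, h1, h2⟩

theorem IsTop.unique (hn : 4 ≤ n) {T U U' : Btilde n s} (h : IsTop T U) (h' : IsTop T U') :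
    U = U' :=
  word_injective (highest_unique hn (Icc_two_subset n) h.1 h'.1 h.2 h'.2)

theorem isLeviHighest_iff (hn : 4 ≤ n) {U : Btilde n s} :
    IsLeviHighest U ↔ IsHighest n (Set.Icc 2 n) (word U) := by
  constructor
  · exact fun h i hi => (classE_eq_none_iff (by omega) ⟨by have := hi.1; omega, hi.2⟩).1 (h i hi.1 hi.2)
  · exact fun h i h2 hi => (classE_eq_none_iff (by omega) ⟨by omega, hi⟩).2 (h i ⟨h2, hi⟩)

theorem bcVertex_eq_of_raises (hn : 4 ≤ n) {T : Btilde n s} {v : List ℤ}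
    (h : ReflTransGen (Raises n (Set.Icc 2 n)) (word T) v) :
    ∀ U : Btilde n s, word U = v → bcVertex T = bcVertex U := by
  induction h with
  | refl => exact fun U h => by rw [word_injective h]
  | @tail x y hr hs ih =>
    intro U hU
    obtain ⟨V, rfl⟩ := exists_word_of_raises hn (Icc_two_subset n) hr
    rw [ih V rfl]
    obtain ⟨i, hi, he⟩ := hs
    subst hU
    have hi' : 1 ≤ i ∧ i ≤ n := Icc_two_subset n hi
    have hf := (classF_eq_some_iff (by omega) hi').2 ((wordE_eq_some_iff (by omega)).1 he)
    refine SimpleGraph.ConnectedComponent.sound (SimpleGraph.Adj.reachable ?_)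
    rw [leviGraph, SimpleGraph.fromRel_adj]
    refine ⟨?_, .inr ⟨i, hi.1, hi.2, hf⟩⟩
    rintro rfl
    have := totalHeight_of_wordE hn he
    omega

theorem IsTop.bcVertex_eq (hn : 4 ≤ n) {T U : Btilde n s} (h : IsTop T U) :
    bcVertex T = bcVertex U := bcVertex_eq_of_raises hn h.1 U rfl

theorem isTop_of_classF (hn : 4 ≤ n) {T T' U : Btilde n s} {i : ℕ} (h2 : 2 ≤ i) (hi : i ≤ n)
    (h : classF i T = some T') : IsTop T U ↔ IsTop T' U := by
  have he := (wordE_eq_some_iff (by omega)).2 ((classF_eq_some_iff (by omega) ⟨by omega, hi⟩).1 h)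
  have key : ∀ U, IsTop T U → IsTop T' U := fun U hU => ⟨.head ⟨i, ⟨h2, hi⟩, he⟩ hU.1, hU.2⟩
  refine ⟨key U, fun hU => ?_⟩
  obtain ⟨V, hV⟩ := exists_isTop hn T
  rwa [hU.unique hn (key V hV)]

theorem isTop_iff_of_bcVertex_eq (hn : 4 ≤ n) {T T' U : Btilde n s} (h : bcVertex T = bcVertex T') :
    IsTop T U ↔ IsTop T' U := by
  obtain ⟨p⟩ := SimpleGraph.ConnectedComponent.exact h
  induction p with
  | nil => rfl
  | cons hadj p ih =>
    rw [← ih (SimpleGraph.ConnectedComponent.sound p.reachable)]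
    rw [leviGraph, SimpleGraph.fromRel_adj] at hadj
    rcases hadj.2 with ⟨i, h2, hi, hf⟩ | ⟨i, h2, hi, hf⟩
    · exact isTop_of_classF hn h2 hi hf
    · exact (isTop_of_classF hn h2 hi hf).symm

theorem IsTop.refl {U : Btilde n s} (h : IsHighest n (Set.Icc 2 n) (word U)) : IsTop U U :=
  ⟨.refl, h⟩

theorem IsTop.coord_one (hn : 4 ≤ n) {T U : Btilde n s} (h : IsTop T U) :
    coord (word U) 1 = coord (word T) 1 := coord_one_of_raises hn h.1

theorem IsTop.compIndex (hn : 4 ≤ n) {T U : Btilde n s} (h : IsTop T U) :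
    compIndex U = compIndex T := by
  have := length_of_raises hn h.1
  rw [length_word, length_word] at this
  omega

/-- `U` is a highest weight vector in the component `k`, with weight `d ε₁ + p ε₂ + q ε₃`. -/
def TopLabel (U : Btilde n s) (k p q : ℕ) (d : ℤ) : Prop :=
  ∃ x : Blocks, x.Valid ∧ drop U = x.tableau ∧ x.HasLabel k p q d

theorem exists_topLabel (hn : 4 ≤ n) {U : Btilde n s} (h : IsHighest n (Set.Icc 2 n) (word U)) :
    ∃ k p q d, TopLabel U k p q d := by
  have hk := isKN_iff.1 (isKN_drop U)
  obtain ⟨x, hx, he⟩ := Blocks.exists_tableau_eq hn hk.2.1 hk.2.2 h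
  obtain ⟨k, p, q, d, hl, -⟩ := hx.exists_label
  exact ⟨k, p, q, d, x, hx, he, hl⟩

namespace TopLabel

variable {U : Btilde n s} {k p q : ℕ} {d : ℤ}

theorem isHighest (hn : 4 ≤ n) (h : TopLabel U k p q d) : IsHighest n (Set.Icc 2 n) (word U) := by
  obtain ⟨x, hx, he, -⟩ := h
  rw [word, he]
  exact x.isHighest hn hx

theorem isLabel (h : TopLabel U k p q d) : Blocks.IsLabel k p q d := by
  obtain ⟨x, hx, he, hl⟩ := h
  exact hl.isLabel hx

theorem compIndex_eq (h : TopLabel U k p q d) : compIndex U = k := by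
  obtain ⟨x, hx, he, hl⟩ := h
  rw [compIndex, he, ← hl.size]
  simp [Blocks.tableau]
  ring

theorem coord_eq (h : TopLabel U k p q d) {j : ℕ} (hj : 1 ≤ j) : coord (word U) j =
    if j = 1 then d else if j = 2 then (p : ℤ) else if j = 3 then (q : ℤ) else 0 := by
  obtain ⟨x, hx, he, hl⟩ := h
  rw [word, he, x.coord_tableau j hj, ← hl.first, ← hl.second, ← hl.third]
  push_cast
  rfl

theorem le (h : TopLabel U k p q d) : k ≤ s := h.compIndex_eq ▸ compIndex_le U

theorem label_unique (h : TopLabel U k p q d) {k' p' q' : ℕ} {d' : ℤ}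
    (h' : TopLabel U k' p' q' d') : k = k' ∧ p = p' ∧ q = q' ∧ d = d' := by
  have h1 := h.compIndex_eq.symm.trans h'.compIndex_eq
  have e1 := (h.coord_eq le_rfl).symm.trans (h'.coord_eq le_rfl)
  have e2 := (h.coord_eq (j := 2) (by omega)).symm.trans (h'.coord_eq (by omega))
  have e3 := (h.coord_eq (j := 3) (by omega)).symm.trans (h'.coord_eq (by omega))
  norm_num at e1 e2 e3
  exact ⟨h1, e2, e3, e1⟩

theorem unique (h : TopLabel U k p q d) {U' : Btilde n s} (h' : TopLabel U' k p q d) : U = U' := by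
  obtain ⟨x, hx, he, hl⟩ := h
  obtain ⟨y, hy, he', hl'⟩ := h'
  exact drop_injective (by rw [he, he', hl.unique hx hy hl'])

theorem exists_of_isLabel (hn : 4 ≤ n) (h : Blocks.IsLabel k p q d) (hk : k ≤ s) :
    ∃ U : Btilde n s, TopLabel U k p q d := by
  obtain ⟨x, hx, hl⟩ := h.exists_blocks
  have := x.isKN hn hx
  rw [hl.size] at this
  obtain ⟨U, -, hU, -⟩ := exists_word_eq (by omega) this hk
  exact ⟨U, x, hx, hU, hl⟩

theorem wordPhi_one (hn : 4 ≤ n) (h : TopLabel U k p q d) : wordPhi n 1 (word U) = k - p := by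
  obtain ⟨x, hx, he, hl⟩ := h
  rw [word, he, hl.wordPhi_one hn hx]

/-- At a highest weight vector `φ_i` is the value of the coroot `h_i`, which for `i ≥ 2` does not
involve the `ε₁`-coordinate. The shape alone decides. -/
theorem wordPhi_eq (hn : 4 ≤ n) (h : TopLabel U k p q d) {k' : ℕ} {d' : ℤ} {U' : Btilde n s}
    (h' : TopLabel U' k' p q d') {i : ℕ} (hi : i ∈ Set.Icc 2 n) :
    wordPhi n i (word U) = wordPhi n i (word U') := by
  have h1 := wordPhi_sub_wordEps_eq_coord (Icc_two_subset n hi) (by omega) (word U)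
  have h2 := wordPhi_sub_wordEps_eq_coord (Icc_two_subset n hi) (by omega) (word U')
  rw [(wordE_eq_none_iff _).1 (h.isHighest hn i hi)] at h1
  rw [(wordE_eq_none_iff _).1 (h'.isHighest hn i hi)] at h2
  have key : ∀ j, 2 ≤ j → coord (word U) j = coord (word U') j := fun j hj => by
    rw [h.coord_eq (by omega), h'.coord_eq (by omega), if_neg (by omega : j ≠ 1),
      if_neg (by omega : j ≠ 1)]
  have := hi.1
  rw [key _ (by omega), key _ (by omega), key _ (by omega), key _ (by omega)] at h1
  omega

end TopLabel

end

open Relation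

/-! ### The branching component graph -/

theorem letterEps_one_two {n : ℕ} (hn : 4 ≤ n) : letterEps n 1 2 = 1 := by
  rw [letterEps_eq ⟨le_rfl, by omega⟩, if_pos]
  left
  unfold arrowTarget
  rw [if_neg (by omega)]
  norm_num

theorem wordEps_colWord_append_ge (n i : ℕ) (T T' : Tableau) :
    wordEps n i (colWord T') ≤ wordEps n i (colWord (T ++ T')) := by
  rw [colWord_append, wordEps_append]
  omega

/-- The word ends with a letter `2`, and there is nothing to its right that could cancel its `ε_1`.
-/
theorem wordEps_colWord_replicate_pos {n m : ℕ} (hn : 4 ≤ n) (hm : m ≠ 0) (b : ℤ) :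
    0 < wordEps n 1 (colWord (List.replicate m (2, b))) := by
  obtain ⟨m, rfl⟩ := Nat.exists_eq_succ_of_ne_zero hm
  rw [Nat.succ_eq_add_one, List.replicate_succ']
  refine lt_of_lt_of_le ?_ (wordEps_colWord_append_ge n 1 _ _)
  simp only [colWord, wordEps, letterEps_one_two hn, wordPhi]
  omega

/-- A highest weight vector for the colours `2, …, n` that is annihilated by `ẽ_1` is
`(1, 2) ⋯ (1, 2)`. -/
theorem Blocks.eq_of_wordE_one {n : ℕ} (hn : 4 ≤ n) {x : Blocks} (hx : x.Valid)
    (h : wordE n 1 (colWord x.tableau) = none) : x = ⟨x.x₁, 0, 0, 0, 0, 0⟩ := by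
  rw [wordE_eq_none_iff] at h
  obtain ⟨x₁, x₂, x₃, x₄, x₅, x₆⟩ := x
  obtain ⟨v5, v4, v6⟩ := hx
  simp only [tableau] at *
  have e1 := wordEps_colWord_append_ge n 1 (List.replicate x₁ (1, 2)) (List.replicate x₂ (1, 3) ++
    (List.replicate x₃ (1, -2) ++ (List.replicate x₄ (2, 3) ++ (List.replicate x₅ (2, -2) ++
    List.replicate x₆ (2, -1)))))
  have e2 := wordEps_colWord_append_ge n 1 (List.replicate x₂ (1, 3)) (
    List.replicate x₃ (1, -2) ++ (List.replicate x₄ (2, 3) ++ (List.replicate x₅ (2, -2) ++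
    List.replicate x₆ (2, -1))))
  have e3 := wordEps_colWord_append_ge n 1 (List.replicate x₃ (1, -2)) (List.replicate x₄ (2, 3) ++
    (List.replicate x₅ (2, -2) ++ List.replicate x₆ (2, -1)))
  have e4 := wordEps_colWord_append_ge n 1 (List.replicate x₄ (2, 3)) (List.replicate x₅ (2, -2) ++
    List.replicate x₆ (2, -1))
  have e5 := wordEps_colWord_append_ge n 1 (List.replicate x₅ (2, -2)) (List.replicate x₆ (2, -1))
  obtain rfl : x₆ = 0 := by
    by_contra h6
    have := wordEps_colWord_replicate_pos hn h6 (-1)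
    omega
  obtain rfl : x₅ = 0 := by
    by_contra h5
    have := wordEps_colWord_replicate_pos hn h5 (-2)
    simp only [List.replicate_zero, List.append_nil] at *
    omega
  obtain rfl : x₄ = 0 := by
    by_contra h4
    have := wordEps_colWord_replicate_pos hn h4 3
    simp only [List.replicate_zero, List.append_nil] at *
    omega
  obtain rfl : x₂ = 0 := by omega
  obtain rfl : x₃ = 0 := by omega
  rfl

theorem coord_one_of_wordF_one {n : ℕ} (hn : 4 ≤ n) {w v : List ℤ} (h : wordF n 1 w = some v) :
    coord v 1 = coord w 1 - 1 := by
  rw [coord_of_wordF ⟨le_rfl, by omega⟩ h]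
  have hs : arrowSource n 1 = 1 := by unfold arrowSource; grind
  have ht : arrowTarget n 1 = 2 := by unfold arrowTarget; grind
  rw [hs, ht]
  norm_num [letterCoord]
  ring

section

variable {n s : ℕ}

theorem coord_one_eq_of_bcVertex_eq (hn : 4 ≤ n) {T T' : Btilde n s}
    (h : bcVertex T = bcVertex T') : coord (word T) 1 = coord (word T') 1 := by
  obtain ⟨U, hU⟩ := exists_isTop hn T
  rw [← hU.coord_one hn, ← ((isTop_iff_of_bcVertex_eq hn h).1 hU).coord_one hn]

/-- The `ε₁`-coordinate is constant on vertices, as the colours `2, …, n` preserve it, and it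
changes by exactly one along an edge. -/
theorem coord_one_sub_le_length (hn : 4 ≤ n) {v w : BCVertex n s} (p : (bcGraph n s).Walk v w) :
    ∀ T T' : Btilde n s, bcVertex T = v → bcVertex T' = w →
      coord (word T) 1 - coord (word T') 1 ≤ p.length := by
  induction p with
  | nil =>
    intro T T' h h'
    rw [coord_one_eq_of_bcVertex_eq hn (h.trans h'.symm)]
    simp
  | cons hadj p ih =>
    intro T T' h h'
    rw [bcGraph, SimpleGraph.fromRel_adj] at hadj
    rw [SimpleGraph.Walk.length_cons]
    rcases hadj.2 with ⟨V, V', hV, hV', hf⟩ | ⟨V, V', hV, hV', hf⟩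
    · have h1 := ih V' T' hV' h'
      have h2 := coord_one_of_wordF_one hn ((classF_eq_some_iff (by omega) ⟨le_rfl, by omega⟩).1 hf)
      have h3 := coord_one_eq_of_bcVertex_eq hn (h.trans hV.symm)
      push_cast
      omega
    · have h1 := ih V T' hV h'
      have h2 := coord_one_of_wordF_one hn ((classF_eq_some_iff (by omega) ⟨le_rfl, by omega⟩).1 hf)
      have h3 := coord_one_eq_of_bcVertex_eq hn (h.trans hV'.symm)
      push_cast
      omega

theorem TopLabel.le_size {U : Btilde n s} {k p q : ℕ} {d : ℤ} (h : TopLabel U k p q d) :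
    d ≤ k ∧ -k ≤ d := by
  obtain ⟨h1, h2, α, h3, h4⟩ := h.isLabel
  omega

/-- Climb from `U`. If `ẽ_1` applies, it leads to a vertex whose `ε₁`-coordinate is larger by one;
if not, `U` is `(1, 2)^k`, whose `ε₁`-coordinate is already `k`. -/
theorem exists_walk (hn : 4 ≤ n) {u : Btilde n s} {k : ℕ} (hu : drop u = List.replicate k (1, 2))
    (m : ℕ) : ∀ (U : Btilde n s) (p q : ℕ) (d : ℤ), TopLabel U k p q d → k = d + m →
      ∃ w : (bcGraph n s).Walk (bcVertex u) (bcVertex U), w.length = m := by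
  induction m with
  | zero =>
    intro U p q d h hd
    obtain ⟨x, hx, he, hl⟩ := h
    have : U = u := drop_injective <| by
      obtain ⟨x₁, x₂, x₃, x₄, x₅, x₆⟩ := x
      obtain ⟨v5, v4, v6⟩ := hx
      obtain ⟨l1, l2, l3, l4⟩ := hl
      simp only at *
      obtain rfl : x₆ = 0 := by omega
      obtain rfl : x₅ = 0 := by omega
      obtain rfl : x₄ = 0 := by omega
      obtain rfl : x₃ = 0 := by omega
      obtain rfl : x₂ = 0 := by omega
      obtain rfl : x₁ = k := by omega
      rw [he, hu]
      simp [Blocks.tableau]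
    subst this
    exact ⟨.nil, rfl⟩
  | succ m ih =>
    intro U p q d h hd
    cases hE : wordE n 1 (word U) with
    | none =>
      obtain ⟨x, hx, he, hl⟩ := h
      rw [word, he] at hE
      have hx1 := Blocks.eq_of_wordE_one hn hx hE
      obtain ⟨l1, l2, l3, l4⟩ := hl
      rw [hx1] at l1 l2
      simp only at l1 l2
      omega
    | some v =>
      obtain ⟨V, rfl⟩ := exists_word_of_wordE (by omega) ⟨le_rfl, by omega⟩ hE
      have hF := (wordE_eq_some_iff (by omega)).1 hE
      obtain ⟨W, hW⟩ := exists_isTop hn V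
      obtain ⟨k', p', q', d', hl⟩ := exists_topLabel hn hW.2
      have h1 : d' = d + 1 := by
        have h2 := hl.coord_eq le_rfl
        have h3 := h.coord_eq le_rfl
        have h4 := coord_one_of_wordF_one hn hF
        rw [if_pos rfl] at h2 h3
        rw [← h2, hW.coord_one hn]
        omega
      have h2 : k' = k := by
        have h3 := (wordF_some (by omega) hF).2.2.2
        rw [length_word, length_word] at h3
        rw [← hl.compIndex_eq, hW.compIndex hn, ← h.compIndex_eq]
        omega
      subst h1 h2
      obtain ⟨w, hw⟩ := ih W p' q' _ hl (by omega)
      have hadj : (bcGraph n s).Adj (bcVertex W) (bcVertex U) := by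
        rw [bcGraph, SimpleGraph.fromRel_adj]
        refine ⟨fun heq => ?_, .inl ⟨V, U, hW.bcVertex_eq hn, rfl,
          (classF_eq_some_iff (by omega) ⟨le_rfl, by omega⟩).2 hF⟩⟩
        have h2 := coord_one_eq_of_bcVertex_eq hn heq
        rw [hl.coord_eq le_rfl, h.coord_eq le_rfl, if_pos rfl, if_pos rfl] at h2
        omega
      exact ⟨w.concat hadj, by rw [SimpleGraph.Walk.length_concat, hw]⟩

theorem coord_one_replicate {u : Btilde n s} {k : ℕ} (hu : drop u = List.replicate k (1, 2)) :
    TopLabel u k k 0 k :=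
  ⟨⟨k, 0, 0, 0, 0, 0⟩, ⟨by simp, by simp, by simp⟩, by rw [hu]; simp [Blocks.tableau],
    ⟨by simp, by simp, by simp, by simp⟩⟩

theorem dist_eq (hn : 4 ≤ n) {u U : Btilde n s} {k p q : ℕ} {d : ℤ}
    (hu : drop u = List.replicate k (1, 2)) (h : TopLabel U k p q d) :
    ((bcGraph n s).dist (bcVertex u) (bcVertex U) : ℤ) = k - d := by
  obtain ⟨w, hw⟩ := exists_walk hn hu (k - d).toNat U p q d h (by have := h.le_size; omega)
  have h1 := SimpleGraph.dist_le w
  obtain ⟨w', hw'⟩ := w.reachable.exists_walk_length_eq_dist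
  have h2 := coord_one_sub_le_length hn w' u U rfl rfl
  rw [h.coord_eq le_rfl, (coord_one_replicate hu).coord_eq le_rfl, if_pos rfl, if_pos rfl] at h2
  have := h.le_size
  omega

/-- The distance is `k - d`, so the rank is `(k - d) + (s - k) = s - d`, independent of the
component. -/
theorem isVertex_iff (hn : 4 ≤ n) {k p q r : ℕ} {v : BCVertex n s} : IsVertex k p q r v ↔
    ∃ (U : Btilde n s) (d : ℤ), bcVertex U = v ∧ TopLabel U k p q d ∧ (r : ℤ) = s - d := by
  constructor
  · rintro ⟨⟨U, rfl, hk, hU, hw⟩, u, hu, hr⟩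
    obtain ⟨k', p', q', d, hl⟩ := exists_topLabel hn ((isLeviHighest_iff hn).1 hU)
    obtain rfl := hl.compIndex_eq.symm.trans hk
    have h2 := hw 2 le_rfl (by omega)
    have h3 := hw 3 (by omega) (by omega)
    rw [wt_eq_coord, hl.coord_eq (by omega)] at h2 h3
    norm_num at h2 h3
    subst h2 h3
    have h4 := dist_eq hn hu hl
    have h5 := hl.le
    exact ⟨U, d, rfl, hl, by omega⟩
  · rintro ⟨U, d, rfl, hl, hr⟩
    refine ⟨⟨U, rfl, hl.compIndex_eq, (isLeviHighest_iff hn).2 (hl.isHighest hn), fun j hj hjn => ?_⟩,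
      ?_⟩
    · rw [wt_eq_coord, hl.coord_eq (by omega), if_neg (by omega : j ≠ 1)]
    · obtain ⟨u, x, hx, hu, hlx⟩ := TopLabel.exists_of_isLabel (s := s) (k := k) (p := k) (q := 0)
        (d := k) hn ⟨by omega, le_rfl, k, by omega, by push_cast; ring⟩ hl.le
      have hu' : drop u = List.replicate k (1, 2) := by
        obtain ⟨x₁, x₂, x₃, x₄, x₅, x₆⟩ := x
        obtain ⟨v5, v4, v6⟩ := hx
        obtain ⟨l1, l2, l3, l4⟩ := hlx
        simp only at *
        obtain rfl : x₆ = 0 := by omega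
        obtain rfl : x₅ = 0 := by omega
        obtain rfl : x₄ = 0 := by omega
        obtain rfl : x₃ = 0 := by omega
        obtain rfl : x₂ = 0 := by omega
        obtain rfl : x₁ = k := by omega
        rw [hu]
        simp [Blocks.tableau]
      have h4 := dist_eq hn hu' hl
      have h5 := hl.le
      exact ⟨u, hu', by omega⟩

/-- Whether `(p, q, d)` occurs in a component depends on its index `j` only through `p ≤ j`, whence
`ℓ = p`. Ranks adding up to `2s` means opposite `ε₁`-coordinates. -/
theorem isSigmaCheck_iff (hn : 4 ≤ n) {U U' : Btilde n s} {k p q : ℕ} {d : ℤ}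
    (h : TopLabel U k p q d) (hU' : IsHighest n (Set.Icc 2 n) (word U')) :
    IsSigmaCheck (bcVertex U) (bcVertex U') ↔ TopLabel U' (s + p - k) p q (-d) := by
  have hlow : ∀ (r : ℕ) (d : ℤ), Blocks.IsLabel k p q d → (r : ℤ) = s - d →
      IsLeast {j : ℕ | ∃ v' : BCVertex n s, IsVertex j p q r v'} p := by
    intro r d hl hr
    constructor
    · obtain ⟨V, hV⟩ := TopLabel.exists_of_isLabel (s := s) hn (k := p) (p := p) (q := q) (d := d)
        ⟨hl.1, le_rfl, hl.2.2⟩ (hl.2.1.trans h.le)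
      exact ⟨_, (isVertex_iff hn).2 ⟨V, d, rfl, hV, hr⟩⟩
    · rintro j ⟨v', hv'⟩
      obtain ⟨V, e, -, hV, -⟩ := (isVertex_iff hn).1 hv'
      exact hV.isLabel.2.1
  constructor
  · rintro ⟨k', l, p', q', r, r', hv, hl, hrr, hw⟩
    obtain ⟨V, e, hV, hVl, hr⟩ := (isVertex_iff hn).1 hv
    obtain rfl : V = U := ((isTop_iff_of_bcVertex_eq hn hV).1 (IsTop.refl (hVl.isHighest hn))).unique
      hn (IsTop.refl (h.isHighest hn))
    obtain ⟨rfl, rfl, rfl, rfl⟩ := h.label_unique hVl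
    obtain rfl := hl.unique (hlow r d h.isLabel hr)
    obtain ⟨V', e', hV', hVl', hr'⟩ := (isVertex_iff hn).1 hw
    obtain rfl : V' = U' := ((isTop_iff_of_bcVertex_eq hn hV').1
      (IsTop.refl (hVl'.isHighest hn))).unique hn (IsTop.refl hU')
    obtain rfl : e' = -d := by omega
    exact hVl'
  · intro h'
    have h1 := h.le_size
    have h2 := h.le
    have hr : (((s : ℤ) - d).toNat : ℤ) = s - d := by omega
    exact ⟨k, p, p, q, (s - d).toNat, (s + d).toNat, (isVertex_iff hn).2 ⟨U, d, rfl, h, hr⟩,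
      hlow _ d h.isLabel hr, by omega, (isVertex_iff hn).2 ⟨U', -d, rfl, h', by omega⟩⟩

end

open Relation

/-! ### The involution `σ` -/

section

variable {n s : ℕ}

theorem paired_of_applyF (hn : 4 ≤ n) {U U' : Btilde n s} : ∀ {w : List ℕ} {b b' : Btilde n s},
    (∀ i ∈ w, 2 ≤ i ∧ i ≤ n) → applyF w U = some b → applyF w U' = some b' →
      Paired n (Set.Icc 2 n) (word U) (word U') w.length (word b) (word b')
  | [], b, b', _, h, h' => by
    rw [applyF, Option.some.injEq] at h h'
    subst h h'
    exact .base
  | i :: w, b, b', hw, h, h' => by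
    rw [applyF, Option.bind_eq_some_iff] at h h'
    obtain ⟨c, h1, h2⟩ := h
    obtain ⟨c', h3, h4⟩ := h'
    have hi := hw i (by simp)
    exact (paired_of_applyF hn (fun j hj => hw j (by simp [hj])) h1 h3).step hi
      ((classF_eq_some_iff (by omega) ⟨by omega, hi.2⟩).1 h2)
      ((classF_eq_some_iff (by omega) ⟨by omega, hi.2⟩).1 h4)

theorem exists_applyF_of_paired (hn : 4 ≤ n) {U U' : Btilde n s} {m : ℕ} {x x' : List ℤ}
    (h : Paired n (Set.Icc 2 n) (word U) (word U') m x x') :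
    ∃ (b b' : Btilde n s) (w : List ℕ), word b = x ∧ word b' = x' ∧ (∀ i ∈ w, 2 ≤ i ∧ i ≤ n) ∧
      applyF w U = some b ∧ applyF w U' = some b' := by
  induction h with
  | base => exact ⟨U, U', [], rfl, rfl, by simp, rfl, rfl⟩
  | @step d x x' y y' i _ hi h1 h2 ih =>
    obtain ⟨b, b', w, rfl, rfl, hw, ha, ha'⟩ := ih
    have hi1 := Icc_two_subset n hi
    obtain ⟨c, rfl⟩ := exists_word_of_wordF (by omega) hi1 h1
    obtain ⟨c', rfl⟩ := exists_word_of_wordF (by omega) hi1 h2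
    refine ⟨c, c', i :: w, rfl, rfl, ?_, ?_, ?_⟩
    · intro j hj
      rcases List.mem_cons.1 hj with rfl | hj
      · exact hi
      · exact hw j hj
    · rw [applyF, ha]
      exact (classF_eq_some_iff (by omega) hi1).2 h1
    · rw [applyF, ha']
      exact (classF_eq_some_iff (by omega) hi1).2 h2

theorem isSigma_iff (hn : 4 ≤ n) {b b' : Btilde n s} : IsSigma b b' ↔
    ∃ (U U' : Btilde n s) (k p q : ℕ) (d : ℤ) (m : ℕ), TopLabel U k p q d ∧
      TopLabel U' (s + p - k) p q (-d) ∧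
      Paired n (Set.Icc 2 n) (word U) (word U') m (word b) (word b') := by
  constructor
  · rintro ⟨w, U, U', hw, hU, hU', hs, h, h'⟩
    rw [isLeviHighest_iff hn] at hU hU'
    obtain ⟨k, p, q, d, hl⟩ := exists_topLabel hn hU
    exact ⟨U, U', k, p, q, d, _, hl, (isSigmaCheck_iff hn hl hU').1 hs, paired_of_applyF hn hw h h'⟩
  · rintro ⟨U, U', k, p, q, d, m, hl, hl', hp⟩
    obtain ⟨c, c', w, hc, hc', hw, ha, ha'⟩ := exists_applyF_of_paired hn hp
    obtain rfl := word_injective hc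
    obtain rfl := word_injective hc'
    exact ⟨w, U, U', hw, (isLeviHighest_iff hn).2 (hl.isHighest hn),
      (isLeviHighest_iff hn).2 (hl'.isHighest hn), (isSigmaCheck_iff hn hl (hl'.isHighest hn)).2 hl',
      ha, ha'⟩

theorem IsSigma.symm (hn : 4 ≤ n) {b b' : Btilde n s} (h : IsSigma b b') : IsSigma b' b := by
  rw [isSigma_iff hn] at *
  obtain ⟨U, U', k, p, q, d, m, hl, hl', hp⟩ := h
  refine ⟨U', U, s + p - k, p, q, -d, m, hl', ?_, hp.symm⟩
  have h1 := hl.isLabel.2.1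
  have h2 := hl.le
  rwa [show s + p - (s + p - k) = k by omega, neg_neg]

theorem TopLabel.good (hn : 4 ≤ n) {U U' : Btilde n s} {k k' p q : ℕ} {d d' : ℤ}
    (h : TopLabel U k p q d) (h' : TopLabel U' k' p q d') (m : ℕ) :
    Paired.Good n (Set.Icc 2 n) (word U) (word U') m :=
  Paired.good hn (Icc_two_subset n) (h.isHighest hn) (h'.isHighest hn)
    (fun _ hi => h.wordPhi_eq hn h' hi) m

theorem TopLabel.exists_sigma (hn : 4 ≤ n) {U : Btilde n s} {k p q : ℕ} {d : ℤ}
    (h : TopLabel U k p q d) : ∃ U' : Btilde n s, TopLabel U' (s + p - k) p q (-d) := by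
  have h1 := h.le
  obtain ⟨h2, h3, α, h4, h5⟩ := h.isLabel
  -- Replacing `α` by `p - q - α` negates `2α - (p - q)`.
  exact TopLabel.exists_of_isLabel hn ⟨h2, by omega, p - q - α, by omega, by omega⟩ (by omega)

theorem exists_isSigma (hn : 4 ≤ n) (b : Btilde n s) : ∃ b', IsSigma b b' := by
  obtain ⟨U, hU⟩ := exists_isTop hn b
  obtain ⟨k, p, q, d, hl⟩ := exists_topLabel hn hU.2
  obtain ⟨U', hl'⟩ := hl.exists_sigma hn
  obtain ⟨m, -, x', hx'⟩ := Paired.exists_of_raises (u' := word U') hn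
    (d := totalHeight n (word b)) (fun m _ => hl.good hn hl' m) hU.1 (by omega)
  obtain ⟨c, c', -, hc, hc', -⟩ := exists_applyF_of_paired hn hx'
  exact ⟨c', (isSigma_iff hn).2 ⟨U, U', k, p, q, d, m, hl, hl', hc' ▸ hx'⟩⟩

theorem IsSigma.unique (hn : 4 ≤ n) {b b' b'' : Btilde n s} (h : IsSigma b b')
    (h' : IsSigma b b'') : b' = b'' := by
  rw [isSigma_iff hn] at h h'
  obtain ⟨U, U', k, p, q, d, m, hl, hl', hp⟩ := h
  obtain ⟨V, V', k', p', q', d', m', hk, hk', hq⟩ := h'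
  obtain rfl : U = V := IsTop.unique hn (T := b) ⟨hp.raises hn, hl.isHighest hn⟩
    ⟨hq.raises hn, hk.isHighest hn⟩
  obtain ⟨rfl, rfl, rfl, rfl⟩ := hl.label_unique hk
  obtain rfl := hl'.unique hk'
  exact word_injective ((hl.good hn hl' m _ _ hp).2 _ _ hq)

theorem isSigma_sigma (hn : 4 ≤ n) (b : Btilde n s) : IsSigma b (sigma b) := by
  have h := exists_isSigma hn b
  unfold sigma
  rw [dif_pos h]
  exact h.choose_spec

theorem sigma_sigma (hn : 4 ≤ n) (b : Btilde n s) : sigma (sigma b) = b :=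
  (isSigma_sigma hn (sigma b)).unique hn ((isSigma_sigma hn b).symm hn)

/-- What is needed about `σ`: it preserves the structure for the colours `2, …, n` and moves
components and the `ε₁`-coordinate of the weight as prescribed. -/
theorem sigma_spec (hn : 4 ≤ n) (b : Btilde n s) : ∃ k p : ℕ, p ≤ k ∧ k ≤ s ∧ compIndex b = k ∧
    compIndex (sigma b) = s + p - k ∧ coord (word (sigma b)) 1 = -coord (word b) 1 ∧
    coord (word (sigma b)) 2 = coord (word b) 2 ∧
    (∀ i ∈ Set.Icc 2 n, wordPhi n i (word (sigma b)) = wordPhi n i (word b)) ∧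
    ∃ U, IsTop b U ∧ wordPhi n 1 (word U) = k - p := by
  obtain ⟨U, U', k, p, q, d, m, hl, hl', hp⟩ := (isSigma_iff hn).1 (isSigma_sigma hn b)
  have hU : IsTop b U := ⟨hp.raises hn, hl.isHighest hn⟩
  have hU' : IsTop (sigma b) U' := ⟨hp.symm.raises hn, hl'.isHighest hn⟩
  refine ⟨k, p, hl.isLabel.2.1, hl.le, ?_, ?_, ?_, ?_, ?_, U, hU, hl.wordPhi_one hn⟩
  · rw [← hU.compIndex hn, hl.compIndex_eq]
  · rw [← hU'.compIndex hn, hl'.compIndex_eq]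
  · rw [← hU'.coord_one hn, ← hU.coord_one hn, hl.coord_eq le_rfl, hl'.coord_eq le_rfl]
    simp
  · have key : ∀ m x x', Paired n (Set.Icc 2 n) (word U) (word U') m x x' →
        coord x' 2 = coord x 2 := by
      intro m x x' h
      induction h with
      | base => rw [hl.coord_eq (by omega), hl'.coord_eq (by omega)]; simp
      | step _ hi h1 h2 ih =>
        rw [coord_of_wordF (Icc_two_subset n hi) h1, coord_of_wordF (Icc_two_subset n hi) h2, ih]
    exact key m _ _ hp
  · exact fun i hi => ((hl.good hn hl' m _ _ hp).1 i hi).1.symm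

end

open Relation

/-! ### Lower bounds for string lengths -/

/-- Only colour 2 matters: it turns `2` into `3`, which removes an `ε_1`, or `3̄` into `2̄`, which
adds a `φ_1`. Neither can decrease `φ_1` of the word. -/
theorem wordPhi_one_le_of_wordF {n j : ℕ} (hn : 4 ≤ n) (hj : 2 ≤ j ∧ j ≤ n) {w v : List ℤ}
    (h : wordF n j w = some v) : wordPhi n 1 w ≤ wordPhi n 1 v := by
  induction w generalizing v with
  | nil => simp [wordF] at h
  | cons x w ih =>
    simp only [wordF] at h
    split_ifs at h with hc
    · obtain ⟨y, hy, rfl⟩ := Option.map_eq_some_iff.1 h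
      have h1 := arrow_cases (n := n) (i := j) ⟨by omega, hj.2⟩
      have h2 : 2 ≤ arrowSource n j := by unfold arrowSource; split_ifs <;> omega
      have hs : arrowSource n 1 = 1 := by unfold arrowSource; grind
      have ht : arrowTarget n 1 = 2 := by unfold arrowTarget; grind
      rw [letterF_eq (by omega) hj.2] at hy
      have hp := fun x => letterPhi_eq (n := n) (i := 1) (x := x) (by omega)
      have he := fun x => letterEps_eq (n := n) (i := 1) (x := x) (by omega)
      rw [hs, ht] at hp he
      rw [wordPhi, wordPhi]
      have h3 : letterPhi n 1 x ≤ letterPhi n 1 y ∧ letterEps n 1 y ≤ letterEps n 1 x := by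
        rw [hp, hp, he, he]
        split_ifs at hy with h4 h4 <;> rw [Option.some.injEq] at hy <;> constructor <;>
          split_ifs <;> omega
      omega
    · obtain ⟨u, hu, rfl⟩ := Option.map_eq_some_iff.1 h
      have := ih hu
      rw [wordPhi, wordPhi]
      omega

theorem wordPhi_one_le_of_raises {n : ℕ} (hn : 4 ≤ n) {w v : List ℤ}
    (h : ReflTransGen (Raises n (Set.Icc 2 n)) w v) : wordPhi n 1 v ≤ wordPhi n 1 w := by
  induction h with
  | refl => rfl
  | tail _ hs ih =>
    obtain ⟨i, hi, he⟩ := hs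
    exact (wordPhi_one_le_of_wordF hn hi ((wordE_eq_some_iff (by omega)).1 he)).trans ih

/-- One-row tableaux, as words. -/
def IsRow (n : ℕ) (Y : List ℤ) : Prop := (∀ y ∈ Y, IsLetter n y) ∧ Y.Pairwise (LetterLE n)

theorem sum_map_nonpos {g : ℤ → ℤ} {Y : List ℤ} (h : ∀ y ∈ Y, g y ≤ 0) : (Y.map g).sum ≤ 0 := by
  induction Y with
  | nil => simp
  | cons y Y ih =>
    rw [List.map_cons, List.sum_cons]
    have := ih fun z hz => h z (by simp [hz])
    have := h y (by simp)
    omega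

/-- A letter with `ε_i ≠ 0` may cancel one `φ_i` to its right. Either this is paid for by `g y ≤
-1`, or it is harmless because no letter from `y` on has positive `g`. -/
theorem sum_le_wordPhi {n i : ℕ} {g : ℤ → ℤ} (h0 : ∀ y, letterEps n i y = 0 → g y ≤ letterPhi n i y)
    (h1 : ∀ y, IsLetter n y → letterEps n i y ≠ 0 →
      g y ≤ -1 ∨ (g y ≤ 0 ∧ ∀ z, IsLetter n z → LetterLE n y z → g z ≤ 0)) {Y : List ℤ}
    (hY : IsRow n Y) : (Y.map g).sum ≤ wordPhi n i Y := by
  induction Y with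
  | nil => simp [wordPhi]
  | cons y Y ih =>
    obtain ⟨hl, hr⟩ := hY
    rw [List.pairwise_cons] at hr
    have hY' : ∀ z ∈ Y, IsLetter n z := fun z hz => hl z (by simp [hz])
    have ih := ih ⟨hY', hr.2⟩
    rw [List.map_cons, List.sum_cons, wordPhi]
    have he := letterEps_le_one n i y
    by_cases h : letterEps n i y = 0
    · have := h0 y h
      rw [h]
      push_cast
      omega
    · rcases h1 y (hl y (by simp)) h with h2 | ⟨h2, h3⟩
      · omega
      · have := sum_map_nonpos (Y := Y) fun x hx => h3 x (hY' x hx) (hr.1 x hx)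
        omega

/-- A row without `1` and `1̄` is bounded by the level of its string lengths: the contribution of
a letter to the bound for `φ_i`. -/
def contribution (n i : ℕ) (y : ℤ) : ℤ :=
  if i = 1 then (if y = -2 then 1 else if y = 2 then -1 else 0)
  else if i = n then (if y = n - 1 ∨ y = n then 1 else 0)
  else if i + 1 = n then (if y = n - 1 ∨ y = -n then 1 else 0)
  else if y = i then 2 else if y = -(i + 1) then 1 else if y = i + 1 then -1 else 0

/-- The coefficient of `h_i` in the canonical central element. -/
def mark (n i : ℕ) : ℤ := if 2 ≤ i ∧ i + 2 ≤ n then 2 else 1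

/-- For `i < n - 1` a row lists the relevant letters in the order `i`, `i+1`, `(i+1)‾`, `ī`, so
`φ_i` is the number of `i` plus the surplus of `(i+1)‾` over `i+1`. For a colour of mark two, the
bound by this expression is added to the bound by the number of `i` alone. For the colours `n - 1`
and `n` one uses that `n` and `n̄` do not both occur in a row. -/
theorem sum_contribution_le {n i : ℕ} (hn : 4 ≤ n) (hi : 1 ≤ i ∧ i ≤ n) {Y : List ℤ}
    (hY : IsRow n Y) : (Y.map (contribution n i)).sum ≤ mark n i * wordPhi n i Y := by
  have hp := fun x => letterPhi_eq (n := n) (i := i) (x := x) hi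
  have he := fun x => letterEps_eq (n := n) (i := i) (x := x) hi
  by_cases h2 : 2 ≤ i ∧ i + 2 ≤ n
  · have hs : arrowSource n i = i := by unfold arrowSource; grind
    have ht : arrowTarget n i = i + 1 := by unfold arrowTarget; grind
    rw [hs, ht] at hp he
    have e1 := sum_le_wordPhi (n := n) (i := i) (g := fun y => if y = i then 1 else 0)
      (by intro y h; rw [he] at h; rw [hp]; grind)
      (by
        intro y hy h
        rw [he] at h
        right
        simp only [isLetter_iff, letterLE_iff] at *
        grind) hY
    have e2 := sum_le_wordPhi (n := n) (i := i)
      (g := fun y => if y = i then 1 else if y = -(i + 1) then 1 else if y = i + 1 then -1 else 0)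
      (by intro y h; rw [he] at h; rw [hp]; grind)
      (by
        intro y hy h
        rw [he] at h
        simp only [isLetter_iff, letterLE_iff] at *
        grind) hY
    have e3 : contribution n i = fun y => (if y = (i : ℤ) then 1 else 0) +
        (if y = (i : ℤ) then 1 else if y = -((i : ℤ) + 1) then 1 else if y = (i : ℤ) + 1 then -1
          else 0) := by
      funext y
      unfold contribution
      grind
    rw [e3, List.sum_map_add, mark, if_pos h2]
    linarith
  · rw [mark, if_neg h2, one_mul]
    refine sum_le_wordPhi ?_ ?_ hY
    · intro y h
      rw [he] at h
      rw [hp]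
      unfold contribution arrowSource arrowTarget at *
      grind
    · intro y hy h
      rw [he] at h
      have : i = 1 ∨ i = n ∨ i + 1 = n := by omega
      rcases this with rfl | rfl | rfl
      · have hs : arrowSource n 1 = 1 := by unfold arrowSource; grind
        have ht : arrowTarget n 1 = 2 := by unfold arrowTarget; grind
        rw [hs, ht] at h
        simp only [isLetter_iff, letterLE_iff, contribution] at *
        grind
      · have hs : arrowSource i i = i - 1 := by unfold arrowSource; grind
        have ht : arrowTarget i i = -i := by unfold arrowTarget; grind
        rw [hs, ht] at h
        simp only [isLetter_iff, letterLE_iff, contribution] at *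
        grind
      · have hs : arrowSource (i + 1) i = i := by unfold arrowSource; grind
        have ht : arrowTarget (i + 1) i = i + 1 := by unfold arrowTarget; grind
        rw [hs, ht] at h
        simp only [isLetter_iff, letterLE_iff, contribution] at *
        grind

/-- A letter `j < n - 1` gets `2` from colour `j` and `-1` from `j - 1`. The letter `n - 1` gets `1
+ 1 - 1` from the colours `n`, `n - 1`, `n - 2`, and `n` gets `1` from colour `n`. A letter `j̄`
gets `1` from colour `j - 1`. -/
theorem sum_contribution {n : ℕ} (hn : 4 ≤ n) {y : ℤ} (hy : IsLetter n y) (h1 : y ≠ 1)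
    (h2 : y ≠ -1) : ∑ i ∈ Finset.range n, contribution n (i + 1) y = 1 := by
  rw [isLetter_iff] at hy
  have key : ∀ a b c : ℕ, ∀ x z w : ℤ, a < n → b < n → c < n → x + z + w = 1 →
      (∀ i < n, contribution n (i + 1) y = (if i = a then x else 0) + (if i = b then z else 0) +
        (if i = c then w else 0)) → ∑ i ∈ Finset.range n, contribution n (i + 1) y = 1 := by
    intro a b c x z w ha hb hc hx h
    rw [Finset.sum_congr rfl fun i hi => h i (Finset.mem_range.1 hi)]
    simp [Finset.sum_add_distrib, ha, hb, hc, hx]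
  rcases lt_or_ge y 0 with hneg | hpos
  -- The index `i` stands for the colour `i + 1`, so colour `j - 1` has index `j - 2`.
  · refine key (-y).toNat.pred.pred 0 0 1 0 0 (by simp; omega) (by omega) (by omega) (by omega) ?_
    intro i hi
    unfold contribution
    push_cast
    simp only [Nat.pred_eq_sub_one]
    split_ifs <;> omega
  · by_cases hn1 : y = n
    · refine key (n - 1) 0 0 1 0 0 (by omega) (by omega) (by omega) (by omega) ?_
      intro i hi
      unfold contribution
      push_cast
      split_ifs <;> omega
    by_cases hn2 : y = n - 1
    · refine key (n - 1) (n - 2) (n - 3) 1 1 (-1) (by omega) (by omega) (by omega) (by omega) ?_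
      intro i hi
      unfold contribution
      push_cast
      split_ifs <;> omega
    · refine key (y.toNat - 1) (y.toNat - 2) 0 2 (-1) 0 (by omega) (by omega) (by omega) (by omega) ?_
      intro i hi
      unfold contribution
      push_cast
      split_ifs <;> omega

theorem length_le_sum_mark {n : ℕ} (hn : 4 ≤ n) {Y : List ℤ} (hY : IsRow n Y) (h1 : (1 : ℤ) ∉ Y)
    (h2 : (-1 : ℤ) ∉ Y) :
    (Y.length : ℤ) ≤ ∑ i ∈ Finset.range n, mark n (i + 1) * wordPhi n (i + 1) Y := by
  have e : (Y.length : ℤ) = ∑ i ∈ Finset.range n, (Y.map (contribution n (i + 1))).sum := by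
    have hl := hY.1
    clear hY
    induction Y with
    | nil => simp
    | cons y Y ih =>
      simp only [List.mem_cons, not_or] at h1 h2
      simp only [List.map_cons, List.sum_cons, Finset.sum_add_distrib]
      rw [sum_contribution hn (hl y (by simp)) (Ne.symm h1.1) (Ne.symm h2.1),
        ← ih h1.2 h2.2 fun z hz => hl z (by simp [hz])]
      push_cast [List.length_cons]
      ring
  rw [e]
  exact Finset.sum_le_sum fun i hi => sum_contribution_le hn
    ⟨by omega, by have := Finset.mem_range.1 hi; omega⟩ hY

open Relation

/-! ### The two-row model of a component -/

theorem mem_of_wordF {n i : ℕ} {w v : List ℤ} (h : wordF n i w = some v) {z : ℤ} (hz : z ∈ v) :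
    z ∈ w ∨ ∃ y ∈ w, letterF n i y = some z := by
  induction w generalizing v with
  | nil => simp [wordF] at h
  | cons x w ih =>
    simp only [wordF] at h
    split_ifs at h with hc
    · obtain ⟨y, hy, rfl⟩ := Option.map_eq_some_iff.1 h
      rcases List.mem_cons.1 hz with rfl | hz
      · exact .inr ⟨x, by simp, hy⟩
      · exact .inl (by simp [hz])
    · obtain ⟨u, hu, rfl⟩ := Option.map_eq_some_iff.1 h
      rcases List.mem_cons.1 hz with rfl | hz
      · exact .inl (by simp)
      · rcases ih hu hz with h1 | ⟨y, hy, h1⟩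
        · exact .inl (by simp [h1])
        · exact .inr ⟨y, by simp [hy], h1⟩

section Letters

variable {n i : ℕ} {y z : ℤ}

theorem letterF_cases (hi : 1 ≤ i ∧ i ≤ n) (h : letterF n i y = some z) :
    (y = arrowSource n i ∧ z = arrowTarget n i) ∨
      (y = -arrowTarget n i ∧ z = -arrowSource n i) := by
  rw [letterF_eq hi.1 hi.2] at h; grind

theorem IsLetter.letterF (hn : 2 ≤ n) (hi : 1 ≤ i ∧ i ≤ n) (h : letterF n i y = some z) :
    IsLetter n z := by
  have h1 := arrow_cases hi
  have h2 := letterF_cases hi h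
  have h3 : 1 ≤ arrowSource n i := by unfold arrowSource; split_ifs <;> omega
  rw [isLetter_iff]
  omega

theorem LetterLE.of_letterF (hn : 2 ≤ n) (hi : 1 ≤ i ∧ i ≤ n) (h : letterF n i y = some z) :
    LetterLE n y z := by
  have h1 := arrow_cases hi
  have h2 := letterF_cases hi h
  have h3 : 1 ≤ arrowSource n i := by unfold arrowSource; split_ifs <;> omega
  rw [letterLE_iff]
  omega

theorem LetterLE.letterF_le (hn : 2 ≤ n) (hi : 1 ≤ i ∧ i ≤ n) {y' : ℤ}
    (h : letterF n i y = some y') (hz : IsLetter n z) (hyz : LetterLE n y z)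
    (h0 : letterPhi n i z = 0) : LetterLE n y' z := by
  have h1 := arrow_cases hi
  have h2 := letterF_cases hi h
  have h3 : 1 ≤ arrowSource n i := by unfold arrowSource; split_ifs <;> omega
  rw [letterPhi_eq_zero_iff, letterF_eq_none_iff hi] at h0
  rw [letterLE_iff] at *
  rw [isLetter_iff] at hz
  omega

end Letters

/-- If `f̃_i` acts on a letter, the next letter has `φ_i = 0`, so it differs from the old letter and
is at least the new one. The second conclusion allows a letter to be put in front in the induction.
-/
theorem IsRow.wordF {n i : ℕ} (hn : 2 ≤ n) (hi : 1 ≤ i ∧ i ≤ n) {Y Z : List ℤ} (hY : IsRow n Y)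
    (h : wordF n i Y = some Z) :
    IsRow n Z ∧ ∀ l, (∀ y ∈ Y, LetterLE n l y) → ∀ z ∈ Z, LetterLE n l z := by
  induction Y generalizing Z with
  | nil => simp [KRCrystal.wordF] at h
  | cons y Y ih =>
    obtain ⟨hl, hr⟩ := hY
    rw [List.pairwise_cons] at hr
    have hY' : ∀ z ∈ Y, IsLetter n z := fun z hz => hl z (by simp [hz])
    simp only [KRCrystal.wordF] at h
    split_ifs at h with hc
    · obtain ⟨y', hy, rfl⟩ := Option.map_eq_some_iff.1 h
      have hle : ∀ z ∈ Y, LetterLE n y' z := by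
        cases Y with
        | nil => simp
        | cons z Y =>
          have h1 := letterPhi_add_letterEps_le n i hn y
          have h2 : letterPhi n i y = 1 := letterPhi_eq_one_iff.2 ⟨y', hy⟩
          rw [wordPhi] at hc
          have h3 := LetterLE.letterF_le hn hi hy (hY' z (by simp)) (hr.1 z (by simp)) (by omega)
          intro x hx
          rcases List.mem_cons.1 hx with rfl | hx
          · exact h3
          · exact h3.trans ((List.pairwise_cons.1 hr.2).1 x hx)
      refine ⟨⟨?_, List.pairwise_cons.2 ⟨hle, hr.2⟩⟩, ?_⟩
      · intro z hz
        rcases List.mem_cons.1 hz with rfl | hz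
        · exact IsLetter.letterF hn hi hy
        · exact hY' z hz
      · intro l hl z hz
        rcases List.mem_cons.1 hz with rfl | hz
        · exact (hl y (by simp)).trans (LetterLE.of_letterF hn hi hy)
        · exact hl z (by simp [hz])
    · obtain ⟨u, hu, rfl⟩ := Option.map_eq_some_iff.1 h
      obtain ⟨h1, h2⟩ := ih ⟨hY', hr.2⟩ hu
      refine ⟨⟨?_, List.pairwise_cons.2 ⟨h2 y hr.1, h1.2⟩⟩, ?_⟩
      · intro z hz
        rcases List.mem_cons.1 hz with rfl | hz
        · exact hl _ (by simp)
        · exact h1.1 z hz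
      · intro l hl z hz
        rcases List.mem_cons.1 hz with rfl | hz
        · exact hl _ (by simp)
        · exact h2 l (fun y hy => hl y (by simp [hy])) z hz

theorem letterPhi_one {n : ℕ} (hn : 4 ≤ n) (y : ℤ) :
    letterPhi n 1 y = if y = 1 ∨ y = -2 then 1 else 0 := by
  have hs : arrowSource n 1 = 1 := by unfold arrowSource; grind
  have ht : arrowTarget n 1 = 2 := by unfold arrowTarget; grind
  rw [letterPhi_eq ⟨le_rfl, by omega⟩, hs, ht]

theorem letterEps_one {n : ℕ} (hn : 4 ≤ n) (y : ℤ) :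
    letterEps n 1 y = if y = 2 ∨ y = -1 then 1 else 0 := by
  have hs : arrowSource n 1 = 1 := by unfold arrowSource; grind
  have ht : arrowTarget n 1 = 2 := by unfold arrowTarget; grind
  rw [letterEps_eq ⟨le_rfl, by omega⟩, hs, ht]

/-- In such a row each `2` precedes each `2̄`. If `φ_1 > 0`, the `2̄` outnumber the `2`, so every
`2` is cancelled. -/
theorem IsRow.wordEps_one_eq_zero {n : ℕ} (hn : 4 ≤ n) {Y : List ℤ} (hY : IsRow n Y)
    (h1 : (1 : ℤ) ∉ Y) (h2 : (-1 : ℤ) ∉ Y) (h : 0 < wordPhi n 1 Y) : wordEps n 1 Y = 0 := by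
  induction Y with
  | nil => rfl
  | cons y Y ih =>
    obtain ⟨hl, hr⟩ := hY
    rw [List.pairwise_cons] at hr
    simp only [List.mem_cons, not_or] at h1 h2
    have hY' : IsRow n Y := ⟨fun z hz => hl z (by simp [hz]), hr.2⟩
    have ih := ih hY' h1.2 h2.2
    rw [wordPhi, letterPhi_one hn, letterEps_one hn] at h
    rw [wordEps, letterEps_one hn]
    by_cases hy : y = -2
    · subst hy
      have : wordEps n 1 Y = 0 := wordEps_eq_zero_of_forall fun z hz => by
        rw [letterEps_one hn, if_neg]
        rintro (rfl | rfl)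
        · have := hr.1 2 hz
          rw [letterLE_iff] at this
          omega
        · exact h2.2 hz
      simp [this]
    · rw [if_neg (by omega)] at h
      rw [ih (by omega)]
      omega

theorem IsRow.wordPhi_one_pos {n : ℕ} (hn : 4 ≤ n) {X : List ℤ} (hX : IsRow n X)
    (h1 : (1 : ℤ) ∈ X) : 0 < wordPhi n 1 X := by
  cases X with
  | nil => simp at h1
  | cons x X =>
    have hx : x = 1 := by
      rcases List.mem_cons.1 h1 with h | h
      · exact h.symm
      · have h2 := (List.pairwise_cons.1 hX.2).1 1 h
        have h3 := hX.1 x (by simp)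
        rw [letterLE_iff] at h2
        rw [isLetter_iff] at h3
        omega
    rw [wordPhi, letterPhi_one hn, if_pos (.inl hx)]
    omega

/-- Words `Y X` made of two rows, such as occur in the component of `2^k 1^k`. -/
def IsRowPair (n k : ℕ) (w : List ℤ) : Prop :=
  ∃ Y X : List ℤ, w = Y ++ X ∧ Y.length = k ∧ IsRow n Y ∧ IsRow n X ∧ (1 : ℤ) ∉ Y ∧
    ((1 : ℤ) ∉ X ∨ (-1 : ℤ) ∉ Y)

theorem letterF_ne_one {n i : ℕ} (hn : 4 ≤ n) (hi : 1 ≤ i ∧ i ≤ n) {y : ℤ} :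
    letterF n i y ≠ some 1 := by
  intro h
  have h1 := arrow_cases hi
  have h2 := letterF_cases hi h
  have h3 : 1 ≤ arrowSource n i := by unfold arrowSource; split_ifs <;> omega
  omega

/-- A letter `1̄` enters `Y` only when `f̃_1` acts on a `2̄` in `Y`. If `Y` had no `1̄` before, then
`ε_1(Y) = 0` there, so the tensor rule requires `φ_1(X) = 0`, and `X` contains no `1`. Lowering
never creates a `1`. -/
theorem IsRowPair.wordF {n k i : ℕ} (hn : 4 ≤ n) (hi : 1 ≤ i ∧ i ≤ n) {w v : List ℤ}
    (hw : IsRowPair n k w) (h : wordF n i w = some v) : IsRowPair n k v := by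
  obtain ⟨Y, X, rfl, hk, hY, hX, h1, h2⟩ := hw
  have hone : ∀ w v : List ℤ, KRCrystal.wordF n i w = some v → (1 : ℤ) ∉ w → (1 : ℤ) ∉ v := by
    intro w v h h1 h2
    rcases mem_of_wordF h h2 with h3 | ⟨y, -, h3⟩
    · exact h1 h3
    · exact letterF_ne_one hn hi h3
  rw [wordF_append] at h
  split_ifs at h with hc
  · obtain ⟨Z, hZ, rfl⟩ := Option.map_eq_some_iff.1 h
    refine ⟨Z, X, rfl, ?_, (hY.wordF (by omega) hi hZ).1, hX, hone _ _ hZ h1, ?_⟩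
    · rw [← hk, (wordF_some (by omega) hZ).2.2.2]
    · by_cases hX1 : (1 : ℤ) ∈ X
      swap
      · exact .inl hX1
      have h2 := h2.resolve_left (not_not.2 hX1)
      right
      intro hm
      obtain ⟨y, -, hy⟩ := (mem_of_wordF hZ hm).resolve_left h2
      have h3 := arrow_cases hi
      have h4 := letterF_cases hi hy
      have h5 : 1 ≤ arrowSource n i := by unfold arrowSource; split_ifs <;> omega
      have h6 : arrowSource n i = 1 := by omega
      have hi1 : i = 1 := by
        unfold arrowSource at h6
        split_ifs at h6 <;> omega
      subst hi1
      have h7 := (wordF_some (by omega) hZ).1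
      rw [hY.wordEps_one_eq_zero hn h1 h2 (by omega)] at hc
      have := hX.wordPhi_one_pos hn hX1
      omega
  · obtain ⟨Z, hZ, rfl⟩ := Option.map_eq_some_iff.1 h
    exact ⟨Y, Z, rfl, hk, hY, (hX.wordF (by omega) hi hZ).1, h1, h2.imp_left (hone _ _ hZ)⟩

/-- If `Y` contained `1̄`, there would be no `1` in either row and the `ε₁`-coordinate would be
negative. So `Y` contains neither letter, and the bound for a single row applies to it. -/
theorem IsRowPair.level {n k : ℕ} (hn : 4 ≤ n) {w : List ℤ} (hw : IsRowPair n k w)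
    (hc : 0 ≤ coord w 1) :
    (k : ℤ) ≤ ∑ i ∈ Finset.range n, mark n (i + 1) * wordPhi n (i + 1) w := by
  obtain ⟨Y, X, rfl, rfl, hY, hX, h1, h2⟩ := hw
  have h3 : (-1 : ℤ) ∉ Y := by
    intro h3
    have h4 := h2.resolve_right (not_not.2 h3)
    have h5 := List.count_pos_iff.2 h3
    have h6 := List.count_eq_zero_of_not_mem h4
    have h7 := List.count_eq_zero_of_not_mem h1
    unfold coord at hc
    simp only [List.count_append, Nat.cast_one, h6, h7] at hc
    push_cast at hc
    omega
  refine (length_le_sum_mark hn hY h1 h3).trans (Finset.sum_le_sum fun i _ => ?_)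
  have : wordPhi n (i + 1) Y ≤ wordPhi n (i + 1) (Y ++ X) := by rw [wordPhi_append]; omega
  have h0 : 0 ≤ mark n (i + 1) := by unfold mark; split_ifs <;> omega
  exact mul_le_mul_of_nonneg_left (by exact_mod_cast this) h0

/-- The highest weight word of the two-row model. -/
def rowWord (k : ℕ) : List ℤ := List.replicate k 2 ++ List.replicate k 1

theorem isRowPair_rowWord {n : ℕ} (hn : 4 ≤ n) (k : ℕ) : IsRowPair n k (rowWord k) := by
  have hrow : ∀ a : ℤ, IsLetter n a → IsRow n (List.replicate k a) := fun a ha =>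
    ⟨fun y hy => by rw [List.eq_of_mem_replicate hy]; exact ha,
      List.pairwise_replicate.2 (.inr (.refl n a))⟩
  exact ⟨_, _, rfl, by simp, hrow 2 (isLetter_iff.2 (by omega)), hrow 1 (isLetter_iff.2 (by omega)),
    fun h => by simpa using List.eq_of_mem_replicate h,
    .inr fun h => by simpa using List.eq_of_mem_replicate h⟩

theorem isHighest_rowWord {n : ℕ} (hn : 4 ≤ n) (k : ℕ) :
    IsHighest n (Set.Icc 1 n) (rowWord k) := by
  intro i hi
  rw [wordE_eq_none_iff, rowWord, wordEps_append]
  have h1 := arrow_cases hi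
  have h2 : wordEps n i (List.replicate k 1) = 0 := wordEps_eq_zero_of_forall fun y hy => by
    rw [List.eq_of_mem_replicate hy, letterEps_eq hi, if_neg]
    have h3 : 1 ≤ arrowSource n i := by unfold arrowSource; have := hi.1; split_ifs <;> omega
    omega
  by_cases hi1 : i = 1
  · subst hi1
    have h3 : ∀ m, wordEps n 1 (List.replicate m 2) = m ∧ wordPhi n 1 (List.replicate m 2) = 0 := by
      intro m
      induction m with
      | zero => simp [wordEps, wordPhi]
      | succ m ih =>
        simp [List.replicate_succ, wordEps, wordPhi, ih, letterEps_one hn, letterPhi_one hn]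
    have h4 : ∀ m, wordPhi n 1 (List.replicate m 1) = m := by
      intro m
      induction m with
      | zero => simp [wordPhi]
      | succ m ih =>
        simp [List.replicate_succ, wordPhi, ih, letterEps_one hn, letterPhi_one hn]
        omega
    rw [h2, (h3 k).1, h4]
    omega
  · have h3 : wordEps n i (List.replicate k 2) = 0 := wordEps_eq_zero_of_forall fun y hy => by
      have h4 : 2 ≤ arrowSource n i := by unfold arrowSource; have := hi.1; split_ifs <;> omega
      rw [List.eq_of_mem_replicate hy, letterEps_eq hi, if_neg]
      omega
    omega

/-- In a component `B(kϖ₂)` the string lengths of an element whose weight has nonnegative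
`ε₁`-coordinate add up to at least `k`. -/
theorem compIndex_le_sum_mark {n s : ℕ} (hn : 4 ≤ n) (T : Btilde n s) (hc : 0 ≤ coord (word T) 1) :
    (compIndex T : ℤ) ≤ ∑ i ∈ Finset.range n, mark n (i + 1) * wordPhi n (i + 1) (word T) := by
  obtain ⟨u, hr, hu⟩ := exists_highest hn (Set.Icc 1 n) (word T)
  obtain ⟨U, rfl⟩ := exists_word_of_raises hn subset_rfl hr
  obtain ⟨k, p, q, d, x, hx, he, hl⟩ := exists_topLabel hn fun i hi => hu i (Icc_two_subset n hi)
  have hx1 : x = ⟨x.x₁, 0, 0, 0, 0, 0⟩ := Blocks.eq_of_wordE_one hn hx <| by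
    rw [← he]
    exact hu 1 ⟨le_rfl, by omega⟩
  have hd : drop U = List.replicate x.x₁ (1, 2) := by
    rw [he, hx1]
    simp [Blocks.tableau]
  have hk : compIndex T = x.x₁ := by
    have h1 := length_of_raises hn hr
    rw [length_word, length_word] at h1
    have h2 : compIndex U = x.x₁ := by rw [compIndex, hd, List.length_replicate]
    omega
  rw [hk]
  set k := x.x₁
  -- The column word of `(1, 2)^k` is a rearrangement of `rowWord k`. Equal weights of two highest
  -- weight words give equal `φ_i`, which makes the components isomorphic.
  have hcoord : ∀ j, coord (word U) j = coord (rowWord k) j := by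
    intro j
    unfold coord word rowWord
    rw [hd]
    simp only [Blocks.count_colWord_replicate, List.count_append, List.count_replicate, beq_iff_eq]
    push_cast
    split_ifs <;> ring
  have hphi : ∀ i ∈ Set.Icc 1 n, wordPhi n i (word U) = wordPhi n i (rowWord k) := by
    intro i hi
    have h1 := wordPhi_sub_wordEps_eq_coord hi (by omega) (word U)
    have h2 := wordPhi_sub_wordEps_eq_coord hi (by omega) (rowWord k)
    rw [(wordE_eq_none_iff _).1 (hu i hi)] at h1
    rw [(wordE_eq_none_iff _).1 (isHighest_rowWord hn k i hi)] at h2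
    simp only [hcoord] at h1
    omega
  have hgood := Paired.good hn subset_rfl hu (isHighest_rowWord hn k) hphi
  obtain ⟨m, -, x', hx'⟩ := Paired.exists_of_raises (u' := rowWord k) hn
    (d := totalHeight n (word T)) (fun m _ => hgood m) hr (by omega)
  have key : ∀ m y y', Paired n (Set.Icc 1 n) (word U) (rowWord k) m y y' →
      coord y' 1 = coord y 1 ∧ IsRowPair n k y' := by
    intro m y y' h
    induction h with
    | base => exact ⟨(hcoord 1).symm, isRowPair_rowWord hn k⟩
    | step _ hi h1 h2 ih =>
      rw [coord_of_wordF hi h1, coord_of_wordF hi h2, ih.1]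
      exact ⟨rfl, ih.2.wordF hn hi h2⟩
  obtain ⟨h1, h2⟩ := key m _ _ hx'
  refine (h2.level hn (by omega)).trans (le_of_eq (Finset.sum_congr rfl fun i hi => ?_))
  rw [((hgood m _ _ hx').1 (i + 1) ⟨by omega, by have := Finset.mem_range.1 hi; omega⟩).1]

open Relation

/-! ### The inequalities -/

theorem stringLength_eq {X : Type*} {g : X → Option X} {N : X → ℕ}
    (h0 : ∀ x, g x = none ↔ N x = 0) (h1 : ∀ x y, g x = some y → N x = N y + 1) (x : X) :
    stringLength g x = N x := by
  have hnone : ∀ m, (fun o : Option X => o.bind g)^[m] none = none := by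
    intro m
    induction m with
    | zero => rfl
    | succ m ih => rw [Function.iterate_succ_apply]; exact ih
  have key : ∀ m x, (fun o : Option X => o.bind g)^[m] (some x) ≠ none ↔ m ≤ N x := by
    intro m
    induction m with
    | zero => simp
    | succ m ih =>
      intro x
      rw [Function.iterate_succ_apply]
      simp only [Option.bind_some]
      cases hg : g x with
      | none =>
        have := (h0 x).1 hg
        rw [hnone]
        simp [this]
      | some y =>
        rw [ih, h1 x y hg]
        omega
  unfold stringLength
  simp only [key]
  exact csSup_Iic

section

variable {n s : ℕ}

theorem stringLength_classF (hn : 4 ≤ n) {i : ℕ} (hi : 1 ≤ i ∧ i ≤ n) (T : Btilde n s) :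
    stringLength (classF i) T = wordPhi n i (word T) :=
  stringLength_eq (N := fun T : Btilde n s => wordPhi n i (word T))
    (fun T => (classF_eq_none_iff (by omega) hi).trans (wordF_eq_none_iff _))
    (fun T T' h => (wordF_some (by omega) ((classF_eq_some_iff (by omega) hi).1 h)).1) T

theorem stringLength_classE (hn : 4 ≤ n) {i : ℕ} (hi : 1 ≤ i ∧ i ≤ n) (T : Btilde n s) :
    stringLength (classE i) T = wordEps n i (word T) :=
  stringLength_eq (N := fun T : Btilde n s => wordEps n i (word T))
    (fun T => (classE_eq_none_iff (by omega) hi).trans (wordE_eq_none_iff _))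
    (fun T T' h => (wordF_some (by omega) ((wordE_eq_some_iff (by omega)).1
      ((classE_eq_some_iff (by omega) hi).1 h))).2.1) T

theorem stringLength_opF_zero (hn : 4 ≤ n) (T : Btilde n s) :
    stringLength (opF 0) T = wordPhi n 1 (word (sigma T)) := by
  have h1 : 1 ≤ 1 ∧ 1 ≤ n := ⟨le_rfl, by omega⟩
  refine stringLength_eq (N := fun T : Btilde n s => wordPhi n 1 (word (sigma T)))
    (fun T => ?_) (fun T T' h => ?_) T
  · rw [opF, if_pos rfl, Option.map_eq_none_iff, classF_eq_none_iff (by omega) h1,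
      wordF_eq_none_iff]
  · rw [opF, if_pos rfl] at h
    obtain ⟨V, hV, rfl⟩ := Option.map_eq_some_iff.1 h
    rw [sigma_sigma hn]
    exact (wordF_some (by omega) ((classF_eq_some_iff (by omega) h1).1 hV)).1

theorem stringLength_opE_zero (hn : 4 ≤ n) (T : Btilde n s) :
    stringLength (opE 0) T = wordEps n 1 (word (sigma T)) := by
  have h1 : 1 ≤ 1 ∧ 1 ≤ n := ⟨le_rfl, by omega⟩
  refine stringLength_eq (N := fun T : Btilde n s => wordEps n 1 (word (sigma T)))
    (fun T => ?_) (fun T T' h => ?_) T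
  · rw [opE, if_pos rfl, Option.map_eq_none_iff, classE_eq_none_iff (by omega) h1,
      wordE_eq_none_iff]
  · rw [opE, if_pos rfl] at h
    obtain ⟨V, hV, rfl⟩ := Option.map_eq_some_iff.1 h
    rw [sigma_sigma hn]
    exact (wordF_some (by omega) ((wordE_eq_some_iff (by omega)).1
      ((classE_eq_some_iff (by omega) h1).1 hV))).2.1

theorem cPairing_eq (f : ℕ → ℤ) : cPairing n (fun i => f (i : ℕ)) =
    f 0 + ∑ i ∈ Finset.range n, mark n (i + 1) * f (i + 1) := by
  unfold cPairing
  rw [Fin.sum_univ_succ, ← Fin.sum_univ_eq_sum_range (fun i => mark n (i + 1) * f (i + 1))]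
  simp [mark]

theorem cPairing_phiWt (hn : 4 ≤ n) (T : Btilde n s) : cPairing n (phiWt T) =
    wordPhi n 1 (word (sigma T)) +
      ∑ i ∈ Finset.range n, mark n (i + 1) * wordPhi n (i + 1) (word T) := by
  unfold phiWt
  rw [cPairing_eq (fun i => (stringLength (opF (n := n) (s := s) i) T : ℤ)),
    stringLength_opF_zero hn]
  congr 1
  refine Finset.sum_congr rfl fun i hi => ?_
  have : (opF (n := n) (s := s) (i + 1)) = classF (i + 1) := by funext T; simp [opF]
  rw [this, stringLength_classF hn ⟨by omega, by have := Finset.mem_range.1 hi; omega⟩]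

theorem cPairing_epsWt (hn : 4 ≤ n) (T : Btilde n s) : cPairing n (epsWt T) =
    wordEps n 1 (word (sigma T)) +
      ∑ i ∈ Finset.range n, mark n (i + 1) * wordEps n (i + 1) (word T) := by
  unfold epsWt
  rw [cPairing_eq (fun i => (stringLength (opE (n := n) (s := s) i) T : ℤ)),
    stringLength_opE_zero hn]
  congr 1
  refine Finset.sum_congr rfl fun i hi => ?_
  have : (opE (n := n) (s := s) (i + 1)) = classE (i + 1) := by funext T; simp [opE]
  rw [this, stringLength_classE hn ⟨by omega, by have := Finset.mem_range.1 hi; omega⟩]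

/-- Without `h_0`, the element `c` is the coroot of the highest root `ε₁ + ε₂`; the sum telescopes.
-/
theorem sum_mark_coroot (hn : 4 ≤ n) (w : List ℤ) :
    ∑ i ∈ Finset.range n, mark n (i + 1) * ((wordPhi n (i + 1) w : ℤ) - wordEps n (i + 1) w) =
      coord w 1 + coord w 2 := by
  obtain ⟨m, rfl⟩ : ∃ m, n = m + 4 := ⟨n - 4, by omega⟩
  have h : ∀ i ∈ Finset.range (m + 4),
      mark (m + 4) (i + 1) * ((wordPhi (m + 4) (i + 1) w : ℤ) - wordEps (m + 4) (i + 1) w) =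
      mark (m + 4) (i + 1) * (if i + 1 = m + 4 then coord w (m + 4 - 1) + coord w (m + 4)
        else coord w (i + 1) - coord w (i + 1 + 1)) := fun i hi => by
    rw [wordPhi_sub_wordEps_eq_coord ⟨by omega, by have := Finset.mem_range.1 hi; omega⟩ (by omega)]
  rw [Finset.sum_congr rfl h, Finset.sum_range_succ, Finset.sum_range_succ, Finset.sum_range_succ']
  have h2 : ∑ i ∈ Finset.range (m + 1), mark (m + 4) (i + 1 + 1) * (if i + 1 + 1 = m + 4 then
      coord w (m + 4 - 1) + coord w (m + 4) else coord w (i + 1 + 1) - coord w (i + 1 + 1 + 1)) =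
      2 * coord w 2 - 2 * coord w (m + 3) := by
    have h3 : ∀ i ∈ Finset.range (m + 1), mark (m + 4) (i + 1 + 1) * (if i + 1 + 1 = m + 4 then
      coord w (m + 4 - 1) + coord w (m + 4) else coord w (i + 1 + 1) - coord w (i + 1 + 1 + 1)) =
      2 * coord w (i + 2) - 2 * coord w (i + 1 + 2) := fun i hi => by
      have := Finset.mem_range.1 hi
      rw [if_neg (by omega), mark, if_pos (by omega)]
      ring
    rw [Finset.sum_congr rfl h3, Finset.sum_range_sub' (fun i => 2 * coord w (i + 2))]
  rw [h2]
  unfold mark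
  rw [if_neg (by omega), if_neg (by omega), if_neg (by omega), if_neg (by omega), if_neg (by omega),
    if_pos rfl]
  simp only [zero_add, one_mul]
  have : m + 4 - 1 = m + 3 := by omega
  rw [this]
  ring_nf

/-- Weights have level zero: node 0 contributes the value of `h_1` on the weight of `σ(T)`, which is
the negative of the classical part. -/
theorem cPairing_epsWt_eq (hn : 4 ≤ n) (T : Btilde n s) :
    cPairing n (epsWt T) = cPairing n (phiWt T) := by
  obtain ⟨k, p, -, -, -, -, h1, h2, -⟩ := sigma_spec hn T
  rw [cPairing_epsWt hn, cPairing_phiWt hn]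
  have h3 := sum_mark_coroot hn (word T)
  simp only [mul_sub, Finset.sum_sub_distrib] at h3
  have h4 := wordPhi_sub_wordEps_eq_coord (n := n) (i := 1) ⟨le_rfl, by omega⟩ (by omega)
    (word (sigma T))
  rw [if_neg (by omega), h1, h2] at h4
  linarith

/-- If `σ(T)` lies in the component `k` and its shape has first part `p`, node 0 gives at least `k -
p` and the other nodes at least the component index `s + p - k` of `T`. -/
theorem le_cPairing_phiWt_of_nonneg (hn : 4 ≤ n) (T : Btilde n s) (hc : 0 ≤ coord (word T) 1) :
    (s : ℤ) ≤ cPairing n (phiWt T) := by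
  obtain ⟨k, p, hp, hk, -, h1, -, -, -, U, hU, h2⟩ := sigma_spec hn (sigma T)
  rw [sigma_sigma hn] at h1
  have h3 := compIndex_le_sum_mark hn T hc
  have h4 := wordPhi_one_le_of_raises hn hU.1
  rw [cPairing_phiWt hn]
  omega

/-- The involution exchanges `φ_0` and `φ_1`, both of mark one, and fixes the other `φ_i`. -/
theorem cPairing_phiWt_sigma (hn : 4 ≤ n) (T : Btilde n s) :
    cPairing n (phiWt (sigma T)) = cPairing n (phiWt T) := by
  obtain ⟨k, p, -, -, -, -, -, -, h, -⟩ := sigma_spec hn T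
  rw [cPairing_phiWt hn, cPairing_phiWt hn, sigma_sigma hn]
  obtain ⟨m, rfl⟩ : ∃ m, n = m + 1 := ⟨n - 1, by omega⟩
  rw [Finset.sum_range_succ', Finset.sum_range_succ']
  have e : ∀ i ∈ Finset.range m, mark (m + 1) (i + 1 + 1) *
      (wordPhi (m + 1) (i + 1 + 1) (word (sigma T)) : ℤ) =
      mark (m + 1) (i + 1 + 1) * wordPhi (m + 1) (i + 1 + 1) (word T) := fun i hi => by
    rw [h (i + 1 + 1) ⟨by omega, by have := Finset.mem_range.1 hi; omega⟩]
  rw [Finset.sum_congr rfl e]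
  have : mark (m + 1) (0 + 1) = 1 := by unfold mark; rw [if_neg (by omega)]
  rw [this]
  ring

theorem le_cPairing_phiWt (hn : 4 ≤ n) (T : Btilde n s) : (s : ℤ) ≤ cPairing n (phiWt T) := by
  rcases le_or_gt 0 (coord (word T) 1) with hc | hc
  · exact le_cPairing_phiWt_of_nonneg hn T hc
  · rw [← cPairing_phiWt_sigma hn]
    refine le_cPairing_phiWt_of_nonneg hn _ ?_
    obtain ⟨k, p, -, -, -, -, h, -⟩ := sigma_spec hn T
    omega

end

end KRCrystal

theorem lemma7p10 (n s : ℕ) (hn : 4 ≤ n) (t : KRCrystal.Btilde n s) :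
    (s : ℤ) ≤ KRCrystal.cPairing n (KRCrystal.epsWt t) ∧
      (s : ℤ) ≤ KRCrystal.cPairing n (KRCrystal.phiWt t) := by
  rw [KRCrystal.cPairing_epsWt_eq hn]
  exact ⟨KRCrystal.le_cPairing_phiWt hn t, KRCrystal.le_cPairing_phiWt hn t⟩
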